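/- Let $\mathrm{Sol}$ be the manifold $\mathbb{R}^3$ with the group law $(\alpha,\beta,\lambda)\cdot(x,y,z)=(e^{\lambda}x+\alpha,\,e^{-\lambda}y+\beta,\,z+\lambda)$ and the left-invariant Riemannian metric $e^{-2z}dx^2+e^{2z}dy^2+dz^2$. A closed Sol three-manifold is a compact smooth manifold $L$ diffeomorphic to a quotient $\Lambda\backslash\mathrm{Sol}$, where $\Lambda$ is a discrete group of isometries of $\mathrm{Sol}$ acting without fixed points. A smoothly embedded connected surface in $L$ is called one-sided if its normal line bundle is nontrivial, and it is said to have nonorientable neighborhood if none of its open neighborhoods in $L$ is orientable (equivalently, its tubular neighborhoods are nonorientable). Let $L$ be a closed Sol three-manifold. Then: 1. $L$ contains no smoothly embedded real projective plane $\mathbb{RP}^2$; 2. $L$ contains no smoothly embedded one-sided two-torus; 3. $L$ contains no smoothly embedded one-sided Klein bottle with nonorientable neighborhood. -/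

import Mathlib

open Set Topology Manifold
open scoped Manifold ContDiff EuclideanSpace

noncomputable section

attribute [local instance 2000] chartedSpaceSelf

/-! ### The Riemannian manifold Sol -/

/-- The underlying manifold of the Lie group `Sol = ℝ² ⋊ ℝ`, whose group law is
`(α, β, l) * (x, y, z) = (exp l * x + α, exp (-l) * y + β, z + l)`; points are triples
`p = (x, y, z) = (p 0, p 1, p 2)`. Only the manifold structure of `ℝ³` is used, not its
Euclidean metric. -/
abbrev Sol : Type := EuclideanSpace ℝ (Fin 3)

/-- The coefficient of the `i`-th component in the left-invariant frame
`X = exp z ∂x`, `Y = exp (-z) ∂y`, `Z = ∂z`: a tangent vector `v` at `p` is equal to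
`solCoeff p 0 * v 0 • X + solCoeff p 1 * v 1 • Y + solCoeff p 2 * v 2 • Z`. -/
def solCoeff (p : Sol) : Fin 3 → ℝ := ![Real.exp (-p 2), Real.exp (p 2), 1]

/-- The left-invariant metric for which `(X, Y, Z)` is orthonormal, as a bilinear form at `p`:
`exp (-2 z) dx² + exp (2 z) dy² + dz²`. -/
def solInner (p : Sol) : Sol →L[ℝ] Sol →L[ℝ] ℝ :=
  ∑ i, (solCoeff p i) ^ 2 •
    ((EuclideanSpace.proj i : Sol →L[ℝ] ℝ).smulRight (EuclideanSpace.proj i : Sol →L[ℝ] ℝ))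

theorem solInner_apply (p u v : Sol) :
    solInner p u v = ∑ i, (solCoeff p i * u i) * (solCoeff p i * v i) := by
  simp only [solInner, sum_apply, smul_apply, ContinuousLinearMap.smulRight_apply, smul_eq_mul]
  refine Finset.sum_congr rfl fun i _ => ?_
  change solCoeff p i ^ 2 * (u i * v i) = _
  ring

theorem solCoeff_pos (p : Sol) (i : Fin 3) : 0 < solCoeff p i := by
  fin_cases i <;> simp [solCoeff, Real.exp_pos]

theorem solInner_symm (p u v : Sol) : solInner p u v = solInner p v u := by
  rw [solInner_apply, solInner_apply]
  exact Finset.sum_congr rfl fun i _ => by ring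

theorem solInner_pos (p v : Sol) (hv : v ≠ 0) : 0 < solInner p v v := by
  rw [solInner_apply]
  have : ∃ i, v i ≠ 0 := by
    by_contra! h
    exact hv (by ext i; simpa using h i)
  obtain ⟨i, hi⟩ := this
  refine Finset.sum_pos' (fun i _ => mul_self_nonneg _) ⟨i, Finset.mem_univ i, ?_⟩
  exact mul_self_pos.2 (mul_ne_zero (solCoeff_pos p i).ne' hi)

theorem solInner_isVonNBounded (p : Sol) :
    Bornology.IsVonNBounded ℝ {v : Sol | solInner p v v < 1} := by
  rw [NormedSpace.isVonNBounded_iff]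
  refine (Metric.isBounded_iff_subset_closedBall 0).2 ⟨√(∑ i, ((solCoeff p i)⁻¹) ^ 2), ?_⟩
  intro v hv
  rw [mem_closedBall_zero_iff, EuclideanSpace.norm_eq]
  refine Real.sqrt_le_sqrt (Finset.sum_le_sum fun i _ => ?_)
  have h1 : (solCoeff p i * v i) ^ 2 ≤ 1 := by
    have hv' : solInner p v v < 1 := hv
    rw [solInner_apply] at hv'
    have := Finset.single_le_sum (f := fun i => (solCoeff p i * v i) * (solCoeff p i * v i))
      (fun i _ => mul_self_nonneg _) (Finset.mem_univ i)
    simp only at this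
    nlinarith
  have h2 := solCoeff_pos p i
  rw [Real.norm_eq_abs, sq_abs, inv_pow, ← one_div, le_div_iff₀ (pow_pos h2 2)]
  nlinarith

theorem contDiff_solInner : ContDiff ℝ ∞ solInner := by
  unfold solInner
  refine ContDiff.sum fun i _ => ?_
  suffices h : ContDiff ℝ ∞ fun p : Sol => solCoeff p i from
    (ContinuousLinearMap.toSpanSingleton ℝ _).contDiff.comp (h.pow 2)
  fin_cases i
  · change ContDiff ℝ ∞ fun p : Sol => Real.exp (-p 2)
    fun_prop
  · change ContDiff ℝ ∞ fun p : Sol => Real.exp (p 2)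
    fun_prop
  · exact contDiff_const

/-- The Riemannian metric of Sol. -/
def solMetric : Bundle.ContMDiffRiemannianMetric 𝓘(ℝ, Sol) ∞ Sol
    (fun p : Sol => TangentSpace 𝓘(ℝ, Sol) p) where
  inner p := solInner p
  symm p v w := solInner_symm p v w
  pos p v hv := solInner_pos p v hv
  isVonNBounded p := solInner_isVonNBounded p
  contMDiff := by
    intro x
    refine (Bundle.contMDiffAt_section x).2 ?_
    refine contDiff_solInner.contMDiff.contMDiffAt.congr_of_eventuallyEq (.of_forall fun y => ?_)
    dsimp only
    erw [hom_trivializationAt_apply]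
    ext v w
    erw [inCoordinates_apply_eq₂ (mem_univ _) (mem_univ _) (mem_univ _)]
    have hs : ∀ u : Sol,
        (trivializationAt Sol (TangentSpace 𝓘(ℝ, Sol)) x).symm y u = u := fun u =>
      (Bundle.Trivialization.symmL_apply (R := ℝ) _ (mem_univ _) _).symm.trans
        (congrArg (fun T : Sol →L[ℝ] Sol => T u) (TangentBundle.symmL_model_space x y))
    erw [hs v, hs w]
    simp
    rfl

/-- The group of isometries of Sol: the diffeomorphisms which preserve the Riemannian metric. -/
def solIsometryGroup : Subgroup (Sol ≃ₜ Sol) where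
  carrier := {Φ | ContDiff ℝ ∞ Φ ∧ ContDiff ℝ ∞ Φ.symm ∧
    ∀ p u v : Sol, solMetric.inner (Φ p) (fderiv ℝ Φ p u) (fderiv ℝ Φ p v) =
      solMetric.inner p u v}
  one_mem' := by
    refine ⟨contDiff_id, contDiff_id, fun p u v => ?_⟩
    have h : fderiv ℝ ((1 : Sol ≃ₜ Sol) : Sol → Sol) p = ContinuousLinearMap.id ℝ Sol :=
      fderiv_id
    rw [h]
    rfl
  mul_mem' := by
    rintro Φ Ψ ⟨hΦ, hΦ', hΦg⟩ ⟨hΨ, hΨ', hΨg⟩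
    refine ⟨hΦ.comp hΨ, hΨ'.comp hΦ', fun p u v => ?_⟩
    have h : fderiv ℝ ((Φ * Ψ : Sol ≃ₜ Sol) : Sol → Sol) p =
        (fderiv ℝ Φ (Ψ p)).comp (fderiv ℝ Ψ p) :=
      fderiv_comp p (hΦ.differentiable (by simp) _) (hΨ.differentiable (by simp) _)
    rw [h]
    exact (hΦg (Ψ p) _ _).trans (hΨg p u v)
  inv_mem' := by
    rintro Φ ⟨hΦ, hΦ', hΦg⟩
    refine ⟨hΦ', hΦ, fun p u v => ?_⟩
    have h : (fderiv ℝ Φ (Φ.symm p)).comp (fderiv ℝ Φ.symm p) = ContinuousLinearMap.id ℝ Sol := by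
      rw [← fderiv_comp p (hΦ.differentiable (by simp) _) (hΦ'.differentiable (by simp) _)]
      have : (Φ ∘ Φ.symm : Sol → Sol) = id := by ext x; simp
      rw [this]
      exact fderiv_id
    have h' : ∀ w, fderiv ℝ Φ (Φ.symm p) (fderiv ℝ Φ.symm p w) = w :=
      fun w => congrArg (fun T : Sol →L[ℝ] Sol => T w) h
    have key := hΦg (Φ.symm p) (fderiv ℝ Φ.symm p u) (fderiv ℝ Φ.symm p v)
    rw [h', h', Φ.apply_symm_apply] at key
    exact key.symm

/-! ### Quotient manifolds -/

/-- `q : M → N` exhibits the smooth manifold `N` as the quotient of the smooth manifold `M` by the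
relation `r`: it is a surjective local diffeomorphism whose fibres are the classes of `r`. -/
def IsQuotientManifold {n : ℕ} {M : Type*} [TopologicalSpace M]
    [ChartedSpace (EuclideanSpace ℝ (Fin n)) M] {N : Type*} [TopologicalSpace N]
    [ChartedSpace (EuclideanSpace ℝ (Fin n)) N] (r : M → M → Prop) (q : M → N) : Prop :=
  IsLocalDiffeomorph (𝓡 n) (𝓡 n) ∞ q ∧ Function.Surjective q ∧ ∀ x y, q x = q y ↔ r x y

/-- A Sol-manifold: a smooth 3-manifold which is the quotient of Sol by a discrete (for the
compact-open topology) group of isometries acting without fixed points. -/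
def IsSolManifold (L : Type*) [TopologicalSpace L]
    [ChartedSpace (EuclideanSpace ℝ (Fin 3)) L] : Prop :=
  ∃ Γ : Subgroup (Sol ≃ₜ Sol), Γ ≤ solIsometryGroup ∧
    IsDiscrete ((fun γ : Sol ≃ₜ Sol => (γ : C(Sol, Sol))) '' (Γ : Set (Sol ≃ₜ Sol))) ∧
    (∀ γ ∈ Γ, ∀ p : Sol, γ p = p → γ = 1) ∧
    ∃ q : Sol → L, IsQuotientManifold (n := 3) (fun x y => ∃ γ ∈ Γ, γ x = y) q

/-! ### Surfaces -/

/-- `S` is diffeomorphic to the real projective plane, the quotient of the unit sphere of `ℝ³` by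
the antipodal map. -/
def IsProjectivePlane (S : Type*) [TopologicalSpace S]
    [ChartedSpace (EuclideanSpace ℝ (Fin 2)) S] : Prop :=
  ∃ q : Metric.sphere (0 : EuclideanSpace ℝ (Fin 3)) 1 → S,
    IsQuotientManifold (n := 2) (fun x y => y = x ∨ y = -x) q

/-- `S` is diffeomorphic to the two-torus `ℝ² / ℤ²`. -/
def IsTwoTorus (S : Type*) [TopologicalSpace S]
    [ChartedSpace (EuclideanSpace ℝ (Fin 2)) S] : Prop :=
  ∃ q : EuclideanSpace ℝ (Fin 2) → S,
    IsQuotientManifold (n := 2) (fun x y => ∃ m n : ℤ, y 0 = x 0 + (m : ℝ) ∧ y 1 = x 1 + (n : ℝ)) q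

/-- `S` is diffeomorphic to the Klein bottle, the quotient of `ℝ²` by the group generated by
`(s, t) ↦ (s + 1, -t)` and `(s, t) ↦ (s, t + 1)`. -/
def IsKleinBottle (S : Type*) [TopologicalSpace S]
    [ChartedSpace (EuclideanSpace ℝ (Fin 2)) S] : Prop :=
  ∃ q : EuclideanSpace ℝ (Fin 2) → S,
    IsQuotientManifold (n := 2) (fun x y => ∃ m n : ℤ, y 0 = x 0 + (m : ℝ) ∧ y 1 = (-1 : ℝ) ^ m * x 1 + (n : ℝ)) q

/-! ### One-sidedness and orientability -/

/-- An (immersed) surface `f : S → L` in a 3-manifold is two-sided if its normal bundle is trivial,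
that is, if there is a continuous vector field along `f` which is nowhere tangent to the surface. -/
def IsTwoSided {S L : Type*} [TopologicalSpace S] [ChartedSpace (EuclideanSpace ℝ (Fin 2)) S]
    [TopologicalSpace L] [ChartedSpace (EuclideanSpace ℝ (Fin 3)) L]
    [IsManifold (𝓡 3) ∞ L] (f : S → L) : Prop :=
  ∃ v : ∀ x : S, TangentSpace (𝓡 3) (f x),
    Continuous (fun x => (⟨f x, v x⟩ : TangentBundle (𝓡 3) L)) ∧
    ∀ x, v x ∉ range (mfderiv (𝓡 2) (𝓡 3) f x)

/-- A smooth `n`-manifold is orientable if it has an atlas (of smoothly compatible charts) whose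
coordinate changes all have positive Jacobian determinant. -/
def IsOrientableManifold (n : ℕ) (M : Type*) [TopologicalSpace M]
    [ChartedSpace (EuclideanSpace ℝ (Fin n)) M] : Prop :=
  ∃ A ⊆ IsManifold.maximalAtlas (𝓡 n) ∞ M, (∀ x : M, ∃ e ∈ A, x ∈ e.source) ∧
    ∀ e ∈ A, ∀ e' ∈ A, ∀ x ∈ e.source ∩ e'.source,
      0 < (fderiv ℝ (e' ∘ e.symm) (e x)).det

/-- `f : S → L` has nonorientable neighborhood: no open neighborhood of its image in `L` is
orientable. (Shrinking a neighborhood preserves orientability, so for an embedded compact surface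
this says that its tubular neighborhoods are nonorientable.) -/
def HasNonorientableNeighborhood {S L : Type*}
    [TopologicalSpace L] [ChartedSpace (EuclideanSpace ℝ (Fin 3)) L] (f : S → L) : Prop :=
  ∀ U : TopologicalSpace.Opens L, range f ⊆ U → ¬ IsOrientableManifold 3 U

end

/-!
Bochner's formula shows that the derivative of an isometry of Sol is constant in the left-invariant
frame, so an isometry is either straight, `(x, y, z) ↦ (± eˡ x + a, ± e⁻ˡ y + b, z + l)`, or such a
map composed with the exchange `(x, y, z) ↦ (y, x, -z)`.

Since `L = Γ \ Sol` is compact, `Γ` contains a straight isometry with `l ≠ 0`, which contracts one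
horizontal direction. Hence, by discreteness, `Γ` contains no horizontal glide reflections, and
every orientation-reversing element of `Γ` is straight with `l ≠ 0`: it preserves a unique vertical
axis.

The surface in `L` lifts to a closed surface in `Sol = ℝ³` preserved by a subgroup `H` of `Γ`, and
it is two-sided as soon as `H` preserves the two sides of its lift. This is so if `H` preserves a
vertical axis: an `H`-invariant distance from the axis is bounded on the lift, and the points far
from the axis form a connected invariant set disjoint from the lift.

* Torus: `H` is abelian. If some element of `H` reverses the orientation, `H` preserves its axis.
  Otherwise the cross product of the coordinate vector fields of the plane parametrizing the lift
  descends to the torus and trivializes its normal bundle.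
* Klein bottle: `H` is generated by `α` and `β` with `β α β = α`, and this forces `β` to preserve
  orientation. If `α` does so too, the surface has an orientable neighborhood. Otherwise `α` has an
  axis, the relation forces `β = 1`, and `H` preserves that axis.
* Projective plane: `Γ` has no elements of order two, so the sphere covering the surface lifts to an
  even immersion in `ℝ³`, with even normals. Its differential, completed by the normals in the
  radial direction, would be an odd map from the sphere to `GL(3, ℝ)`; but its determinant is odd,
  hence vanishes somewhere.
-/

noncomputable section

attribute [local instance 2000] chartedSpaceSelf

/-! ### The isometries of Sol -/

section SolFrame

variable {S R : Type*} [CommRing S] [CommRing R]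

/-- The Christoffel symbols of Sol in its left-invariant frame `E = (X, Y, Z)`:
`∇_{E j} E k = ∑ i, solChristoffel j k i • E i`. -/
def solChristoffel (j k i : Fin 3) : R :=
  (![![![0, 0, 1], 0, ![-1, 0, 0]], ![0, ![0, 0, -1], ![0, 1, 0]], 0] :
    Fin 3 → Fin 3 → Fin 3 → R) j k i

variable [Algebra S R]

/-- Three derivations with the Lie brackets of the left-invariant frame of Sol, that is, for which
the connection with symbols `solChristoffel` has no torsion. -/
def IsSolFrame (D : Fin 3 → Derivation S R R) : Prop :=
  ∀ j k f, D j (D k f) - D k (D j f) =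
    ∑ i, (solChristoffel j k i - solChristoffel k j i) * D i f

/-- The second fundamental form `∇dΦ` of a map `Φ` into Sol whose differential has the entries `A`
in the frame `D` of the source and the left-invariant frame of the target. -/
def secondFundamentalForm (D : Fin 3 → Derivation S R R) (A : Matrix (Fin 3) (Fin 3) R)
    (i j k : Fin 3) : R :=
  D j (A i k) - ∑ m, solChristoffel j k m * A i m +
    ∑ p, ∑ q, A p j * A q k * solChristoffel p q i

variable {D : Fin 3 → Derivation S R R} {A : Matrix (Fin 3) (Fin 3) R}

theorem secondFundamentalForm_antisymm (hA : A.transpose * A = 1) (j k l : Fin 3) :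
    ∑ i, secondFundamentalForm D A i j k * A i l +
      ∑ i, secondFundamentalForm D A i j l * A i k = 0 := by
  have entry (k l : Fin 3) : ∑ i, A i k * A i l = if k = l then 1 else 0 := by
    simpa only [Matrix.mul_apply, Matrix.transpose_apply, Matrix.one_apply] using congr($hA k l)
  have deriv_entry : ∑ i, (D j (A i k) * A i l + D j (A i l) * A i k) = 0 := by
    calc ∑ i, (D j (A i k) * A i l + D j (A i l) * A i k)
        = D j (∑ i, A i k * A i l) := by
          rw [map_sum]
          refine Finset.sum_congr rfl fun i _ => ?_
          simp only [Derivation.leibniz, smul_eq_mul]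
          ring
      _ = 0 := by rw [entry]; split_ifs <;> simp
  have target_antisymm : ∑ i, ((∑ p, ∑ q, A p j * A q k * solChristoffel p q i) * A i l +
      (∑ p, ∑ q, A p j * A q l * solChristoffel p q i) * A i k) = 0 := by
    simp [Fin.sum_univ_three, solChristoffel]
    ring
  have source (k l : Fin 3) :
      ∑ i, (∑ m, solChristoffel j k m * A i m) * A i l = (solChristoffel j k l : R) := by
    calc ∑ i, (∑ m, solChristoffel j k m * A i m) * A i l
        = ∑ m, solChristoffel j k m * ∑ i, A i m * A i l := by
          simp only [Finset.sum_mul, Finset.mul_sum, mul_assoc]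
          exact Finset.sum_comm
      _ = solChristoffel j k l := by simp [entry]
  have source_antisymm : (solChristoffel j k l + solChristoffel j l k : R) = 0 := by
    fin_cases j <;> fin_cases k <;> fin_cases l <;> simp [solChristoffel]
  simp only [secondFundamentalForm, add_mul, sub_mul, Finset.sum_add_distrib,
    Finset.sum_sub_distrib, source] at deriv_entry target_antisymm ⊢
  linear_combination deriv_entry + target_antisymm - source_antisymm

/-- The algebra behind the uniqueness of the Levi-Civita connection. -/
theorem eq_zero_of_symm_of_antisymm [IsAddTorsionFree R] {ι : Type*} [Fintype ι]
    [DecidableEq ι] {A : Matrix ι ι R} (hA : A * A.transpose = 1) {T : ι → ι → ι → R}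
    (symm : ∀ i j k, T i j k = T i k j)
    (antisymm : ∀ j k l, ∑ i, T i j k * A i l + ∑ i, T i j l * A i k = 0) (i j k : ι) :
    T i j k = 0 := by
  have contraction_eq_zero (j k l : ι) : ∑ i, T i j k * A i l = 0 := by
    have symm' (j k l : ι) : ∑ i, T i j k * A i l = ∑ i, T i k j * A i l :=
      Finset.sum_congr rfl fun i _ => by rw [symm]
    refine self_eq_neg.1 ?_
    linear_combination
      antisymm j k l - antisymm l j k + antisymm k l j - symm' j l k - symm' k j l + symm' l k j
  calc T i j k = ∑ m, T m j k * (A * A.transpose) i m := by simp [hA, Matrix.one_apply]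
    _ = ∑ l, (∑ m, T m j k * A m l) * A i l := by
      simp only [Matrix.mul_apply, Matrix.transpose_apply, Finset.mul_sum, Finset.sum_mul]
      rw [Finset.sum_comm]
      exact Finset.sum_congr rfl fun l _ => Finset.sum_congr rfl fun m _ => by ring
    _ = 0 := by simp [contraction_eq_zero]

/-- Isometries are affine for the Levi-Civita connections. -/
theorem secondFundamentalForm_eq_zero [IsAddTorsionFree R] (hA : A.transpose * A = 1)
    (symm : ∀ i j k, secondFundamentalForm D A i j k = secondFundamentalForm D A i k j)
    (i j k : Fin 3) : secondFundamentalForm D A i j k = 0 :=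
  eq_zero_of_symm_of_antisymm (mul_eq_one_comm.1 hA) symm
    (secondFundamentalForm_antisymm hA) i j k

/-- The Hessian `∇df` of a function on Sol. -/
def solHessian (D : Fin 3 → Derivation S R R) (f : R) (j k : Fin 3) : R :=
  D j (D k f) - ∑ i, solChristoffel j k i * D i f

/-- The trace of the Hessian; the Christoffel symbols `∑ j, solChristoffel j j i` vanish. -/
def solLaplacian (D : Fin 3 → Derivation S R R) (f : R) : R := ∑ j, D j (D j f)

theorem solLaplacian_eq_sum_solHessian (f : R) : solLaplacian D f = ∑ j, solHessian D f j j := by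
  simp [solLaplacian, solHessian, Fin.sum_univ_three, solChristoffel]

namespace IsSolFrame

theorem comm_zero_one (hD : IsSolFrame D) (f : R) : D 0 (D 1 f) = D 1 (D 0 f) :=
  sub_eq_zero.1 (by simpa [solChristoffel] using hD 0 1 f)

theorem comm_two_zero (hD : IsSolFrame D) (f : R) : D 2 (D 0 f) = D 0 (D 2 f) + D 0 f := by
  rw [← sub_eq_iff_eq_add']
  simpa [Fin.sum_univ_three, solChristoffel] using hD 2 0 f

theorem comm_two_one (hD : IsSolFrame D) (f : R) : D 2 (D 1 f) = D 1 (D 2 f) - D 1 f := by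
  rw [sub_eq_add_neg, ← sub_eq_iff_eq_add']
  simpa [Fin.sum_univ_three, solChristoffel] using hD 2 1 f

theorem solLaplacian_frame (hD : IsSolFrame D) (f : R) (k : Fin 3) :
    solLaplacian D (D k f) = D k (solLaplacian D f) +
      ![D 0 (D 2 f) + D 2 (D 0 f), -(D 1 (D 2 f) + D 2 (D 1 f)),
        2 * (D 1 (D 1 f) - D 0 (D 0 f))] k := by
  fin_cases k <;>
    simp [solLaplacian, Fin.sum_univ_three, hD.comm_zero_one, hD.comm_two_zero, hD.comm_two_one] <;>
    ring

theorem solLaplacian_mul_self (f : R) :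
    solLaplacian D (f * f) = 2 * (∑ j, D j f * D j f + f * solLaplacian D f) := by
  simp [solLaplacian, Fin.sum_univ_three]
  ring

/-- Bochner's formula; the last term comes from the Ricci tensor `-2 dz²` of Sol. -/
theorem bochner (hD : IsSolFrame D) (f : R) :
    solLaplacian D (∑ k, D k f * D k f) =
      2 * (∑ j, ∑ k, solHessian D f j k * solHessian D f j k +
        ∑ k, D k f * D k (solLaplacian D f) - 2 * (D 2 f * D 2 f)) := by
  have laplacian_sum : solLaplacian D (∑ k, D k f * D k f) =
      ∑ k, solLaplacian D (D k f * D k f) := by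
    simp only [solLaplacian, map_sum]
    exact Finset.sum_comm
  rw [laplacian_sum]
  simp only [solLaplacian_mul_self, hD.solLaplacian_frame, Fin.sum_univ_three, solHessian]
  simp [solChristoffel, hD.comm_zero_one, hD.comm_two_zero, hD.comm_two_one]
  ring

end IsSolFrame

/-- The matrix `A`, in the frame `D` and the left-invariant frame of Sol, of the differential of an
isometry of Sol with vertical coordinate `c`. -/
structure IsIsometryMatrix (D : Fin 3 → Derivation S R R) (A : Matrix (Fin 3) (Fin 3) R)
    (c : R) : Prop where
  isSolFrame : IsSolFrame D
  orthogonal : A.transpose * A = 1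
  affine : ∀ i j k, secondFundamentalForm D A i j k = 0
  vertical : ∀ j, A 2 j = D j c

namespace IsIsometryMatrix

variable {c : R} (h : IsIsometryMatrix D A c)

include h

theorem sum_row_mul (i k : Fin 3) : ∑ j, A i j * A k j = if i = k then 1 else 0 := by
  simpa only [Matrix.mul_apply, Matrix.transpose_apply, Matrix.one_apply] using
    congr($(mul_eq_one_comm.1 h.orthogonal) i k)

theorem sum_column_mul (j l : Fin 3) : ∑ i, A i j * A i l = if j = l then 1 else 0 := by
  simpa only [Matrix.mul_apply, Matrix.transpose_apply, Matrix.one_apply] using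
    congr($h.orthogonal j l)

theorem solHessian_vertical (j k : Fin 3) :
    solHessian D c j k = A 1 j * A 1 k - A 0 j * A 0 k := by
  have := h.affine 2 j k
  simp only [secondFundamentalForm, h.vertical] at this
  simp only [solHessian]
  simp [Fin.sum_univ_three, solChristoffel] at this ⊢
  linear_combination this

theorem solLaplacian_vertical : solLaplacian D c = 0 := by
  rw [solLaplacian_eq_sum_solHessian]
  simp only [h.solHessian_vertical, Finset.sum_sub_distrib, h.sum_row_mul]
  simp

theorem sum_solHessian_vertical_sq :
    ∑ j, ∑ k, solHessian D c j k * solHessian D c j k = 2 := by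
  have h00 := h.sum_row_mul 0 0
  have h11 := h.sum_row_mul 1 1
  have h01 := h.sum_row_mul 0 1
  simp only [Fin.sum_univ_three, h.solHessian_vertical, if_true, zero_ne_one, if_false]
    at h00 h11 h01 ⊢
  linear_combination (A 0 0 * A 0 0 + A 0 1 * A 0 1 + A 0 2 * A 0 2 + 1) * h00 +
    (A 1 0 * A 1 0 + A 1 1 * A 1 1 + A 1 2 * A 1 2 + 1) * h11 -
    2 * (A 0 0 * A 1 0 + A 0 1 * A 1 1 + A 0 2 * A 1 2) * h01

/-- Bochner's formula for the harmonic function `c` with unit gradient gives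
`0 = |∇dc|² + Ric (∇c) = 2 - 2 (Z c)²`. -/
theorem vertical_mul_self [IsAddTorsionFree R] : A 2 2 * A 2 2 = 1 := by
  have unit_gradient : ∑ k, D k c * D k c = 1 := by
    simpa only [← h.vertical, if_true] using h.sum_row_mul 2 2
  have laplacian_one : solLaplacian D 1 = 0 := by simp [solLaplacian]
  have bochner := h.isSolFrame.bochner c
  rw [unit_gradient, laplacian_one, h.solLaplacian_vertical, h.sum_solHessian_vertical_sq,
    ← h.vertical] at bochner
  simp only [map_zero, mul_zero, Finset.sum_const_zero, add_zero] at bochner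
  have four_nsmul : 4 • (A 2 2 * A 2 2 - 1) = 0 := by
    rw [nsmul_eq_mul]
    linear_combination bochner
  exact sub_eq_zero.1 ((smul_eq_zero_iff_right four_ne_zero).1 four_nsmul)

end IsIsometryMatrix

end SolFrame

section Isometries

/-- The algebra of smooth functions on Sol. -/
abbrev SolFun : Type := C^∞⟮𝓘(ℝ, Sol), Sol; ℝ⟯

instance : IsAddTorsionFree SolFun :=
  @IsAddTorsionFree.of_module_rat SolFun _ (Module.compHom SolFun (algebraMap ℚ ℝ))

theorem SolFun.contDiff (f : SolFun) : ContDiff ℝ ∞ f := f.contMDiff.contDiff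

theorem SolFun.differentiable (f : SolFun) : Differentiable ℝ f :=
  f.contDiff.differentiable (by simp)

theorem contDiff_solCoeff (i : Fin 3) : ContDiff ℝ ∞ fun p : Sol => solCoeff p i := by
  fin_cases i
  · change ContDiff ℝ ∞ fun p : Sol => Real.exp (-p 2)
    fun_prop
  · change ContDiff ℝ ∞ fun p : Sol => Real.exp (p 2)
    fun_prop
  · exact contDiff_const

/-- The left-invariant orthonormal frame `(X, Y, Z)` of Sol. -/
def solFrame (i : Fin 3) (p : Sol) : Sol :=
  (solCoeff p i)⁻¹ • EuclideanSpace.single i 1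

theorem contDiff_solFrame (i : Fin 3) : ContDiff ℝ ∞ (solFrame i) :=
  ((contDiff_solCoeff i).inv fun p => (solCoeff_pos p i).ne').smul contDiff_const

theorem eq_sum_solFrame (p v : Sol) : v = ∑ j, (solCoeff p j * v j) • solFrame j p := by
  ext i
  have := (solCoeff_pos p i).ne'
  simp [solFrame, smul_smul, Pi.single_apply]
  field_simp

theorem solInner_solFrame (p : Sol) (k l : Fin 3) :
    solInner p (solFrame k p) (solFrame l p) = if k = l then 1 else 0 := by
  rw [solInner_apply, Finset.sum_eq_single k]
  · have := (solCoeff_pos p k).ne'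
    obtain rfl | hkl := eq_or_ne k l
    · simp [solFrame, this]
    · simp [solFrame, hkl]
  · intro i _ hik
    simp [solFrame, hik]
  · simp

theorem hasFDerivAt_solCoeff (i : Fin 3) (p : Sol) :
    HasFDerivAt (fun p : Sol => solCoeff p i)
      (((![-1, 1, 0] : Fin 3 → ℝ) i * solCoeff p i) •
        (EuclideanSpace.proj 2 : Sol →L[ℝ] ℝ)) p := by
  have hp : HasFDerivAt (fun p : Sol => p 2) (EuclideanSpace.proj 2 : Sol →L[ℝ] ℝ) p :=
    (EuclideanSpace.proj 2 : Sol →L[ℝ] ℝ).hasFDerivAt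
  fin_cases i
  · simpa [solCoeff] using hp.fun_neg.exp
  · simpa [solCoeff] using hp.exp
  · simpa [solCoeff] using hasFDerivAt_const (1 : ℝ) p

theorem fderiv_solFrame_apply (i : Fin 3) (p v : Sol) :
    fderiv ℝ (solFrame i) p v = ((![1, -1, 0] : Fin 3 → ℝ) i * v 2) • solFrame i p := by
  have hi := (solCoeff_pos p i).ne'
  have := (((hasDerivAt_inv hi).comp_hasFDerivAt p (hasFDerivAt_solCoeff i p)).smul_const
    (EuclideanSpace.single i (1 : ℝ))).fderiv
  refine congr($this v).trans ?_
  fin_cases i <;> simp [solFrame, smul_smul] <;> field_simp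

/-- Differentiation along the left-invariant frame. -/
def frameDeriv (i : Fin 3) : Derivation ℝ SolFun SolFun :=
  Derivation.mk'
    { toFun := fun f => ⟨fun p => fderiv ℝ f p (solFrame i p),
        ((f.contDiff.fderiv_right (m := ∞) (by simp)).clm_apply
          (contDiff_solFrame i)).contMDiff⟩
      map_add' := fun f g => by
        ext p
        change fderiv ℝ (f + g : Sol → ℝ) p _ = _
        rw [fderiv_add (f.differentiable p) (g.differentiable p)]
        rfl
      map_smul' := fun r f => by
        ext p
        change fderiv ℝ (r • f : Sol → ℝ) p _ = _
        rw [fderiv_const_smul (f.differentiable p)]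
        rfl }
    (fun f g => by
      ext p
      change fderiv ℝ (f * g : Sol → ℝ) p _ = _
      rw [fderiv_mul (f.differentiable p) (g.differentiable p)]
      rfl)

theorem frameDeriv_apply (i : Fin 3) (f : SolFun) (p : Sol) :
    frameDeriv i f p = fderiv ℝ f p (solFrame i p) := rfl

theorem frameDeriv_frameDeriv_apply (i j : Fin 3) (f : SolFun) (p : Sol) :
    frameDeriv i (frameDeriv j f) p =
      fderiv ℝ (fderiv ℝ f) p (solFrame i p) (solFrame j p) +
        fderiv ℝ f p (fderiv ℝ (solFrame j) p (solFrame i p)) := by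
  have hf : DifferentiableAt ℝ (fderiv ℝ f) p :=
    (f.contDiff.fderiv_right (m := ∞) (by simp)).differentiable (by simp) p
  have hE : DifferentiableAt ℝ (solFrame j) p := (contDiff_solFrame j).differentiable (by simp) p
  change fderiv ℝ (fun p => fderiv ℝ f p (solFrame j p)) p (solFrame i p) = _
  rw [fderiv_clm_apply hf hE]
  simp [add_comm]

theorem isSolFrame_frameDeriv : IsSolFrame frameDeriv := by
  intro j k f
  ext p
  have symm : IsSymmSndFDerivAt ℝ f p :=
    f.contDiff.contDiffAt.isSymmSndFDerivAt
      (by simpa using (WithTop.coe_le_coe.2 le_top : ((2 : ℕ∞) : WithTop ℕ∞) ≤ ∞))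
  have bracket : frameDeriv j (frameDeriv k f) p - frameDeriv k (frameDeriv j f) p =
      (![1, -1, 0] : Fin 3 → ℝ) k * solFrame j p 2 * frameDeriv k f p -
        (![1, -1, 0] : Fin 3 → ℝ) j * solFrame k p 2 * frameDeriv j f p := by
    rw [frameDeriv_frameDeriv_apply, frameDeriv_frameDeriv_apply, symm.eq,
      fderiv_solFrame_apply, fderiv_solFrame_apply, map_smul, map_smul]
    simp only [smul_eq_mul, frameDeriv_apply]
    ring
  refine bracket.trans ?_
  rw [Fin.sum_univ_three]
  fin_cases j <;> fin_cases k <;> simp [solFrame, solCoeff, solChristoffel]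

theorem exists_eq_add_const {f : Sol → ℝ} (hf : Differentiable ℝ f) (g : Sol →L[ℝ] ℝ)
    (h : ∀ p j, fderiv ℝ f p (solFrame j p) = g (solFrame j p)) : ∃ c, ∀ p, f p = g p + c := by
  have fderiv_sub_eq_zero (p : Sol) : fderiv ℝ (f - ⇑g) p = 0 := by
    rw [fderiv_sub (hf p) g.differentiableAt, g.fderiv, sub_eq_zero]
    ext v
    rw [eq_sum_solFrame p v]
    simp only [map_sum, map_smul, h]
  refine ⟨(f - ⇑g) 0, fun p => ?_⟩
  rw [← is_const_of_fderiv_eq_zero (𝕜 := ℝ) (hf.sub g.differentiable) fderiv_sub_eq_zero p 0]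
  simp

theorem eq_const_of_frameDeriv_eq_zero {f : SolFun} (h : ∀ j, frameDeriv j f = 0) (p : Sol) :
    f p = f 0 := by
  obtain ⟨c, hc⟩ := exists_eq_add_const f.differentiable 0 fun p j => by
    rw [← frameDeriv_apply, h]
    rfl
  simp [hc]

end Isometries

section Classification

theorem fderiv_apply_coord {Φ : Sol → Sol} {p : Sol} (hΦ : DifferentiableAt ℝ Φ p) (v : Sol)
    (i : Fin 3) : fderiv ℝ (fun p => Φ p i) p v = fderiv ℝ Φ p v i :=
  congr($(((EuclideanSpace.proj i : Sol →L[ℝ] ℝ).hasFDerivAt.comp p hΦ.hasFDerivAt).fderiv) v)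

/-- A coordinate of a smooth map, as a smooth function. -/
def coordFun {Φ : Sol → Sol} (hΦ : ContDiff ℝ ∞ Φ) (i : Fin 3) : SolFun :=
  ⟨fun p => Φ p i, ((EuclideanSpace.proj i : Sol →L[ℝ] ℝ).contDiff.comp hΦ).contMDiff⟩

/-- The coefficient of the left-invariant coframe of Sol, pulled back by a smooth map. -/
def coeffFun {Φ : Sol → Sol} (hΦ : ContDiff ℝ ∞ Φ) (i : Fin 3) : SolFun :=
  ⟨fun p => solCoeff (Φ p) i, ((contDiff_solCoeff i).comp hΦ).contMDiff⟩

/-- The matrix of the differential of a smooth map in the left-invariant frame. -/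
def frameMatrix {Φ : Sol → Sol} (hΦ : ContDiff ℝ ∞ Φ) : Matrix (Fin 3) (Fin 3) SolFun :=
  Matrix.of fun i j => coeffFun hΦ i * frameDeriv j (coordFun hΦ i)

theorem frameMatrix_apply {Φ : Sol → Sol} (hΦ : ContDiff ℝ ∞ Φ) (i j : Fin 3) (p : Sol) :
    frameMatrix hΦ i j p = solCoeff (Φ p) i * fderiv ℝ Φ p (solFrame j p) i :=
  congr(solCoeff (Φ p) i * $(fderiv_apply_coord (hΦ.differentiable (by simp) p) _ i))

theorem frameMatrix_two {Φ : Sol → Sol} (hΦ : ContDiff ℝ ∞ Φ) (j : Fin 3) :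
    frameMatrix hΦ 2 j = frameDeriv j (coordFun hΦ 2) := by
  ext p
  exact one_mul _

theorem frameDeriv_coeffFun {Φ : Sol → Sol} (hΦ : ContDiff ℝ ∞ Φ) (i j : Fin 3) :
    frameDeriv j (coeffFun hΦ i) =
      (![-1, 1, 0] : Fin 3 → SolFun) i * (coeffFun hΦ i * frameMatrix hΦ 2 j) := by
  ext p
  have hp := hΦ.differentiable (by simp) p
  have := ((hasFDerivAt_solCoeff i (Φ p)).comp p hp.hasFDerivAt).fderiv
  rw [frameMatrix_two]
  have pointwise : fderiv ℝ (fun p => solCoeff (Φ p) i) p (solFrame j p) =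
      (![-1, 1, 0] : Fin 3 → ℝ) i *
        (solCoeff (Φ p) i * fderiv ℝ (fun p => Φ p 2) p (solFrame j p)) := by
    rw [fderiv_apply_coord hp, ← mul_assoc]
    exact congr($this (solFrame j p))
  refine pointwise.trans ?_
  fin_cases i <;> rfl

theorem secondFundamentalForm_frameMatrix_symm {Φ : Sol → Sol} (hΦ : ContDiff ℝ ∞ Φ)
    (i j k : Fin 3) :
    secondFundamentalForm frameDeriv (frameMatrix hΦ) i j k =
      secondFundamentalForm frameDeriv (frameMatrix hΦ) i k j := by
  have deriv_entry (j k : Fin 3) : frameDeriv j (frameMatrix hΦ i k) =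
      coeffFun hΦ i * frameDeriv j (frameDeriv k (coordFun hΦ i)) +
        (![-1, 1, 0] : Fin 3 → SolFun) i * (frameMatrix hΦ 2 j * frameMatrix hΦ i k) := by
    simp only [frameMatrix, Matrix.of_apply, Derivation.leibniz, smul_eq_mul, frameDeriv_coeffFun]
    ring
  have bracket : coeffFun hΦ i * (frameDeriv j (frameDeriv k (coordFun hΦ i)) -
      frameDeriv k (frameDeriv j (coordFun hΦ i))) =
        ∑ m, (solChristoffel j k m - solChristoffel k j m) * frameMatrix hΦ i m := by
    rw [isSolFrame_frameDeriv j k, Finset.mul_sum]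
    exact Finset.sum_congr rfl fun m _ => mul_left_comm _ _ _
  have target : ∑ p, ∑ q, frameMatrix hΦ p j * frameMatrix hΦ q k * solChristoffel p q i -
      ∑ p, ∑ q, frameMatrix hΦ p k * frameMatrix hΦ q j * solChristoffel p q i =
        (![-1, 1, 0] : Fin 3 → SolFun) i * (frameMatrix hΦ 2 k * frameMatrix hΦ i j -
          frameMatrix hΦ 2 j * frameMatrix hΦ i k) := by
    fin_cases i <;> simp [Fin.sum_univ_three, solChristoffel] <;> ring
  simp only [sub_mul, Finset.sum_sub_distrib] at bracket
  simp only [secondFundamentalForm, deriv_entry]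
  linear_combination bracket + target

theorem frameMatrix_orthogonal {Φ : Sol ≃ₜ Sol} (hΦ : Φ ∈ solIsometryGroup) :
    (frameMatrix hΦ.1).transpose * frameMatrix hΦ.1 = 1 := by
  ext k l p
  have isometry : solInner (Φ p) (fderiv ℝ Φ p (solFrame k p)) (fderiv ℝ Φ p (solFrame l p)) =
      solInner p (solFrame k p) (solFrame l p) := hΦ.2.2 p _ _
  rw [solInner_solFrame, solInner_apply] at isometry
  rw [Matrix.mul_apply, Fin.sum_univ_three]
  rw [Fin.sum_univ_three] at isometry
  simp only [← frameMatrix_apply hΦ.1] at isometry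
  refine Eq.trans isometry ?_
  rw [Matrix.one_apply]
  split_ifs <;> rfl

theorem isIsometryMatrix_frameMatrix {Φ : Sol ≃ₜ Sol} (hΦ : Φ ∈ solIsometryGroup) :
    IsIsometryMatrix frameDeriv (frameMatrix hΦ.1) (coordFun hΦ.1 2) where
  isSolFrame := isSolFrame_frameDeriv
  orthogonal := frameMatrix_orthogonal hΦ
  affine := secondFundamentalForm_eq_zero (frameMatrix_orthogonal hΦ)
    (secondFundamentalForm_frameMatrix_symm hΦ.1)
  vertical := frameMatrix_two hΦ.1

theorem SolFun.eq_zero_of_sum_mul_self {x y z : SolFun} (hz : z * z = 1)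
    (h : x * x + y * y + z * z = 1) : x = 0 ∧ y = 0 := by
  have pointwise (p : Sol) : x p * x p + y p * y p = 0 :=
    DFunLike.congr_fun (add_eq_right.1 (h.trans hz.symm)) p
  constructor <;> ext p
  · exact (mul_self_add_mul_self_eq_zero.1 (pointwise p)).1
  · exact (mul_self_add_mul_self_eq_zero.1 (pointwise p)).2

theorem frameMatrix_off_block {Φ : Sol ≃ₜ Sol} (hΦ : Φ ∈ solIsometryGroup) :
    frameMatrix hΦ.1 2 0 = 0 ∧ frameMatrix hΦ.1 2 1 = 0 ∧
      frameMatrix hΦ.1 0 2 = 0 ∧ frameMatrix hΦ.1 1 2 = 0 := by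
  have h := isIsometryMatrix_frameMatrix hΦ
  have row := h.sum_row_mul 2 2
  have column := h.sum_column_mul 2 2
  rw [Fin.sum_univ_three, if_pos rfl] at row column
  obtain ⟨h20, h21⟩ := SolFun.eq_zero_of_sum_mul_self h.vertical_mul_self row
  obtain ⟨h02, h12⟩ := SolFun.eq_zero_of_sum_mul_self h.vertical_mul_self column
  exact ⟨h20, h21, h02, h12⟩

theorem frameDeriv_frameMatrix_eq_zero {Φ : Sol ≃ₜ Sol} (hΦ : Φ ∈ solIsometryGroup)
    (i j k : Fin 3) : frameDeriv k (frameMatrix hΦ.1 i j) = 0 := by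
  obtain ⟨h20, h21, h02, h12⟩ := frameMatrix_off_block hΦ
  have affine := (isIsometryMatrix_frameMatrix hΦ).affine i k j
  revert affine
  fin_cases i <;> fin_cases j <;> fin_cases k <;>
    simp [secondFundamentalForm, Fin.sum_univ_three, solChristoffel, h20, h21, h02, h12]

/-- The differential of an isometry of Sol at the origin, in the left-invariant frame. -/
def rotationPart {Φ : Sol ≃ₜ Sol} (hΦ : Φ ∈ solIsometryGroup) : Matrix (Fin 3) (Fin 3) ℝ :=
  Matrix.of fun i j => frameMatrix hΦ.1 i j 0

theorem rotationPart_apply {Φ : Sol ≃ₜ Sol} (hΦ : Φ ∈ solIsometryGroup) (i j : Fin 3) (p : Sol) :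
    rotationPart hΦ i j = solCoeff (Φ p) i * fderiv ℝ Φ p (solFrame j p) i := by
  rw [← frameMatrix_apply hΦ.1]
  exact (eq_const_of_frameDeriv_eq_zero (fun k => frameDeriv_frameMatrix_eq_zero hΦ i j k) p).symm

theorem rotationPart_sum_row_mul {Φ : Sol ≃ₜ Sol} (hΦ : Φ ∈ solIsometryGroup) (i : Fin 3) :
    ∑ j, rotationPart hΦ i j * rotationPart hΦ i j = 1 := by
  have row := (isIsometryMatrix_frameMatrix hΦ).sum_row_mul i i
  rw [if_pos rfl, Fin.sum_univ_three] at row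
  rw [Fin.sum_univ_three]
  exact DFunLike.congr_fun row 0

theorem rotationPart_mul_vertical {Φ : Sol ≃ₜ Sol} (hΦ : Φ ∈ solIsometryGroup) :
    rotationPart hΦ 0 0 * (rotationPart hΦ 2 2 - 1) = 0 ∧
      rotationPart hΦ 0 1 * (rotationPart hΦ 2 2 + 1) = 0 ∧
      rotationPart hΦ 1 0 * (rotationPart hΦ 2 2 + 1) = 0 ∧
      rotationPart hΦ 1 1 * (rotationPart hΦ 2 2 - 1) = 0 := by
  obtain ⟨-, -, h02, h12⟩ := frameMatrix_off_block hΦ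
  have affine (i j) := (isIsometryMatrix_frameMatrix hΦ).affine i j 2
  have h00 : frameMatrix hΦ.1 0 0 + -(frameMatrix hΦ.1 0 0 * frameMatrix hΦ.1 2 2) = 0 := by
    simpa [secondFundamentalForm, Fin.sum_univ_three, solChristoffel, h02, h12] using affine 0 0
  have h01 : -frameMatrix hΦ.1 0 1 + -(frameMatrix hΦ.1 0 1 * frameMatrix hΦ.1 2 2) = 0 := by
    simpa [secondFundamentalForm, Fin.sum_univ_three, solChristoffel, h02, h12] using affine 0 1
  have h10 : frameMatrix hΦ.1 1 0 + frameMatrix hΦ.1 1 0 * frameMatrix hΦ.1 2 2 = 0 := by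
    simpa [secondFundamentalForm, Fin.sum_univ_three, solChristoffel, h02, h12] using affine 1 0
  have h11 : -frameMatrix hΦ.1 1 1 + frameMatrix hΦ.1 1 1 * frameMatrix hΦ.1 2 2 = 0 := by
    simpa [secondFundamentalForm, Fin.sum_univ_three, solChristoffel, h02, h12] using affine 1 1
  refine ⟨DFunLike.congr_fun (f := frameMatrix hΦ.1 0 0 * (frameMatrix hΦ.1 2 2 - 1)) (g := 0) ?_ 0,
    DFunLike.congr_fun (f := frameMatrix hΦ.1 0 1 * (frameMatrix hΦ.1 2 2 + 1)) (g := 0) ?_ 0,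
    DFunLike.congr_fun (f := frameMatrix hΦ.1 1 0 * (frameMatrix hΦ.1 2 2 + 1)) (g := 0) ?_ 0,
    DFunLike.congr_fun (f := frameMatrix hΦ.1 1 1 * (frameMatrix hΦ.1 2 2 - 1)) (g := 0) ?_ 0⟩
  · linear_combination -h00
  · linear_combination -h01
  · linear_combination h10
  · linear_combination h11

theorem rotationPart_off_block {Φ : Sol ≃ₜ Sol} (hΦ : Φ ∈ solIsometryGroup) :
    rotationPart hΦ 2 0 = 0 ∧ rotationPart hΦ 2 1 = 0 ∧
      rotationPart hΦ 0 2 = 0 ∧ rotationPart hΦ 1 2 = 0 := by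
  obtain ⟨h20, h21, h02, h12⟩ := frameMatrix_off_block hΦ
  exact ⟨DFunLike.congr_fun h20 0, DFunLike.congr_fun h21 0, DFunLike.congr_fun h02 0,
    DFunLike.congr_fun h12 0⟩

theorem exists_rotationPart_eq {Φ : Sol ≃ₜ Sol} (hΦ : Φ ∈ solIsometryGroup) :
    ∃ e₀ e₁ : ℝ, e₀ * e₀ = 1 ∧ e₁ * e₁ = 1 ∧
      (rotationPart hΦ = !![e₀, 0, 0; 0, e₁, 0; 0, 0, 1] ∨
        rotationPart hΦ = !![0, e₀, 0; e₁, 0, 0; 0, 0, -1]) := by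
  obtain ⟨h20, h21, h02, h12⟩ := rotationPart_off_block hΦ
  obtain ⟨h00, h01, h10, h11⟩ := rotationPart_mul_vertical hΦ
  have row := rotationPart_sum_row_mul hΦ
  simp only [Fin.sum_univ_three, Fin.forall_fin_succ, Fin.isValue, IsEmpty.forall_iff, and_true,
    Fin.succ_zero_eq_one, Fin.succ_one_eq_two, h20, h21, h02, h12, mul_zero, add_zero,
    zero_add] at row
  obtain ⟨row0, row1, row2⟩ := row
  rcases mul_self_eq_one_iff.1 row2 with h22 | h22
  · have h01 : rotationPart hΦ 0 1 = 0 := by rw [h22] at h01; linarith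
    have h10 : rotationPart hΦ 1 0 = 0 := by rw [h22] at h10; linarith
    refine ⟨rotationPart hΦ 0 0, rotationPart hΦ 1 1, by simpa [h01] using row0,
      by simpa [h10] using row1, Or.inl ?_⟩
    ext i j
    fin_cases i <;> fin_cases j <;> simp [*]
  · have h00 : rotationPart hΦ 0 0 = 0 := by rw [h22] at h00; linarith
    have h11 : rotationPart hΦ 1 1 = 0 := by rw [h22] at h11; linarith
    refine ⟨rotationPart hΦ 0 1, rotationPart hΦ 1 0, by simpa [h00] using row0,
      by simpa [h11] using row1, Or.inr ?_⟩
    ext i j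
    fin_cases i <;> fin_cases j <;> simp [*]

/-- `(x, y, z) ↦ (e₀ exp(l) x + a, e₁ exp(-l) y + b, z + l)`: a left translation of Sol followed
by reflections in the coordinate planes. -/
def IsStraight (e₀ e₁ l a b : ℝ) (Φ : Sol → Sol) : Prop :=
  ∀ p, Φ p 0 = e₀ * Real.exp l * p 0 + a ∧ Φ p 1 = e₁ * Real.exp (-l) * p 1 + b ∧
    Φ p 2 = p 2 + l

/-- `(x, y, z) ↦ (e₀ exp(l) y + a, e₁ exp(-l) x + b, -z + l)`: an isometry of Sol exchanging the
directions of the two horizontal coordinates. -/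
def IsSwap (e₀ e₁ l a b : ℝ) (Φ : Sol → Sol) : Prop :=
  ∀ p, Φ p 0 = e₀ * Real.exp l * p 1 + a ∧ Φ p 1 = e₁ * Real.exp (-l) * p 0 + b ∧
    Φ p 2 = -p 2 + l

theorem exists_coord_eq_add_const {Φ : Sol ≃ₜ Sol} (hΦ : Φ ∈ solIsometryGroup) (i : Fin 3)
    (g : Sol →L[ℝ] ℝ)
    (hg : ∀ p j, (solCoeff (Φ p) i)⁻¹ * rotationPart hΦ i j = g (solFrame j p)) :
    ∃ c, ∀ p, Φ p i = g p + c := by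
  refine exists_eq_add_const (coordFun hΦ.1 i).differentiable g fun p j => ?_
  rw [← hg, rotationPart_apply hΦ i j p, inv_mul_cancel_left₀ (solCoeff_pos _ _).ne']
  exact fderiv_apply_coord (hΦ.1.differentiable (by simp) p) _ i

theorem isStraight_or_isSwap {Φ : Sol ≃ₜ Sol} (hΦ : Φ ∈ solIsometryGroup) :
    ∃ e₀ e₁ l a b : ℝ, e₀ * e₀ = 1 ∧ e₁ * e₁ = 1 ∧
      (IsStraight e₀ e₁ l a b Φ ∨ IsSwap e₀ e₁ l a b Φ) := by
  obtain ⟨e₀, e₁, he₀, he₁, h | h⟩ := exists_rotationPart_eq hΦ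
  · obtain ⟨l, hl⟩ := exists_coord_eq_add_const hΦ 2 (EuclideanSpace.proj 2) fun p j => by
      fin_cases j <;> simp [h, solFrame, solCoeff]
    obtain ⟨a, ha⟩ := exists_coord_eq_add_const hΦ 0 ((e₀ * Real.exp l) • EuclideanSpace.proj 0)
      fun p j => by
        fin_cases j <;> simp [h, hl p, solFrame, solCoeff, Real.exp_add, Real.exp_neg]
        ring
    obtain ⟨b, hb⟩ := exists_coord_eq_add_const hΦ 1 ((e₁ * Real.exp (-l)) • EuclideanSpace.proj 1)
      fun p j => by
        fin_cases j <;> simp [h, hl p, solFrame, solCoeff, Real.exp_add, Real.exp_neg]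
        ring
    exact ⟨e₀, e₁, l, a, b, he₀, he₁, Or.inl fun p => ⟨ha p, hb p, hl p⟩⟩
  · obtain ⟨l, hl⟩ := exists_coord_eq_add_const hΦ 2 (-EuclideanSpace.proj 2) fun p j => by
      fin_cases j <;> simp [h, solFrame, solCoeff]
    obtain ⟨a, ha⟩ := exists_coord_eq_add_const hΦ 0 ((e₀ * Real.exp l) • EuclideanSpace.proj 1)
      fun p j => by
        fin_cases j <;> simp [h, hl p, solFrame, solCoeff, Real.exp_add, Real.exp_neg]
        ring
    obtain ⟨b, hb⟩ := exists_coord_eq_add_const hΦ 1 ((e₁ * Real.exp (-l)) • EuclideanSpace.proj 0)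
      fun p j => by
        fin_cases j <;> simp [h, hl p, solFrame, solCoeff, Real.exp_add, Real.exp_neg]
        ring
    exact ⟨e₀, e₁, l, a, b, he₀, he₁, Or.inr fun p => ⟨ha p, hb p, hl p⟩⟩

end Classification

/-! ### The two sides of a closed hypersurface -/

/-- A cocycle with values in a discrete group over a simply connected space is a coboundary,
because it defines a covering space, which has a section. -/
theorem exists_coboundary_of_locallyConstant_cocycle {X ι G : Type*} [TopologicalSpace X]
    [SimplyConnectedSpace X] [LocallyPathConnectedSpace X] [Group G] {U : ι → Set X}
    (hU : ∀ i, IsOpen (U i)) (hcover : ∀ x, ∃ i, x ∈ U i) {c : ι → ι → X → G}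
    (hc : ∀ i j, ∀ x ∈ U i ∩ U j, ∀ᶠ y in 𝓝 x, c i j y = c i j x)
    (hmul : ∀ i j k, ∀ x ∈ U i ∩ U j ∩ U k, c i j x * c j k x = c i k x) :
    ∃ s : ι → X → G, (∀ i, ∀ x ∈ U i, ∀ᶠ y in 𝓝 x, s i y = s i x) ∧
      ∀ i j, ∀ x ∈ U i ∩ U j, s i x * c i j x = s j x := by
  let : TopologicalSpace G := ⊥
  have : DiscreteTopology G := ⟨rfl⟩
  choose index mem_index using hcover
  let Z : FiberBundleCore ι X G :=
    { baseSet := U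
      isOpen_baseSet := hU
      indexAt := index
      mem_baseSet_at := mem_index
      coordChange i j x a := a * c i j x
      coordChange_self i x hx a := by
        rw [mul_eq_left]
        exact mul_eq_left.1 (hmul i i i x ⟨⟨hx, hx⟩, hx⟩)
      continuousOn_coordChange i j := by
        rintro ⟨x, a⟩ ⟨hx, -⟩
        have eventually_eq : (fun p : X × G => p.2 * c i j p.1) =ᶠ[𝓝 (x, a)]
            fun p => p.2 * c i j x :=
          (continuous_fst.continuousAt.eventually (hc i j x hx)).mono fun p hp => congrArg _ hp
        exact ((((continuous_of_discreteTopology (f := (· * c i j x))).comp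
          continuous_snd).continuousAt).congr eventually_eq.symm).continuousWithinAt
      coordChange_comp i j k x hx a := by rw [mul_assoc, hmul i j k x hx] }
  have covering : IsCoveringMap (Bundle.TotalSpace.proj : Z.TotalSpace → X) :=
    FiberBundle.isCoveringMap
  obtain ⟨x₀⟩ : Nonempty X := inferInstance
  obtain ⟨σ, ⟨-, hσ⟩, -⟩ := covering.existsUnique_continuousMap_lifts (ContinuousMap.id X) x₀
    (⟨x₀, (1 : G)⟩ : Z.TotalSpace) rfl
  have proj_section (x) : (σ x).1 = x := congrFun hσ x
  refine ⟨fun i x => (Z.localTriv i (σ x)).2, fun i x hx => ?_, fun i j x hx => ?_⟩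
  · have mem_source : σ x ∈ (Z.localTriv i).source :=
      (Z.mem_localTriv_source i _).2 ((proj_section x).symm ▸ hx)
    exact (continuousAt_snd.comp (((Z.localTriv i).toOpenPartialHomeomorph.continuousAt
      mem_source).comp σ.continuous.continuousAt)).eventually ((isOpen_discrete {_}).mem_nhds rfl)
  · refine (mul_assoc _ _ _).trans (congrArg _ ?_)
    change c (index (σ x).1) i (σ x).1 * c i j x = c (index (σ x).1) j (σ x).1
    rw [proj_section]
    exact hmul _ i j x ⟨⟨mem_index x, hx.1⟩, hx.2⟩

section RelativeSign

variable {E : Type*} [TopologicalSpace E]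

/-- Near `x` and outside `S`, the functions `h` and `k` have the same sign if `ε = 1`, and opposite
signs if `ε = -1`. -/
def HasRelativeSign (S : Set E) (h k : E → ℝ) (x : E) (ε : ℤˣ) : Prop :=
  ∀ᶠ y in 𝓝 x, y ∉ S → 0 < ε • (h y * k y)

namespace HasRelativeSign

variable {S : Set E} {h k m : E → ℝ} {x : E} {ε δ : ℤˣ}

theorem eventually_nhds (H : HasRelativeSign S h k x ε) :
    ∀ᶠ y in 𝓝 x, HasRelativeSign S h k y ε :=
  eventually_eventually_nhds.2 H

theorem mul (H : HasRelativeSign S h k x ε) (K : HasRelativeSign S k m x δ) :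
    HasRelativeSign S h m x (ε * δ) := by
  filter_upwards [H, K] with y hy ky hS
  refine pos_of_mul_pos_left (b := k y * k y) ((mul_pos (hy hS) (ky hS)).trans_eq ?_)
    (mul_self_nonneg _)
  rw [smul_mul_smul_comm, smul_mul_assoc]
  congr 1
  ring

theorem unique (hS : ∃ᶠ y in 𝓝 x, y ∉ S) (H : HasRelativeSign S h k x ε)
    (K : HasRelativeSign S h k x δ) : ε = δ := by
  obtain ⟨y, hyS, hy, ky⟩ := (hS.and_eventually (H.and K)).exists
  replace hy := hy hyS
  replace ky := ky hyS
  rcases Int.units_eq_one_or ε with rfl | rfl <;> rcases Int.units_eq_one_or δ with rfl | rfl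
  · rfl
  · rw [one_smul] at hy
    rw [Units.neg_smul, one_smul] at ky
    linarith
  · rw [one_smul] at ky
    rw [Units.neg_smul, one_smul] at hy
    linarith
  · rfl

end HasRelativeSign

end RelativeSign

section Sides

variable {E : Type*} [NormedAddCommGroup E] [NormedSpace ℝ E]

/-- The set `S` is defined in the open set `U` by the equation `h = 0`, where `h` is continuously
differentiable and has nonzero derivative along `S`. -/
structure IsDefiningFunction (S U : Set E) (h : E → ℝ) : Prop where
  isOpen : IsOpen U
  contDiffAt : ∀ y ∈ U, ContDiffAt ℝ 1 h y
  fderiv_ne_zero : ∀ y ∈ U ∩ S, fderiv ℝ h y ≠ 0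
  mem_iff : ∀ y ∈ U, y ∈ S ↔ h y = 0

namespace IsDefiningFunction

variable {S U V : Set E} {h k : E → ℝ} {x v : E}

theorem const_one (hS : IsClosed S) : IsDefiningFunction S Sᶜ fun _ => 1 where
  isOpen := hS.isOpen_compl
  contDiffAt _ _ := contDiffAt_const
  fderiv_ne_zero _ hy := absurd hy.2 hy.1
  mem_iff _ hy := iff_of_false hy one_ne_zero

theorem neg (H : IsDefiningFunction S U h) : IsDefiningFunction S U fun y => -h y where
  isOpen := H.isOpen
  contDiffAt y hy := (H.contDiffAt y hy).neg
  fderiv_ne_zero y hy := by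
    rw [fderiv_fun_neg]
    exact neg_ne_zero.2 (H.fderiv_ne_zero y hy)
  mem_iff y hy := by rw [H.mem_iff y hy, neg_eq_zero]

theorem units_smul (H : IsDefiningFunction S U h) (ε : ℤˣ) :
    IsDefiningFunction S U fun y => ε • h y := by
  rcases Int.units_eq_one_or ε with rfl | rfl
  · simpa using H
  · simpa using H.neg

theorem mono (H : IsDefiningFunction S U h) (hV : IsOpen V) (hVU : V ⊆ U) :
    IsDefiningFunction S V h where
  isOpen := hV
  contDiffAt y hy := H.contDiffAt y (hVU hy)
  fderiv_ne_zero y hy := H.fderiv_ne_zero y ⟨hVU hy.1, hy.2⟩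
  mem_iff y hy := H.mem_iff y (hVU hy)

theorem hasStrictFDerivAt (H : IsDefiningFunction S U h) (hx : x ∈ U) :
    HasStrictFDerivAt h (fderiv ℝ h x) x :=
  (H.contDiffAt x hx).hasStrictFDerivAt (by simp)

theorem frequently_notMem (H : IsDefiningFunction S U h) (hU : x ∈ U) : ∃ᶠ y in 𝓝 x, y ∉ S := by
  by_cases hS : x ∈ S
  · intro hf
    refine H.fderiv_ne_zero x ⟨hU, hS⟩ ?_
    have eventually_zero : h =ᶠ[𝓝 x] fun _ => 0 := by
      filter_upwards [hf, H.isOpen.mem_nhds hU] with y hyS hyU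
      exact (H.mem_iff y hyU).1 (not_not.1 hyS)
    rw [eventually_zero.fderiv_eq, fderiv_const_apply]
  · exact fun hf => hf.self_of_nhds hS

end IsDefiningFunction

theorem exists_nhds_forall_lt_add_smul {h : E → ℝ} {φ : E →L[ℝ] ℝ} {x v : E}
    (hh : HasStrictFDerivAt h φ x) (hv : 0 < φ v) :
    ∃ W ∈ 𝓝 x, ∀ y ∈ W, ∀ t : ℝ, 0 < t → y + t • v ∈ W → h y < h (y + t • v) := by
  have hv0 : 0 < ‖v‖ := norm_pos_iff.2 (by rintro rfl; simp at hv)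
  have near := hh.isLittleO.def (c := φ v / (2 * ‖v‖)) (by positivity)
  rw [nhds_prod_eq, Filter.eventually_prod_self_iff'] at near
  obtain ⟨W, hW, near⟩ := near
  refine ⟨W, hW, fun y hy t ht hyt => ?_⟩
  have error := near _ hyt _ hy
  rw [add_sub_cancel_left, norm_smul, map_smul, Real.norm_eq_abs, Real.norm_eq_abs, abs_of_pos ht,
    show φ v / (2 * ‖v‖) * (t * ‖v‖) = t * φ v / 2 by field_simp, abs_le, smul_eq_mul] at error
  linarith [error.1, mul_pos ht hv]

namespace IsDefiningFunction

variable {S U V : Set E} {h k : E → ℝ} {x v : E}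

theorem exists_nhds_mul_neg (H : IsDefiningFunction S U h) (hU : x ∈ U) (hv : 0 < fderiv ℝ h x v) :
    ∃ W ∈ 𝓝 x, ∀ y ∈ W, ∀ t : ℝ, t ≠ 0 → y + t • v ∈ W → y + t • v ∈ S → h y * t < 0 := by
  obtain ⟨W, hW, increasing⟩ := exists_nhds_forall_lt_add_smul (H.hasStrictFDerivAt hU) hv
  refine ⟨W ∩ U, Filter.inter_mem hW (H.isOpen.mem_nhds hU), fun y hy t ht hyt hS => ?_⟩
  have zero := (H.mem_iff _ hyt.2).1 hS
  rcases ht.lt_or_gt with ht | ht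
  · have := increasing _ hyt.1 (-t) (neg_pos.2 ht) (by simpa using hy.1)
    rw [neg_smul, add_neg_cancel_right, zero] at this
    exact mul_neg_of_pos_of_neg this ht
  · have := increasing y hy.1 t ht hyt.1
    rw [zero] at this
    exact mul_neg_of_neg_of_pos this ht

theorem eventually_exists_add_smul_mem (H : IsDefiningFunction S U h) (hU : x ∈ U) (hS : x ∈ S)
    (hv : 0 < fderiv ℝ h x v) {W : Set E} (hW : W ∈ 𝓝 x) :
    ∀ᶠ y in 𝓝 x, ∃ t : ℝ, y + t • v ∈ W ∩ S := by
  obtain ⟨W', hW', increasing⟩ := exists_nhds_forall_lt_add_smul (H.hasStrictFDerivAt hU) hv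
  have zero := (H.mem_iff x hU).1 hS
  have line : Filter.Tendsto (fun p : E × ℝ => p.1 + p.2 • v) (𝓝 x ×ˢ 𝓝 0) (𝓝 x) := by
    rw [← nhds_prod_eq]
    exact (by fun_prop : Continuous fun p : E × ℝ => p.1 + p.2 • v).tendsto' _ _ (by simp)
  obtain ⟨A, hA, B, hB, near⟩ := Filter.eventually_prod_iff.1
    (line (Filter.inter_mem (Filter.inter_mem hW hW') (H.isOpen.mem_nhds hU)))
  obtain ⟨s, hs, hsB⟩ := (nhds_basis_Icc_pos (0 : ℝ)).eventually_iff.1 hB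
  rw [zero_sub, zero_add] at hsB
  have continuousAt {y : E} {t : ℝ} (hy : A y) (ht : t ∈ Icc (-s) s) : ContinuousAt h (y + t • v) :=
    (H.contDiffAt _ (near hy (hsB ht)).2).continuousAt
  have left : -s ∈ Icc (-s) s := ⟨le_rfl, by linarith⟩
  have right : s ∈ Icc (-s) s := ⟨by linarith, le_rfl⟩
  have hx := hA.self_of_nhds
  have neg_left : h (x + (-s) • v) < 0 := by
    have := increasing _ (near hx (hsB left)).1.2 s hs (by simpa using mem_of_mem_nhds hW')
    simpa [zero] using this
  have pos_right : 0 < h (x + s • v) := by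
    have := increasing x (mem_of_mem_nhds hW') s hs (near hx (hsB right)).1.2
    rwa [zero] at this
  have continuousAt_translate {t : ℝ} (ht : t ∈ Icc (-s) s) :
      ContinuousAt (fun y => h (y + t • v)) x :=
    ContinuousAt.comp (f := fun y => y + t • v) (continuousAt hx ht) (by fun_prop)
  filter_upwards [hA, (continuousAt_translate left).eventually_lt_const neg_left,
    (continuousAt_translate right).eventually_const_lt pos_right]
    with y hy hneg hpos
  have continuousOn : ContinuousOn (fun t : ℝ => h (y + t • v)) (Icc (-s) s) := fun t ht =>
    (ContinuousAt.comp (f := fun t : ℝ => y + t • v) (continuousAt hy ht)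
      (by fun_prop)).continuousWithinAt
  obtain ⟨t, ht, crossing⟩ :=
    intermediate_value_Icc (by linarith : -s ≤ s) continuousOn ⟨hneg.le, hpos.le⟩
  have mem := near hy (hsB ht)
  exact ⟨t, mem.1.1, (H.mem_iff _ mem.2).2 crossing⟩

theorem eventually_mul_pos (H : IsDefiningFunction S U h) (K : IsDefiningFunction S V k)
    (hU : x ∈ U) (hV : x ∈ V) (hS : x ∈ S) (hh : 0 < fderiv ℝ h x v) (hk : 0 < fderiv ℝ k x v) :
    ∀ᶠ y in 𝓝 x, y ∉ S → 0 < h y * k y := by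
  obtain ⟨W, hW, hsign⟩ := H.exists_nhds_mul_neg hU hh
  obtain ⟨W', hW', ksign⟩ := K.exists_nhds_mul_neg hV hk
  filter_upwards [H.eventually_exists_add_smul_mem hU hS hh (Filter.inter_mem hW hW'), hW, hW']
    with y ⟨t, ⟨htW, htW'⟩, htS⟩ hyW hyW' hyS
  have ht : t ≠ 0 := by
    rintro rfl
    exact hyS (by simpa using htS)
  refine pos_of_mul_pos_left (b := t * t) ?_ (mul_self_nonneg t)
  rw [mul_mul_mul_comm]
  exact mul_pos_of_neg_of_neg (hsign y hyW t ht htW htS) (ksign y hyW' t ht htW' htS)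

end IsDefiningFunction

theorem exists_pos_ne_zero {φ ψ : E →L[ℝ] ℝ} (hφ : φ ≠ 0) (hψ : ψ ≠ 0) :
    ∃ v, 0 < φ v ∧ ψ v ≠ 0 := by
  suffices ∃ v, φ v ≠ 0 ∧ ψ v ≠ 0 by
    obtain ⟨v, hφv, hψv⟩ := this
    rcases lt_or_gt_of_ne hφv with neg | pos
    · exact ⟨-v, by simpa using neg, by simpa using hψv⟩
    · exact ⟨v, pos, hψv⟩
  obtain ⟨v, hv⟩ := DFunLike.exists_ne hφ
  obtain ⟨w, hw⟩ := DFunLike.exists_ne hψ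
  by_cases hψv : ψ v = 0
  · by_cases hφw : φ w = 0
    · exact ⟨v + w, by simpa [hφw] using hv, by simpa [hψv] using hw⟩
    · exact ⟨w, hφw, hw⟩
  · exact ⟨v, hv, hψv⟩

namespace IsDefiningFunction

variable {S U V : Set E} {h k : E → ℝ} {x : E}

theorem exists_hasRelativeSign (H : IsDefiningFunction S U h) (K : IsDefiningFunction S V k)
    (hU : x ∈ U) (hV : x ∈ V) : ∃ ε, HasRelativeSign S h k x ε := by
  by_cases hS : x ∈ S
  · obtain ⟨v, hv, kv⟩ := exists_pos_ne_zero (H.fderiv_ne_zero x ⟨hU, hS⟩)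
      (K.fderiv_ne_zero x ⟨hV, hS⟩)
    rcases lt_or_gt_of_ne kv with kv | kv
    · refine ⟨-1, (H.eventually_mul_pos K.neg hU hV hS hv ?_).mono fun y hy hS => ?_⟩
      · rwa [fderiv_fun_neg, neg_apply, neg_pos]
      · rw [Units.neg_smul, one_smul, ← mul_neg]
        exact hy hS
    · refine ⟨1, (H.eventually_mul_pos K hU hV hS hv kv).mono fun y hy hS => ?_⟩
      rw [one_smul]
      exact hy hS
  · have ne_zero : h x * k x ≠ 0 :=
      mul_ne_zero (mt (H.mem_iff x hU).2 hS) (mt (K.mem_iff x hV).2 hS)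
    have continuousAt : ContinuousAt (fun y => h y * k y) x :=
      (H.contDiffAt x hU).continuousAt.mul (K.contDiffAt x hV).continuousAt
    rcases lt_or_gt_of_ne ne_zero with neg | pos
    · refine ⟨-1, (continuousAt.eventually_lt_const neg).mono fun y hy _ => ?_⟩
      rwa [Units.neg_smul, one_smul, neg_pos]
    · refine ⟨1, (continuousAt.eventually_const_lt pos).mono fun y hy _ => ?_⟩
      rwa [one_smul]

end IsDefiningFunction

/-- `P` is one of the two sides of the closed hypersurface `S`: locally, `S` and `P` are defined by
`h = 0` and `0 < h`. Away from `S`, where `h` has no zero, this says that `P` is open and closed. -/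
def IsSide (S P : Set E) : Prop :=
  ∀ x, ∃ U h, x ∈ U ∧ IsDefiningFunction S U h ∧ ∀ y ∈ U, y ∈ P ↔ 0 < h y

theorem exists_isSide {S : Set E} (hS : IsClosed S)
    (hloc : ∀ x ∈ S, ∃ U h, x ∈ U ∧ IsDefiningFunction S U h) : ∃ P, IsSide S P := by
  have hloc' (x : E) : ∃ U h, x ∈ U ∧ IsDefiningFunction S U h := by
    by_cases hx : x ∈ S
    · exact hloc x hx
    · exact ⟨Sᶜ, _, hx, .const_one hS⟩
  choose U h hU H using hloc'
  have hsign (i j x : E) (hx : x ∈ U i ∩ U j) : ∃ ε, HasRelativeSign S (h i) (h j) x ε :=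
    (H i).exists_hasRelativeSign (H j) hx.1 hx.2
  choose! c hc using hsign
  have sign_eq {i j x : E} {ε : ℤˣ} (hx : x ∈ U i ∩ U j)
      (hε : HasRelativeSign S (h i) (h j) x ε) : c i j x = ε :=
    (hc i j x hx).unique ((H i).frequently_notMem hx.1) hε
  obtain ⟨s, s_const, s_mul⟩ := exists_coboundary_of_locallyConstant_cocycle (c := c)
    (fun i => (H i).isOpen) (fun x => ⟨x, hU x⟩)
    (fun i j x hx => by
      filter_upwards [(hc i j x hx).eventually_nhds, (H i).isOpen.mem_nhds hx.1,
        (H j).isOpen.mem_nhds hx.2] with y hy hi hj using sign_eq ⟨hi, hj⟩ hy)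
    (fun i j k x hx => (sign_eq ⟨hx.1.1, hx.2⟩
      ((hc i j x hx.1).mul (hc j k x ⟨hx.1.2, hx.2⟩))).symm)
  refine ⟨{y | 0 < s y y • h y y}, fun x => ?_⟩
  obtain ⟨W, hW, hWo, hxW⟩ := mem_nhds_iff.1
    (Filter.inter_mem (s_const x x (hU x)) ((H x).isOpen.mem_nhds (hU x)))
  refine ⟨W, fun y => s x x • h x y, hxW, ((H x).units_smul _).mono hWo fun y hy => (hW hy).2,
    fun y hy => ?_⟩
  rw [mem_ofPred_eq]
  by_cases hyS : y ∈ S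
  · simp only [((H y).mem_iff y (hU y)).1 hyS, ((H x).mem_iff y (hW hy).2).1 hyS, smul_zero]
  · have pos := (hc y x y ⟨hU y, (hW hy).2⟩).self_of_nhds hyS
    have sign : s y y * s x x = c y x y := by
      rw [← (hW hy).1, ← s_mul y x y ⟨hU y, (hW hy).2⟩, ← mul_assoc, Int.units_mul_self, one_mul]
    rw [← sign, ← smul_mul_smul_comm] at pos
    exact pos_iff_pos_of_mul_pos pos

namespace IsSide

variable {S P Q T : Set E} {x y : E}

theorem disjoint (hP : IsSide S P) : Disjoint P S := by
  refine Set.disjoint_left.2 fun x hxP hxS => ?_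
  obtain ⟨U, h, hU, H, hPh⟩ := hP x
  exact ((hPh x hU).1 hxP).ne' ((H.mem_iff x hU).1 hxS)

theorem eventually_mem_iff (hP : IsSide S P) (hx : x ∉ S) : ∀ᶠ y in 𝓝 x, y ∈ P ↔ x ∈ P := by
  obtain ⟨U, h, hU, H, hPh⟩ := hP x
  have continuousAt := (H.contDiffAt x hU).continuousAt
  rw [hPh x hU]
  rcases lt_or_gt_of_ne (mt (H.mem_iff x hU).2 hx) with h0 | h0
  · filter_upwards [continuousAt.eventually_lt_const h0, H.isOpen.mem_nhds hU] with y hy hyU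
    rw [hPh y hyU]
    exact iff_of_false hy.not_gt h0.not_gt
  · filter_upwards [continuousAt.eventually_const_lt h0, H.isOpen.mem_nhds hU] with y hy hyU
    rw [hPh y hyU]
    exact iff_of_true hy h0

theorem mem_iff_of_isPreconnected (hP : IsSide S P) (hT : IsPreconnected T) (hTS : Disjoint T S)
    (hx : x ∈ T) (hy : y ∈ T) : x ∈ P ↔ y ∈ P := by
  have locallyConstant : IsLocallyConstant fun t : T => (t : E) ∈ P :=
    (IsLocallyConstant.iff_eventually_eq _).2 fun t =>
      (continuous_subtype_val.continuousAt.eventually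
        (hP.eventually_mem_iff (Set.disjoint_left.1 hTS t.2))).mono fun s hs => propext hs
  have : PreconnectedSpace T := isPreconnected_iff_preconnectedSpace.1 hT
  exact (locallyConstant.apply_eq_of_preconnectedSpace ⟨x, hx⟩ ⟨y, hy⟩).to_iff

theorem eventually_iff_or (hP : IsSide S P) (hQ : IsSide S Q) (x : E) :
    (∀ᶠ y in 𝓝 x, y ∉ S → (y ∈ P ↔ y ∈ Q)) ∨ ∀ᶠ y in 𝓝 x, y ∉ S → ¬ (y ∈ P ↔ y ∈ Q) := by
  obtain ⟨U, h, hU, H, hPh⟩ := hP x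
  obtain ⟨V, k, hV, K, hQk⟩ := hQ x
  obtain ⟨ε, hε⟩ := H.exists_hasRelativeSign K hU hV
  rcases Int.units_eq_one_or ε with rfl | rfl
  · left
    filter_upwards [hε, H.isOpen.mem_nhds hU, K.isOpen.mem_nhds hV] with y hy hyU hyV hyS
    rw [hPh y hyU, hQk y hyV]
    exact pos_iff_pos_of_mul_pos (by simpa only [one_smul] using hy hyS)
  · right
    filter_upwards [hε, H.isOpen.mem_nhds hU, K.isOpen.mem_nhds hV] with y hy hyU hyV hyS
    rw [hPh y hyU, hQk y hyV]
    have neg : h y * k y < 0 := by simpa only [Units.neg_smul, one_smul, neg_pos] using hy hyS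
    rcases mul_neg_iff.1 neg with ⟨hpos, kneg⟩ | ⟨hneg, kpos⟩
    · exact fun hiff => kneg.not_gt (hiff.1 hpos)
    · exact fun hiff => hneg.not_gt (hiff.2 kpos)

theorem eq_of_mem_iff (hP : IsSide S P) (hQ : IsSide S Q) (hx : x ∉ S) (hxPQ : x ∈ P ↔ x ∈ Q) :
    P = Q := by
  have clopen : IsClopen {y | ∀ᶠ z in 𝓝 y, z ∉ S → (z ∈ P ↔ z ∈ Q)} := by
    refine ⟨⟨isOpen_iff_mem_nhds.2 fun y hy => ?_⟩,
      isOpen_iff_mem_nhds.2 fun y hy => eventually_eventually_nhds.2 hy⟩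
    filter_upwards [eventually_eventually_nhds.2 ((hP.eventually_iff_or hQ y).resolve_left hy)]
      with z hz hz'
    obtain ⟨U, h, hU, H, -⟩ := hP z
    obtain ⟨w, hwS, hw, hw'⟩ := ((H.frequently_notMem hU).and_eventually (hz.and hz')).exists
    exact hw hwS (hw' hwS)
  have mem : x ∈ {y | ∀ᶠ z in 𝓝 y, z ∉ S → (z ∈ P ↔ z ∈ Q)} :=
    (hP.eventually_iff_or hQ x).resolve_right fun h => h.self_of_nhds hx hxPQ
  ext y
  by_cases hy : y ∈ S
  · exact iff_of_false (fun h => Set.disjoint_left.1 hP.disjoint h hy)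
      fun h => Set.disjoint_left.1 hQ.disjoint h hy
  · exact (clopen.eq_univ ⟨x, mem⟩ ▸ mem_univ y : y ∈ {y | _}).self_of_nhds hy

end IsSide
end Sides

section Conormal

variable {E : Type*} [NormedAddCommGroup E] [NormedSpace ℝ E]

/-- A conormal of the set `P` at the boundary point `p`: a nonzero linear form which is positive on
the tangent vectors pointing into `P` and negative on those pointing out of `P`. -/
structure IsConormal (P : Set E) (p : E) (φ : E →L[ℝ] ℝ) : Prop where
  ne_zero : φ ≠ 0
  eventually_mem : ∀ v, 0 < φ v → ∀ᶠ t in 𝓝[>] (0 : ℝ), p + t • v ∈ P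
  eventually_notMem : ∀ v, φ v < 0 → ∀ᶠ t in 𝓝[>] (0 : ℝ), p + t • v ∉ P

namespace IsConormal

variable {P : Set E} {p : E} {φ ψ : E →L[ℝ] ℝ}

theorem smul (hφ : IsConormal P p φ) {c : ℝ} (hc : 0 < c) : IsConormal P p (c • φ) where
  ne_zero := smul_ne_zero hc.ne' hφ.ne_zero
  eventually_mem v hv := hφ.eventually_mem v ((mul_pos_iff_of_pos_left hc).1 hv)
  eventually_notMem v hv := hφ.eventually_notMem v (neg_of_mul_neg_right hv hc.le)

theorem nonneg_of_pos (hφ : IsConormal P p φ) (hψ : IsConormal P p ψ) {v : E} (hv : 0 < φ v) :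
    0 ≤ ψ v := by
  by_contra! neg
  obtain ⟨t, mem, notMem⟩ :=
    ((hφ.eventually_mem v hv).and (hψ.eventually_notMem v neg)).exists
  exact notMem mem

theorem exists_eq_smul (hφ : IsConormal P p φ) (hψ : IsConormal P p ψ) :
    ∃ c : ℝ, 0 < c ∧ ψ = c • φ := by
  obtain ⟨u, hu⟩ := DFunLike.exists_ne hφ.ne_zero
  obtain ⟨v, hv⟩ : ∃ v, φ v = 1 := ⟨(φ u)⁻¹ • u, by simpa using inv_mul_cancel₀ hu⟩
  have ker_le (w) (hw : φ w = 0) : ψ w = 0 := by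
    by_contra hne
    have := hφ.nonneg_of_pos hψ (v := v + (-(ψ v + 1) / ψ w) • w) (by simp [hw, hv])
    rw [map_add, map_smul, smul_eq_mul, div_mul_cancel₀ _ hne] at this
    linarith
  have eq_smul : ψ = ψ v • φ := by
    ext w
    have := ker_le (w - φ w • v) (by simp [hv])
    rw [map_sub, map_smul, sub_eq_zero] at this
    rw [this, smul_apply, smul_eq_mul, smul_eq_mul, mul_comm]
  have nonneg : 0 ≤ ψ v := hφ.nonneg_of_pos hψ (by simp [hv])
  refine ⟨ψ v, nonneg.lt_of_ne fun h0 => hψ.ne_zero ?_, eq_smul⟩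
  rw [eq_smul, ← h0, zero_smul]

theorem norm_inv_smul_eq (hφ : IsConormal P p φ) (hψ : IsConormal P p ψ) :
    ‖φ‖⁻¹ • φ = ‖ψ‖⁻¹ • ψ := by
  obtain ⟨c, hc, rfl⟩ := hφ.exists_eq_smul hψ
  rw [norm_smul, Real.norm_eq_abs, abs_of_pos hc, smul_smul, mul_inv, mul_right_comm,
    inv_mul_cancel₀ hc.ne', one_mul]

end IsConormal

theorem IsDefiningFunction.isConormal {S P U : Set E} {h : E → ℝ} (H : IsDefiningFunction S U h)
    (hP : ∀ y ∈ U, y ∈ P ↔ 0 < h y) {p : E} (hU : p ∈ U) (hS : p ∈ S) :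
    IsConormal P p (fderiv ℝ h p) := by
  have eventually_mem (v : E) : ∀ᶠ t in 𝓝[>] (0 : ℝ), p + t • v ∈ U := by
    have continuousAt : ContinuousAt (fun t : ℝ => p + t • v) 0 := by fun_prop
    exact (continuousAt.eventually (H.isOpen.mem_nhds (by simpa using hU))).filter_mono
      nhdsWithin_le_nhds
  have slope (v : E) :
      Filter.Tendsto (fun t : ℝ => t⁻¹ * h (p + t • v)) (𝓝[>] 0) (𝓝 (fderiv ℝ h p v)) := by
    simpa [(H.mem_iff p hU).1 hS] using
      ((H.hasStrictFDerivAt hU).hasFDerivAt.hasLineDerivAt v).tendsto_slope_zero_right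
  refine ⟨H.fderiv_ne_zero p ⟨hU, hS⟩, fun v hv => ?_, fun v hv => ?_⟩
  · filter_upwards [eventually_mem v, (slope v).eventually_const_lt hv, self_mem_nhdsWithin]
      with t htU hpos ht
    rw [hP _ htU]
    exact (pos_iff_pos_of_mul_pos hpos).1 (inv_pos.2 ht)
  · filter_upwards [eventually_mem v, (slope v).eventually_lt_const hv, self_mem_nhdsWithin]
      with t htU hneg ht
    rw [hP _ htU]
    exact fun h0 => hneg.not_gt (mul_pos (inv_pos.2 ht) h0)

theorem IsSide.exists_conormal {S P : Set E} (hP : IsSide S P) : ∃ ν : E → E →L[ℝ] ℝ,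
    ContinuousOn ν S ∧ ∀ p ∈ S, IsConormal P p (ν p) := by
  choose U h hU H hPh using hP
  have conormal (p y) (hy : y ∈ U p) (hS : y ∈ S) : IsConormal P y (fderiv ℝ (h p) y) :=
    (H p).isConormal (hPh p) hy hS
  refine ⟨fun p => ‖fderiv ℝ (h p) p‖⁻¹ • fderiv ℝ (h p) p, fun p hp => ?_, fun p hp =>
    (conormal p p (hU p) hp).smul (inv_pos.2 (norm_pos_iff.2 (conormal p p (hU p) hp).ne_zero))⟩
  have continuousAt : ContinuousAt (fderiv ℝ (h p)) p :=
    (((H p).contDiffAt p (hU p)).fderiv_right (m := 0) (by simp)).continuousAt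
  refine ContinuousWithinAt.congr_of_eventuallyEq (f := fun y => ‖fderiv ℝ (h p) y‖⁻¹ •
    fderiv ℝ (h p) y) (((continuousAt.norm.inv₀ (norm_ne_zero_iff.2
      (conormal p p (hU p) hp).ne_zero)).smul continuousAt).continuousWithinAt) ?_ rfl
  filter_upwards [self_mem_nhdsWithin, nhdsWithin_le_nhds ((H p).isOpen.mem_nhds (hU p))]
    with y hyS hyU using (conormal y y (hU y) hyS).norm_inv_smul_eq (conormal p y hyU hyS)

end Conormal

/-! ### Embedded hypersurfaces -/

section Immersion

variable {m n : ℕ} {S : Type*} [TopologicalSpace S] [ChartedSpace (EuclideanSpace ℝ (Fin m)) S]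
  {L : Type*} [TopologicalSpace L] [ChartedSpace (EuclideanSpace ℝ (Fin n)) L] {f : S → L} {x : S}

theorem codChart_apply_of_isImmersionAt (hf : IsImmersionAt (𝓡 m) (𝓡 n) ∞ f x) {y : S}
    (hy : y ∈ hf.domChart.source) : hf.codChart (f y) = hf.equiv (hf.domChart y, 0) := by
  have mem_target : hf.domChart y ∈ (hf.domChart.extend (𝓡 m)).target := by
    simpa using hf.domChart.map_source hy
  simpa [hf.domChart.left_inv hy] using hf.writtenInCharts mem_target

theorem mfderiv_injective_of_isImmersionAt [IsManifold (𝓡 m) ∞ S] [IsManifold (𝓡 n) ∞ L]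
    (hf : IsImmersionAt (𝓡 m) (𝓡 n) ∞ f x) : Function.Injective (mfderiv (𝓡 m) (𝓡 n) f x) := by
  set φ := hf.domChart
  set ψ := hf.codChart
  have hx : x ∈ φ.source := hf.mem_domChart_source
  let proj : EuclideanSpace ℝ (Fin n) →L[ℝ] EuclideanSpace ℝ (Fin m) :=
    (ContinuousLinearMap.fst ℝ (EuclideanSpace ℝ (Fin m)) hf.complement).comp
      (hf.equiv.symm : EuclideanSpace ℝ (Fin n) →L[ℝ] _)
  have proj_chart (y) (hy : y ∈ φ.source) : proj (ψ (f y)) = φ y := by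
    rw [codChart_apply_of_isImmersionAt hf hy]
    simp [proj, φ]
  have retraction : MDifferentiableAt (𝓡 n) (𝓡 m) (φ.symm ∘ proj ∘ ψ) (f x) := by
    have hψ : MDifferentiableAt (𝓡 n) (𝓡 n) ψ (f x) :=
      (contMDiffAt_of_mem_maximalAtlas hf.codChart_mem_maximalAtlas
        hf.mem_codChart_source).mdifferentiableAt (by simp)
    have hφ : MDifferentiableAt (𝓡 m) (𝓡 m) φ.symm ((proj ∘ ψ) (f x)) := by
      rw [Function.comp_apply, proj_chart x hx]
      exact (contMDiffAt_symm_of_mem_maximalAtlas hf.domChart_mem_maximalAtlas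
        (φ.map_source hx)).mdifferentiableAt (by simp)
    exact hφ.comp _ (proj.mdifferentiableAt.comp _ hψ)
  have left_inverse : (φ.symm ∘ proj ∘ ψ) ∘ f =ᶠ[𝓝 x] id := by
    filter_upwards [φ.open_source.mem_nhds hx] with y hy
    rw [Function.comp_apply, Function.comp_apply, Function.comp_apply, proj_chart y hy,
      φ.left_inv hy, id]
  have comp_eq := mfderiv_comp x retraction (hf.contMDiffAt.mdifferentiableAt (by simp))
  rw [left_inverse.mfderiv_eq, mfderiv_id] at comp_eq
  exact Function.LeftInverse.injective
    (g := mfderiv (𝓡 n) (𝓡 m) (φ.symm ∘ proj ∘ ψ) (f x)) fun v =>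
      (congr($comp_eq v) :
        v = mfderiv (𝓡 n) (𝓡 m) (φ.symm ∘ proj ∘ ψ) (f x) (mfderiv (𝓡 m) (𝓡 n) f x v)).symm

theorem isLocalDiffeomorphAt_of_mem_maximalAtlas {ψ : OpenPartialHomeomorph L
    (EuclideanSpace ℝ (Fin n))} (hψ : ψ ∈ IsManifold.maximalAtlas (𝓡 n) ∞ L) {y : L}
    (hy : y ∈ ψ.source) : IsLocalDiffeomorphAt (𝓡 n) (𝓡 n) ∞ ψ y :=
  PartialDiffeomorph.isLocalDiffeomorphAt (𝓡 n) (𝓡 n) ∞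
    { ψ with
      contMDiffOn_toFun := contMDiffOn_of_mem_maximalAtlas hψ
      contMDiffOn_invFun := contMDiffOn_symm_of_mem_maximalAtlas hψ } hy

/-- In the slice charts of an embedding, the points of the target near `f x` which lie on the image
are those whose transverse coordinate vanishes. -/
theorem eventually_mem_range_iff_of_isSmoothEmbedding
    (hf : IsSmoothEmbedding (𝓡 m) (𝓡 n) ∞ f) (h : IsImmersionAt (𝓡 m) (𝓡 n) ∞ f x) :
    ∀ᶠ y in 𝓝 (f x), y ∈ range f ↔ (h.equiv.symm (h.codChart y)).2 = 0 := by
  set φ := h.domChart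
  set ψ := h.codChart
  have hx : x ∈ φ.source := h.mem_domChart_source
  have hfx : f x ∈ ψ.source := h.mem_codChart_source
  obtain ⟨V, hV, mem_source⟩ := Filter.mem_comap.1
    (hf.isEmbedding.nhds_eq_comap x ▸ φ.open_source.mem_nhds hx)
  have tangent : (h.equiv.symm (ψ (f x))).1 ∈ φ.target := by
    rw [codChart_apply_of_isImmersionAt h hx, h.equiv.symm_apply_apply]
    exact φ.map_source hx
  have continuousAt : ContinuousAt (fun y => (h.equiv.symm (ψ y)).1) (f x) :=
    continuous_fst.continuousAt.comp
      (h.equiv.symm.continuous.continuousAt.comp (ψ.continuousAt hfx))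
  filter_upwards [hV, ψ.open_source.mem_nhds hfx,
    continuousAt.eventually (φ.open_target.mem_nhds tangent)] with y hyV hyψ hyφ
  constructor
  · rintro ⟨z, rfl⟩
    rw [codChart_apply_of_isImmersionAt h (mem_source hyV), h.equiv.symm_apply_apply]
  · intro zero
    have hz := φ.map_target hyφ
    refine ⟨φ.symm (h.equiv.symm (ψ y)).1,
      ψ.injOn (h.source_subset_preimage_source hz) hyψ ?_⟩
    rw [codChart_apply_of_isImmersionAt h hz, φ.right_inv hyφ, ← zero, Prod.mk.eta,
      h.equiv.apply_symm_apply]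

end Immersion

theorem exists_local_equation_of_isSmoothEmbedding {n : ℕ} {S : Type*} [TopologicalSpace S]
    [ChartedSpace (EuclideanSpace ℝ (Fin n)) S] {L : Type*} [TopologicalSpace L]
    [ChartedSpace (EuclideanSpace ℝ (Fin (n + 1))) L] {f : S → L}
    (hf : IsSmoothEmbedding (𝓡 n) (𝓡 (n + 1)) ∞ f) (x : S) :
    ∃ k : L → ℝ, ContMDiffAt (𝓡 (n + 1)) 𝓘(ℝ, ℝ) ∞ k (f x) ∧
      Function.Surjective (mfderiv (𝓡 (n + 1)) 𝓘(ℝ, ℝ) k (f x)) ∧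
      ∀ᶠ y in 𝓝 (f x), y ∈ range f ↔ k y = 0 := by
  have h := hf.isImmersion.isImmersionAt x
  have : FiniteDimensional ℝ (EuclideanSpace ℝ (Fin n) × h.complement) :=
    h.equiv.symm.toLinearEquiv.finiteDimensional
  have : FiniteDimensional ℝ h.complement :=
    Module.Finite.of_surjective (LinearMap.snd ℝ (EuclideanSpace ℝ (Fin n)) h.complement)
      LinearMap.snd_surjective
  have finrank_complement : Module.finrank ℝ h.complement = Module.finrank ℝ ℝ := by
    have := h.equiv.toLinearEquiv.finrank_eq
    rw [Module.finrank_prod, finrank_euclideanSpace_fin, finrank_euclideanSpace_fin] at this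
    rw [Module.finrank_self]
    exact Nat.add_left_cancel this
  let ℓ : h.complement ≃L[ℝ] ℝ := ContinuousLinearEquiv.ofFinrankEq finrank_complement
  let A : EuclideanSpace ℝ (Fin (n + 1)) →L[ℝ] ℝ := (ℓ : h.complement →L[ℝ] ℝ).comp
    ((ContinuousLinearMap.snd ℝ (EuclideanSpace ℝ (Fin n)) h.complement).comp
      (h.equiv.symm : EuclideanSpace ℝ (Fin (n + 1)) →L[ℝ] _))
  have A_surjective : Function.Surjective A := fun t => ⟨h.equiv (0, ℓ.symm t), by simp [A]⟩
  have chart := isLocalDiffeomorphAt_of_mem_maximalAtlas h.codChart_mem_maximalAtlas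
    h.mem_codChart_source
  refine ⟨A ∘ h.codChart, A.contMDiff.contMDiffAt.comp _ chart.contMDiffAt, ?_,
    (eventually_mem_range_iff_of_isSmoothEmbedding hf h).mono fun y hy => hy.trans ?_⟩
  · rw [mfderiv_comp _ A.mdifferentiableAt (chart.mdifferentiableAt (by simp)),
      ContinuousLinearMap.mfderiv_eq]
    exact A_surjective.comp (chart.mfderivToContinuousLinearEquiv (by simp)).surjective
  · exact ℓ.map_eq_zero_iff.symm

/-! ### Surfaces in a quotient of Sol -/

/-- `q` is the quotient map of Sol by the group `Γ` of isometries, which acts freely. -/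
structure IsSolQuotient {L : Type*} [TopologicalSpace L] [ChartedSpace (EuclideanSpace ℝ (Fin 3)) L]
    (Γ : Subgroup (Sol ≃ₜ Sol)) (q : Sol → L) : Prop where
  isometry : Γ ≤ solIsometryGroup
  free : ∀ γ ∈ Γ, ∀ p : Sol, γ p = p → γ = 1
  diffeo : IsLocalDiffeomorph (𝓡 3) (𝓡 3) ∞ q
  surjective : Function.Surjective q
  fiber : ∀ x y, q x = q y ↔ ∃ γ ∈ Γ, γ x = y

section Covering

variable {L : Type*} [TopologicalSpace L] [ChartedSpace (EuclideanSpace ℝ (Fin 3)) L]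
  {Γ : Subgroup (Sol ≃ₜ Sol)} {q : Sol → L}

namespace IsSolQuotient

theorem apply_eq (hq : IsSolQuotient Γ q) {γ : Sol ≃ₜ Sol} (hγ : γ ∈ Γ) (p : Sol) :
    q (γ p) = q p :=
  ((hq.fiber _ _).2 ⟨γ, hγ, rfl⟩).symm

theorem eq_of_apply_eq (hq : IsSolQuotient Γ q) {γ δ : Sol ≃ₜ Sol} (hγ : γ ∈ Γ) (hδ : δ ∈ Γ)
    {p : Sol} (h : γ p = δ p) : γ = δ := by
  refine (inv_mul_eq_one.1 (hq.free (δ⁻¹ * γ) (Γ.mul_mem (Γ.inv_mem hδ) hγ) p ?_)).symm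
  change δ.symm (γ p) = p
  rw [h, δ.symm_apply_apply]

theorem continuous (hq : IsSolQuotient Γ q) : Continuous q :=
  hq.diffeo.contMDiff.continuous

theorem exists_injOn (hq : IsSolQuotient Γ q) (p : Sol) : ∃ U, IsOpen U ∧ p ∈ U ∧ InjOn q U :=
  hq.diffeo.isLocalHomeomorph.isLocallyInjective p

theorem isCoveringMap (hq : IsSolQuotient Γ q) : IsCoveringMap q := by
  let : MulAction Γ Sol :=
    { smul γ x := (γ : Sol ≃ₜ Sol) x
      one_smul _ := rfl
      mul_smul _ _ _ := rfl }
  have quotient : IsQuotientCoveringMap q Γ :=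
    { hq.diffeo.isOpenMap.isQuotientMap hq.continuous hq.surjective with
      continuous_const_smul γ := (γ : Sol ≃ₜ Sol).continuous
      apply_eq_iff_mem_orbit {x y} := by
        rw [eq_comm, hq.fiber]
        exact ⟨fun ⟨γ, hγ, h⟩ => ⟨⟨γ, hγ⟩, h⟩, fun ⟨γ, h⟩ => ⟨γ.1, γ.2, h⟩⟩
      disjoint p := by
        obtain ⟨U, hU, hp, injOn⟩ := hq.exists_injOn p
        refine ⟨U, hU.mem_nhds hp, ?_⟩
        rintro γ ⟨_, ⟨x, hx, rfl⟩, hγx⟩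
        exact Subtype.ext (hq.free γ γ.2 x (injOn hγx hx (hq.apply_eq γ.2 x))) }
  exact quotient.isCoveringMap

theorem exists_lift (hq : IsSolQuotient Γ q) {A : Type*} [TopologicalSpace A]
    [SimplyConnectedSpace A] [LocallyPathConnectedSpace A] {f : A → L} (hf : Continuous f) :
    ∃ F : A → Sol, Continuous F ∧ ∀ a, q (F a) = f a := by
  obtain ⟨a⟩ : Nonempty A := inferInstance
  obtain ⟨p, hp⟩ := hq.surjective (f a)
  obtain ⟨F, ⟨-, hF⟩, -⟩ := hq.isCoveringMap.existsUnique_continuousMap_lifts ⟨f, hf⟩ a p hp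
  exact ⟨F, F.continuous, congrFun hF⟩

theorem exists_deck (hq : IsSolQuotient Γ q) {A : Type*} [TopologicalSpace A] [ConnectedSpace A]
    {F G : A → Sol} (hF : Continuous F) (hG : Continuous G) (h : ∀ a, q (F a) = q (G a)) :
    ∃ γ ∈ Γ, ∀ a, G a = γ (F a) := by
  obtain ⟨a⟩ : Nonempty A := inferInstance
  obtain ⟨γ, hγ, hγa⟩ := (hq.fiber _ _).1 (h a)
  refine ⟨γ, hγ, fun b => (congrFun (hq.isCoveringMap.eq_of_comp_eq (γ.continuous.comp hF) hG
    (funext fun b => ?_) a hγa) b).symm⟩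
  exact (hq.apply_eq hγ _).trans (h b)

end IsSolQuotient

/-- Lift to Sol of an embedded surface `f`, where `g : N → S` is a covering of the surface, whose
fibres are identified with orbits of the subgroup `H` of `Γ`. -/
structure IsSurfaceLift {S N : Type*} [TopologicalSpace S]
    [ChartedSpace (EuclideanSpace ℝ (Fin 2)) S] [TopologicalSpace N]
    [ChartedSpace (EuclideanSpace ℝ (Fin 2)) N] (Γ : Subgroup (Sol ≃ₜ Sol)) (q : Sol → L)
    (H : Subgroup (Sol ≃ₜ Sol)) (g : N → S) (f : S → L) (F : N → Sol) : Prop where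
  le : H ≤ Γ
  diffeo : IsLocalDiffeomorph (𝓡 2) (𝓡 2) ∞ g
  surjective : Function.Surjective g
  embedding : IsSmoothEmbedding (𝓡 2) (𝓡 3) ∞ f
  continuous : Continuous F
  lift : ∀ s, q (F s) = f (g s)
  fiber : ∀ s s', g s = g s' → ∃ h ∈ H, F s' = h (F s)
  invariant : ∀ h ∈ H, ∀ s, ∃ s', g s' = g s ∧ F s' = h (F s)

namespace IsSurfaceLift

variable {S N : Type*} [TopologicalSpace S] [ChartedSpace (EuclideanSpace ℝ (Fin 2)) S]
  [TopologicalSpace N] [ChartedSpace (EuclideanSpace ℝ (Fin 2)) N]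
  {H : Subgroup (Sol ≃ₜ Sol)} {g : N → S} {f : S → L} {F : N → Sol}

theorem apply_mem_range_iff (hF : IsSurfaceLift Γ q H g f F) {h : Sol ≃ₜ Sol} (hh : h ∈ H)
    (p : Sol) : h p ∈ range F ↔ p ∈ range F := by
  have apply_mem {k : Sol ≃ₜ Sol} (hk : k ∈ H) {r : Sol} (hr : r ∈ range F) : k r ∈ range F := by
    obtain ⟨s, rfl⟩ := hr
    obtain ⟨s', -, hs'⟩ := hF.invariant k hk s
    exact ⟨s', hs'⟩
  refine ⟨fun hp => ?_, apply_mem hh⟩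
  rw [← h.symm_apply_apply p]
  exact apply_mem (H.inv_mem hh) hp

theorem eventually_mem_range_iff (hF : IsSurfaceLift Γ q H g f F) (hq : IsSolQuotient Γ q)
    (s : N) : ∀ᶠ p in 𝓝 (F s), p ∈ range F ↔ q p ∈ range f := by
  obtain ⟨U, hU, hsU, injOn⟩ := hq.exists_injOn (F s)
  have image_mem : g '' (F ⁻¹' U) ∈ 𝓝 (g s) := hF.diffeo.isOpenMap.image_mem_nhds
    (hF.continuous.continuousAt.preimage_mem_nhds (hU.mem_nhds hsU))
  obtain ⟨V, hV, hVU⟩ := Filter.mem_comap.1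
    (hF.embedding.isEmbedding.nhds_eq_comap (g s) ▸ image_mem)
  rw [← hF.lift] at hV
  filter_upwards [hU.mem_nhds hsU, hq.continuous.continuousAt hV] with p hpU hpV
  constructor
  · rintro ⟨s', rfl⟩
    exact ⟨g s', (hF.lift s').symm⟩
  · rintro ⟨x, hx⟩
    obtain ⟨s', hs'U, rfl⟩ := hVU (show f x ∈ V from hx ▸ hpV)
    exact ⟨s', injOn hs'U hpU ((hF.lift s').trans hx)⟩

theorem isClosed_range (hF : IsSurfaceLift Γ q H g f F) (hq : IsSolQuotient Γ q) [T2Space L]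
    [CompactSpace S] : IsClosed (range F) := by
  refine isClosed_of_closure_subset fun r hr => ?_
  have closed : IsClosed (q ⁻¹' range f) :=
    (isCompact_range hF.embedding.contMDiff.continuous).isClosed.preimage hq.continuous
  have subset : range F ⊆ q ⁻¹' range f := by
    rintro _ ⟨s, rfl⟩
    exact ⟨g s, (hF.lift s).symm⟩
  obtain ⟨x, hx⟩ := closure_minimal subset closed hr
  obtain ⟨s₀, rfl⟩ := hF.surjective x
  rw [← hF.lift, hq.fiber] at hx
  obtain ⟨γ, hγ, rfl⟩ := hx
  have near : ∀ᶠ p in 𝓝 (γ (F s₀)), γ.symm p ∈ range F ↔ q (γ.symm p) ∈ range f :=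
    γ.symm.continuous.continuousAt.eventually
      ((γ.symm_apply_apply (F s₀)).symm ▸ hF.eventually_mem_range_iff hq s₀)
  obtain ⟨_, ⟨s, rfl⟩, hs⟩ := ((mem_closure_iff_frequently.1 hr).and_eventually near).exists
  have symm_apply : q (γ.symm (F s)) = f (g s) :=
    (hq.apply_eq (Γ.inv_mem hγ) _).trans (hF.lift s)
  obtain ⟨t, ht⟩ := hs.2 ⟨g s, symm_apply.symm⟩
  have base_eq : g t = g s :=
    hF.embedding.isEmbedding.injective (by rw [← hF.lift, ht, symm_apply])
  obtain ⟨h, hh, hts⟩ := hF.fiber t s base_eq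
  have γ_eq : γ = h := hq.eq_of_apply_eq hγ (hF.le hh) (p := F t)
    (by rw [← hts, ht, γ.apply_symm_apply])
  rw [γ_eq, hF.apply_mem_range_iff hh]
  exact mem_range_self _

end IsSurfaceLift

theorem IsDefiningFunction.exists_of_eventually {E : Type*} [NormedAddCommGroup E] [NormedSpace ℝ E]
    {S : Set E} {h : E → ℝ} {x : E} (hh : ContDiffAt ℝ 1 h x) (h0 : fderiv ℝ h x ≠ 0)
    (hS : ∀ᶠ y in 𝓝 x, y ∈ S ↔ h y = 0) : ∃ U, x ∈ U ∧ IsDefiningFunction S U h := by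
  have fderiv_ne_zero : ∀ᶠ y in 𝓝 x, fderiv ℝ h y ≠ 0 :=
    (hh.fderiv_right (m := 0) (by simp)).continuousAt.eventually_ne h0
  obtain ⟨U, hU, hUo, hx⟩ :=
    mem_nhds_iff.1 ((hh.eventually (by simp)).and (fderiv_ne_zero.and hS))
  exact ⟨U, hx, hUo, fun y hy => (hU hy).1, fun y hy => (hU hy.1).2.1, fun y hy => (hU hy).2.2⟩

namespace IsSurfaceLift

variable {S N : Type*} [TopologicalSpace S] [ChartedSpace (EuclideanSpace ℝ (Fin 2)) S]
  [TopologicalSpace N] [ChartedSpace (EuclideanSpace ℝ (Fin 2)) N]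
  {H : Subgroup (Sol ≃ₜ Sol)} {g : N → S} {f : S → L} {F : N → Sol}

theorem exists_isDefiningFunction (hF : IsSurfaceLift Γ q H g f F) (hq : IsSolQuotient Γ q)
    {p : Sol} (hp : p ∈ range F) : ∃ U h, p ∈ U ∧ IsDefiningFunction (range F) U h := by
  obtain ⟨s, rfl⟩ := hp
  obtain ⟨k, k_smooth, k_surjective, hk⟩ :=
    exists_local_equation_of_isSmoothEmbedding hF.embedding (g s)
  rw [← hF.lift] at k_smooth k_surjective hk
  have smooth : ContDiffAt ℝ ∞ (k ∘ q) (F s) :=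
    (k_smooth.comp _ (hq.diffeo (F s)).contMDiffAt).contDiffAt
  have surjective : Function.Surjective (fderiv ℝ (k ∘ q) (F s)) := by
    rw [← mfderiv_eq_fderiv, mfderiv_comp (I' := 𝓡 3) _ (k_smooth.mdifferentiableAt (by simp))
      ((hq.diffeo (F s)).mdifferentiableAt (by simp))]
    exact k_surjective.comp ((hq.diffeo (F s)).mfderivToContinuousLinearEquiv (by simp)).surjective
  have ne_zero : fderiv ℝ (k ∘ q) (F s) ≠ 0 := fun h0 => by
    obtain ⟨v, hv⟩ := surjective 1
    rw [h0, zero_apply] at hv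
    exact zero_ne_one hv
  obtain ⟨U, hU, H⟩ := IsDefiningFunction.exists_of_eventually (smooth.of_le (by simp)) ne_zero (by
    filter_upwards [hF.eventually_mem_range_iff hq s, hq.continuous.continuousAt.eventually hk]
      with p hp hkp using hp.trans hkp)
  exact ⟨U, k ∘ q, hU, H⟩

theorem exists_isSide (hF : IsSurfaceLift Γ q H g f F) (hq : IsSolQuotient Γ q) [T2Space L]
    [CompactSpace S] : ∃ P, IsSide (range F) P :=
  _root_.exists_isSide (hF.isClosed_range hq) fun _ => hF.exists_isDefiningFunction hq

end IsSurfaceLift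

end Covering

/-! ### Two-sided surfaces -/

theorem fderiv_apply_fderiv_symm {h : Sol ≃ₜ Sol} (hh : h ∈ solIsometryGroup) (p w : Sol) :
    fderiv ℝ h p (fderiv ℝ h.symm (h p) w) = w := by
  have chain := fderiv_comp (h p) (g := h) (f := h.symm) (hh.1.differentiable (by simp) _)
    (hh.2.1.differentiable (by simp) _)
  rw [show (h ∘ h.symm : Sol → Sol) = id from funext h.apply_symm_apply, fderiv_id,
    h.symm_apply_apply] at chain
  exact congr($chain w).symm

/-- The gradient of a linear form with respect to the metric of Sol. -/
def solGrad (p : Sol) (φ : Sol →L[ℝ] ℝ) : Sol :=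
  ∑ i, φ (solFrame i p) • solFrame i p

theorem solInner_solGrad (p : Sol) (φ : Sol →L[ℝ] ℝ) (v : Sol) :
    solInner p (solGrad p φ) v = φ v := by
  conv_rhs => rw [eq_sum_solFrame p v, map_sum]
  conv_lhs => rw [eq_sum_solFrame p v]
  simp only [solGrad, map_sum, map_smul, sum_apply, smul_apply, solInner_solFrame, smul_eq_mul,
    mul_ite, mul_one, mul_zero, Finset.sum_ite_eq', Finset.mem_univ, if_true]

theorem eq_solGrad {p w : Sol} {φ : Sol →L[ℝ] ℝ} (h : ∀ v, solInner p w v = φ v) :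
    w = solGrad p φ := by
  by_contra hne
  have orthogonal (v : Sol) : solInner p (w - solGrad p φ) v = 0 := by
    rw [map_sub, sub_apply, h, solInner_solGrad, sub_self]
  exact (solInner_pos p (w - solGrad p φ) (sub_ne_zero.2 hne)).ne' (orthogonal _)

theorem apply_solGrad_pos {p : Sol} {φ : Sol →L[ℝ] ℝ} (hφ : φ ≠ 0) : 0 < φ (solGrad p φ) := by
  rw [← solInner_solGrad p]
  refine solInner_pos p _ fun h0 => hφ (ContinuousLinearMap.ext fun v => ?_)
  rw [← solInner_solGrad p φ v, h0, map_zero, zero_apply]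

theorem continuous_solGrad {X : Type*} [TopologicalSpace X] {p : X → Sol} {φ : X → Sol →L[ℝ] ℝ}
    (hp : Continuous p) (hφ : Continuous φ) : Continuous fun x => solGrad (p x) (φ x) := by
  have frame (i : Fin 3) : Continuous fun x => solFrame i (p x) :=
    (contDiff_solFrame i).continuous.comp hp
  exact continuous_finsetSum _ fun i _ => (hφ.clm_apply (frame i)).smul (frame i)

theorem solGrad_map {h : Sol ≃ₜ Sol} (hh : h ∈ solIsometryGroup) {p : Sol} {φ ψ : Sol →L[ℝ] ℝ}
    {c : ℝ} (hψ : ∀ v, ψ (fderiv ℝ h p v) = c * φ v) :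
    solGrad (h p) ψ = c • fderiv ℝ h p (solGrad p φ) := by
  refine (eq_solGrad fun w => ?_).symm
  rw [map_smul, smul_apply, ← fderiv_apply_fderiv_symm hh p w, hψ, smul_eq_mul,
    ← solInner_solGrad p φ]
  exact congrArg (c * ·) (hh.2.2 p _ _)

/-- The unit normal vector of the kernel of a linear form, with respect to the metric of Sol. -/
def solNormal (p : Sol) (φ : Sol →L[ℝ] ℝ) : Sol := (√(φ (solGrad p φ)))⁻¹ • solGrad p φ

theorem apply_solNormal_pos {p : Sol} {φ : Sol →L[ℝ] ℝ} (hφ : φ ≠ 0) : 0 < φ (solNormal p φ) := by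
  have := apply_solGrad_pos (p := p) hφ
  rw [solNormal, map_smul, smul_eq_mul]
  positivity

theorem solNormal_map {h : Sol ≃ₜ Sol} (hh : h ∈ solIsometryGroup) {p : Sol} {φ ψ : Sol →L[ℝ] ℝ}
    {c : ℝ} (hc : 0 < c) (hψ : ∀ v, ψ (fderiv ℝ h p v) = c * φ v) :
    solNormal (h p) ψ = fderiv ℝ h p (solNormal p φ) := by
  have sq_norm : ψ (solGrad (h p) ψ) = c ^ 2 * φ (solGrad p φ) := by
    rw [solGrad_map hh hψ, map_smul, hψ, smul_eq_mul]
    ring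
  rw [solNormal, solNormal, sq_norm, Real.sqrt_mul (sq_nonneg c), Real.sqrt_sq hc.le,
    solGrad_map hh hψ, map_smul, smul_smul, mul_inv_rev, mul_assoc, inv_mul_cancel₀ hc.ne',
    mul_one]

theorem continuous_solNormal {X : Type*} [TopologicalSpace X] {p : X → Sol} {φ : X → Sol →L[ℝ] ℝ}
    (hp : Continuous p) (hφ : Continuous φ) (h0 : ∀ x, φ x ≠ 0) :
    Continuous fun x => solNormal (p x) (φ x) :=
  have grad := continuous_solGrad hp hφ
  ((hφ.clm_apply grad).sqrt.inv₀ fun x =>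
    (Real.sqrt_pos.2 (apply_solGrad_pos (h0 x))).ne').smul grad

section TwoSided

variable {L : Type*} [TopologicalSpace L] [ChartedSpace (EuclideanSpace ℝ (Fin 3)) L]
  {Γ : Subgroup (Sol ≃ₜ Sol)} {q : Sol → L}

theorem IsSolQuotient.mfderiv_map (hq : IsSolQuotient Γ q) {h : Sol ≃ₜ Sol} (hh : h ∈ Γ)
    (p v : Sol) : (mfderiv (𝓡 3) (𝓡 3) q (h p) (fderiv ℝ h p v) : EuclideanSpace ℝ (Fin 3)) =
      mfderiv (𝓡 3) (𝓡 3) q p v := by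
  have chain := mfderiv_comp p (I' := 𝓡 3) (g := q) (f := h)
    ((hq.diffeo (h p)).mdifferentiableAt (by simp))
    (((hq.isometry hh).1.differentiable (by simp) p).mdifferentiableAt)
  rw [show q ∘ h = q from funext (hq.apply_eq hh), mfderiv_eq_fderiv] at chain
  exact congrArg (fun T : Sol →L[ℝ] Sol => T v) chain.symm

theorem IsDefiningFunction.comp_isometry {S U : Set Sol} {k : Sol → ℝ}
    (hk : IsDefiningFunction S U k) {h : Sol ≃ₜ Sol} (hh : h ∈ solIsometryGroup)
    (hS : ∀ p, h p ∈ S ↔ p ∈ S) : IsDefiningFunction S (h ⁻¹' U) (k ∘ h) where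
  isOpen := hk.isOpen.preimage h.continuous
  contDiffAt y hy := (hk.contDiffAt _ hy).comp y (hh.1.contDiffAt.of_le (by simp))
  fderiv_ne_zero y hy h0 := by
    apply hk.fderiv_ne_zero (h y) ⟨hy.1, (hS y).2 hy.2⟩
    rw [fderiv_comp y ((hk.contDiffAt _ hy.1).differentiableAt (by simp))
      (hh.1.differentiable (by simp) y)] at h0
    ext w
    rw [← fderiv_apply_fderiv_symm hh y w]
    exact DFunLike.congr_fun h0 _
  mem_iff y hy := by rw [← hS]; exact hk.mem_iff _ hy

theorem IsSide.preimage_isometry {S P : Set Sol} (hP : IsSide S P) {h : Sol ≃ₜ Sol}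
    (hh : h ∈ solIsometryGroup) (hS : ∀ p, h p ∈ S ↔ p ∈ S) : IsSide S (h ⁻¹' P) := fun x => by
  obtain ⟨U, k, hU, hk, hPk⟩ := hP (h x)
  exact ⟨h ⁻¹' U, k ∘ h, hU, hk.comp_isometry hh hS, fun y hy => hPk (h y) hy⟩

theorem IsConormal.exists_comp_fderiv_eq {S P : Set Sol} (hP : IsSide S P) {h : Sol ≃ₜ Sol}
    (hh : h ∈ solIsometryGroup) (hS : ∀ p, h p ∈ S ↔ p ∈ S) (hinv : ∀ p, h p ∈ P ↔ p ∈ P)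
    {p : Sol} (hp : p ∈ S) {φ ψ : Sol →L[ℝ] ℝ} (hφ : IsConormal P p φ)
    (hψ : IsConormal P (h p) ψ) : ∃ c > 0, ∀ v, ψ (fderiv ℝ h p v) = c * φ v := by
  obtain ⟨U, k, hU, hk, hPk⟩ := hP (h p)
  obtain ⟨c, hc, rfl⟩ := (hk.isConormal hPk hU ((hS p).2 hp)).exists_eq_smul hψ
  obtain ⟨d, hd, k_eq⟩ := hφ.exists_eq_smul ((hk.comp_isometry hh hS).isConormal (P := P)
    (fun y hy => by rw [← hinv]; exact hPk _ hy) hU hp)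
  rw [fderiv_comp p ((hk.contDiffAt _ hU).differentiableAt (by simp))
    (hh.1.differentiable (by simp) p)] at k_eq
  refine ⟨c * d, mul_pos hc hd, fun v => ?_⟩
  rw [smul_apply, show fderiv ℝ k (h p) (fderiv ℝ h p v) = d * φ v from congr($k_eq v),
    smul_eq_mul, mul_assoc]

namespace IsSurfaceLift

variable {S N : Type*} [TopologicalSpace S] [ChartedSpace (EuclideanSpace ℝ (Fin 2)) S]
  [TopologicalSpace N] [ChartedSpace (EuclideanSpace ℝ (Fin 2)) N]
  {H : Subgroup (Sol ≃ₜ Sol)} {g : N → S} {f : S → L} {F : N → Sol}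

theorem isQuotientMap (hF : IsSurfaceLift Γ q H g f F) : IsQuotientMap g :=
  hF.diffeo.isOpenMap.isQuotientMap hF.diffeo.contMDiff.continuous hF.surjective

theorem contMDiff (hF : IsSurfaceLift Γ q H g f F) (hq : IsSolQuotient Γ q) :
    ContMDiff (𝓡 2) (𝓡 3) ∞ F := by
  intro s
  have hloc := hq.diffeo (F s)
  have eventually_eq : F =ᶠ[𝓝 s] hloc.localInverse ∘ (f ∘ g) := by
    filter_upwards [hF.continuous.continuousAt.eventually hloc.localInverse_eventuallyEq_left]
      with s' hs'
    rw [Function.comp_apply, Function.comp_apply, ← hF.lift]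
    exact hs'.symm
  have smooth_inverse : ContMDiffAt (𝓡 3) (𝓡 3) ∞ hloc.localInverse ((f ∘ g) s) := by
    rw [Function.comp_apply, ← hF.lift]
    exact hloc.localInverse_contMDiffAt
  exact (smooth_inverse.comp s (hF.embedding.contMDiff.contMDiffAt.comp s
    (hF.diffeo s).contMDiffAt)).congr_of_eventuallyEq eventually_eq

theorem mfderiv_comp_eq (hF : IsSurfaceLift Γ q H g f F) (hq : IsSolQuotient Γ q)
    (s : N) (v : EuclideanSpace ℝ (Fin 2)) :
    (mfderiv (𝓡 3) (𝓡 3) q (F s) (mfderiv (𝓡 2) (𝓡 3) F s v) : EuclideanSpace ℝ (Fin 3)) =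
      mfderiv (𝓡 2) (𝓡 3) f (g s) (mfderiv (𝓡 2) (𝓡 2) g s v) := by
  have chain_left := mfderiv_comp s ((hq.diffeo (F s)).mdifferentiableAt (by simp))
    ((hF.contMDiff hq s).mdifferentiableAt (by simp))
  have chain_right := mfderiv_comp s (hF.embedding.contMDiff.mdifferentiableAt (by simp) (x := g s))
    ((hF.diffeo s).mdifferentiableAt (by simp))
  rw [show q ∘ F = f ∘ g from funext hF.lift] at chain_left
  exact congrArg (fun T : EuclideanSpace ℝ (Fin 2) →L[ℝ] EuclideanSpace ℝ (Fin 3) => T v)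
    (chain_left.symm.trans chain_right)

theorem mfderiv_injective [IsManifold (𝓡 2) ∞ S] [IsManifold (𝓡 3) ∞ L]
    (hF : IsSurfaceLift Γ q H g f F) (hq : IsSolQuotient Γ q) (s : N) :
    Function.Injective (mfderiv (𝓡 2) (𝓡 3) F s) := by
  intro u v huv
  apply ((hF.diffeo s).mfderivToContinuousLinearEquiv (by simp)).injective
  apply mfderiv_injective_of_isImmersionAt (hF.embedding.isImmersion.isImmersionAt (g s))
  refine (hF.mfderiv_comp_eq hq s u).symm.trans (Eq.trans ?_ (hF.mfderiv_comp_eq hq s v))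
  exact congrArg (fun w => (mfderiv (𝓡 3) (𝓡 3) q (F s) w : EuclideanSpace ℝ (Fin 3))) huv

theorem isTwoSided_of_field [IsManifold (𝓡 3) ∞ L] (hF : IsSurfaceLift Γ q H g f F)
    (hq : IsSolQuotient Γ q) {n : N → Sol} (hn : Continuous n)
    (hnormal : ∀ s, n s ∉ range (mfderiv (𝓡 2) (𝓡 3) F s))
    (hinv : ∀ s s', g s = g s' → ∃ h ∈ Γ, F s' = h (F s) ∧ n s' = fderiv ℝ h (F s) (n s)) :
    IsTwoSided f := by
  let push (p v : Sol) : EuclideanSpace ℝ (Fin 3) := mfderiv (𝓡 3) (𝓡 3) q p v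
  let w (s : N) : EuclideanSpace ℝ (Fin 3) := push (F s) (n s)
  let v (x : S) : TangentSpace (𝓡 3) (f x) := w (Function.surjInv hF.surjective x)
  have v_apply (s : N) : v (g s) = w s := by
    obtain ⟨h, hh, F_eq, n_eq⟩ := hinv _ s (Function.surjInv_eq hF.surjective (g s))
    change push _ _ = push _ _
    rw [F_eq, n_eq]
    exact (hq.mfderiv_map hh _ _).symm
  refine ⟨v, hF.isQuotientMap.continuous_iff.2 ?_, fun x => ?_⟩
  · have continuous : Continuous fun s => tangentMap (𝓡 3) (𝓡 3) q ⟨F s, n s⟩ :=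
      (hq.diffeo.contMDiff.continuous_tangentMap (by simp)).comp
        ((tangentBundleModelSpaceHomeomorph (𝓡 3)).symm.continuous.comp (hF.continuous.prodMk hn))
    refine continuous.congr fun s => ?_
    exact congrArg₂ (fun y v => (⟨y, v⟩ : TangentBundle (𝓡 3) L)) (hF.lift s) (v_apply s).symm
  · rintro ⟨u, hu⟩
    obtain ⟨s, rfl⟩ := hF.surjective x
    obtain ⟨u, rfl⟩ := ((hF.diffeo s).mfderivToContinuousLinearEquiv (by simp)).surjective u
    exact hnormal s ⟨u, ((hq.diffeo (F s)).mfderivToContinuousLinearEquiv (by simp)).injective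
      ((hF.mfderiv_comp_eq hq s u).trans (hu.trans (v_apply s)))⟩

theorem isTwoSided_of_conormal [IsManifold (𝓡 3) ∞ L] (hF : IsSurfaceLift Γ q H g f F)
    (hq : IsSolQuotient Γ q) {φ : N → Sol →L[ℝ] ℝ} (hφ : Continuous φ) (h0 : ∀ s, φ s ≠ 0)
    (htan : ∀ s v, φ s (mfderiv (𝓡 2) (𝓡 3) F s v) = 0)
    (hinv : ∀ s s', g s = g s' → ∃ h ∈ Γ, F s' = h (F s) ∧ ∃ c > 0,
      ∀ v, φ s' (fderiv ℝ h (F s) v) = c * φ s v) : IsTwoSided f := by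
  refine hF.isTwoSided_of_field hq (n := fun s => solNormal (F s) (φ s))
    (continuous_solNormal hF.continuous hφ h0) ?_ fun s s' hs => ?_
  · rintro s ⟨v, hv⟩
    exact (apply_solNormal_pos (p := F s) (h0 s)).ne' (by rw [← hv]; exact htan s v)
  · obtain ⟨h, hh, F_eq, c, hc, hφc⟩ := hinv s s' hs
    refine ⟨h, hh, F_eq, ?_⟩
    rw [F_eq]
    exact solNormal_map (hq.isometry hh) hc hφc

theorem isSide_invariant (hF : IsSurfaceLift Γ q H g f F) (hq : IsSolQuotient Γ q)
    {P : Set Sol} (hP : IsSide (range F) P) {h : Sol ≃ₜ Sol} (hh : h ∈ H) {p₀ : Sol}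
    (hp₀ : p₀ ∉ range F) (h0 : h p₀ ∈ P ↔ p₀ ∈ P) (p : Sol) : h p ∈ P ↔ p ∈ P :=
  Set.ext_iff.1 ((hP.preimage_isometry (hq.isometry (hF.le hh))
    (hF.apply_mem_range_iff hh)).eq_of_mem_iff hP hp₀ h0) p

theorem conormal_mfderiv (hF : IsSurfaceLift Γ q H g f F) (hq : IsSolQuotient Γ q)
    {P : Set Sol} (hP : IsSide (range F) P) {s : N} {φ : Sol →L[ℝ] ℝ} (hφ : IsConormal P (F s) φ)
    (v : EuclideanSpace ℝ (Fin 2)) : φ (mfderiv (𝓡 2) (𝓡 3) F s v) = 0 := by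
  obtain ⟨U, k, hU, hk, hPk⟩ := hP (F s)
  obtain ⟨c, -, rfl⟩ := (hk.isConormal hPk hU (mem_range_self s)).exists_eq_smul hφ
  have vanishes : k ∘ F =ᶠ[𝓝 s] fun _ => 0 := by
    filter_upwards [hF.continuous.continuousAt.eventually (hk.isOpen.mem_nhds hU)] with s' hs'
      using (hk.mem_iff _ hs').1 (mem_range_self s')
  have chain := mfderiv_comp s (I'' := 𝓘(ℝ, ℝ))
    ((hk.contDiffAt _ hU).differentiableAt (by simp)).mdifferentiableAt
    ((hF.contMDiff hq s).mdifferentiableAt (by simp))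
  rw [vanishes.mfderiv_eq, mfderiv_const, mfderiv_eq_fderiv] at chain
  have fderiv_eq_zero : fderiv ℝ k (F s) (mfderiv (𝓡 2) (𝓡 3) F s v) = 0 :=
    (congrArg (fun T : EuclideanSpace ℝ (Fin 2) →L[ℝ] ℝ => T v) chain).symm
  exact (congrArg (c * ·) fderiv_eq_zero).trans (mul_zero c)

theorem isTwoSided_of_isSide [IsManifold (𝓡 3) ∞ L]
    (hF : IsSurfaceLift Γ q H g f F) (hq : IsSolQuotient Γ q) {P : Set Sol}
    (hP : IsSide (range F) P) (hinv : ∀ h ∈ H, ∀ p, h p ∈ P ↔ p ∈ P) : IsTwoSided f := by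
  obtain ⟨ν, hνc, hν⟩ := hP.exists_conormal
  refine hF.isTwoSided_of_conormal hq (φ := fun s => ν (F s))
    (hνc.comp_continuous hF.continuous mem_range_self)
    (fun s => (hν _ (mem_range_self s)).ne_zero)
    (fun s v => hF.conormal_mfderiv hq hP (hν _ (mem_range_self s)) v) fun s s' hs => ?_
  obtain ⟨h, hh, F_eq⟩ := hF.fiber s s' hs
  refine ⟨h, hF.le hh, F_eq, ?_⟩
  rw [F_eq]
  exact IsConormal.exists_comp_fderiv_eq hP (hq.isometry (hF.le hh)) (hF.apply_mem_range_iff hh)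
    (hinv h hh) (mem_range_self s) (hν _ (mem_range_self s)) (hν _ (F_eq ▸ mem_range_self s'))

end IsSurfaceLift

end TwoSided

/-! ### Vertical axes -/

theorem exp_mul_exp_neg (l : ℝ) : Real.exp l * Real.exp (-l) = 1 := by
  rw [← Real.exp_add, add_neg_cancel, Real.exp_zero]

/-- The isometries of Sol which preserve the vertical line over `(x₀, y₀)` and its orientation. -/
def axisStabilizer (x₀ y₀ : ℝ) : Subgroup (Sol ≃ₜ Sol) where
  carrier := {h | ∃ e₀ e₁ l : ℝ, e₀ * e₀ = 1 ∧ e₁ * e₁ = 1 ∧ ∀ p,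
    h p 0 - x₀ = e₀ * Real.exp l * (p 0 - x₀) ∧ h p 1 - y₀ = e₁ * Real.exp (-l) * (p 1 - y₀) ∧
    h p 2 = p 2 + l}
  one_mem' := ⟨1, 1, 0, by norm_num, by norm_num, fun p => by simp⟩
  mul_mem' := by
    rintro h k ⟨e₀, e₁, l, he₀, he₁, hh⟩ ⟨d₀, d₁, m, hd₀, hd₁, hk⟩
    refine ⟨e₀ * d₀, e₁ * d₁, l + m, by linear_combination he₀ * d₀ * d₀ + hd₀,
      by linear_combination he₁ * d₁ * d₁ + hd₁, fun p => ?_⟩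
    obtain ⟨h0, h1, h2⟩ := hh (k p)
    obtain ⟨k0, k1, k2⟩ := hk p
    rw [Homeomorph.mul_apply, h0, h1, h2, k0, k1, k2, neg_add, Real.exp_add, Real.exp_add]
    exact ⟨by ring, by ring, by ring⟩
  inv_mem' := by
    rintro h ⟨e₀, e₁, l, he₀, he₁, hh⟩
    refine ⟨e₀, e₁, -l, he₀, he₁, fun p => ?_⟩
    obtain ⟨h0, h1, h2⟩ := hh (h⁻¹ p)
    rw [show h (h⁻¹ p) = p from h.apply_symm_apply p] at h0 h1 h2
    rw [h0, h1, h2, neg_neg]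
    refine ⟨?_, ?_, by ring⟩
    · linear_combination (-(h⁻¹ p 0 - x₀)) * (e₀ * e₀ * exp_mul_exp_neg l + he₀)
    · linear_combination (-(h⁻¹ p 1 - y₀)) * (e₁ * e₁ * exp_mul_exp_neg l + he₁)

/-- Coordinates `(u, w, z)` of Sol such that the isometries preserving the oriented vertical line
over `(x₀, y₀)` only change the signs of `u` and `w` and translate `z`. -/
def axisCoord (x₀ y₀ : ℝ) : Sol ≃ₜ Sol where
  toFun p := !₂[(p 0 - x₀) * Real.exp (-p 2), (p 1 - y₀) * Real.exp (p 2), p 2]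
  invFun p := !₂[p 0 * Real.exp (p 2) + x₀, p 1 * Real.exp (-p 2) + y₀, p 2]
  left_inv p := by
    ext i
    fin_cases i
    · change (p 0 - x₀) * Real.exp (-p 2) * Real.exp (p 2) + x₀ = p 0
      linear_combination (p 0 - x₀) * exp_mul_exp_neg (p 2)
    · change (p 1 - y₀) * Real.exp (p 2) * Real.exp (-p 2) + y₀ = p 1
      linear_combination (p 1 - y₀) * exp_mul_exp_neg (p 2)
    · rfl
  right_inv p := by
    ext i
    fin_cases i
    · change (p 0 * Real.exp (p 2) + x₀ - x₀) * Real.exp (-p 2) = p 0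
      linear_combination p 0 * exp_mul_exp_neg (p 2)
    · change (p 1 * Real.exp (-p 2) + y₀ - y₀) * Real.exp (p 2) = p 1
      linear_combination p 1 * exp_mul_exp_neg (p 2)
    · rfl
  continuous_toFun := by fun_prop
  continuous_invFun := by fun_prop

/-- A function measuring how far a point of Sol is from the vertical line over `(x₀, y₀)`. -/
def axisDist (x₀ y₀ : ℝ) (p : Sol) : ℝ := max |axisCoord x₀ y₀ p 0| |axisCoord x₀ y₀ p 1|

theorem continuous_axisDist (x₀ y₀ : ℝ) : Continuous (axisDist x₀ y₀) := by
  unfold axisDist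
  fun_prop

theorem axisDist_map {x₀ y₀ : ℝ} {h : Sol ≃ₜ Sol} (hh : h ∈ axisStabilizer x₀ y₀) (p : Sol) :
    axisDist x₀ y₀ (h p) = axisDist x₀ y₀ p := by
  obtain ⟨e₀, e₁, l, he₀, he₁, hp⟩ := hh
  obtain ⟨h0, h1, h2⟩ := hp p
  have abs_mul_eq {e r : ℝ} (he : e * e = 1) : |e * r| = |r| := by
    rw [abs_mul, (abs_eq zero_le_one).2 (mul_self_eq_one_iff.1 he), one_mul]
  have coord_zero : axisCoord x₀ y₀ (h p) 0 = e₀ * axisCoord x₀ y₀ p 0 := by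
    change (h p 0 - x₀) * Real.exp (-h p 2) = e₀ * ((p 0 - x₀) * Real.exp (-p 2))
    rw [h0, h2, neg_add, Real.exp_add]
    linear_combination e₀ * (p 0 - x₀) * Real.exp (-p 2) * exp_mul_exp_neg l
  have coord_one : axisCoord x₀ y₀ (h p) 1 = e₁ * axisCoord x₀ y₀ p 1 := by
    change (h p 1 - y₀) * Real.exp (h p 2) = e₁ * ((p 1 - y₀) * Real.exp (p 2))
    rw [h1, h2, Real.exp_add]
    linear_combination e₁ * (p 1 - y₀) * Real.exp (p 2) * exp_mul_exp_neg l
  rw [axisDist, coord_zero, coord_one, abs_mul_eq he₀, abs_mul_eq he₁, axisDist]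

theorem isPreconnected_lt_max_abs (C : ℝ) : IsPreconnected {p : Sol | C < max |p 0| |p 1|} := by
  have half_space (c : ℝ) (i : Fin 3) : IsPreconnected {p : Sol | C < c * p i} :=
    (convex_halfSpace_gt ((c • (EuclideanSpace.proj i : Sol →L[ℝ] ℝ)).isLinear) C).isPreconnected
  have three := ((half_space 1 0).union' ⟨!₂[C + 1, C + 1, 0], by simp, by simp⟩
    (half_space 1 1)).union' ⟨!₂[-(C + 1), C + 1, 0], by simp, by simp⟩ (half_space (-1) 0)
  convert three.union' ⟨!₂[-(C + 1), -(C + 1), 0], by simp, by simp⟩ (half_space (-1) 1) using 1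
  ext p
  simp only [mem_ofPred_eq, mem_union, lt_max_iff, lt_abs, one_mul, neg_one_mul]
  tauto

theorem isPreconnected_lt_axisDist (x₀ y₀ C : ℝ) : IsPreconnected {p | C < axisDist x₀ y₀ p} :=
  (axisCoord x₀ y₀).isPreconnected_preimage.2 (isPreconnected_lt_max_abs C)

theorem exists_lt_axisDist (x₀ y₀ C : ℝ) : ∃ p, C < axisDist x₀ y₀ p := by
  refine ⟨(axisCoord x₀ y₀).symm !₂[C + 1, 0, 0], ?_⟩
  rw [axisDist, Homeomorph.apply_symm_apply]
  exact (lt_add_one C).trans_le ((le_abs_self _).trans (le_max_left _ _))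

theorem bddAbove_range_of_factorsThrough {A B : Type*} [TopologicalSpace A] [TopologicalSpace B]
    [CompactSpace B] {g : A → B} (hg : IsQuotientMap g) {φ : A → ℝ} (hφ : Continuous φ)
    (factors : Function.FactorsThrough φ g) : BddAbove (range φ) := by
  let g' : C(A, B) := ⟨g, hg.continuous⟩
  have quotient : IsQuotientMap g' := hg
  let descended : C(B, ℝ) := quotient.lift ⟨φ, hφ⟩ factors
  refine (isCompact_range descended.continuous).bddAbove.mono ?_
  rintro _ ⟨a, rfl⟩
  exact ⟨g a, congr($(quotient.lift_comp ⟨φ, hφ⟩ factors) a)⟩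

section Axis

variable {L : Type*} [TopologicalSpace L] [ChartedSpace (EuclideanSpace ℝ (Fin 3)) L]
  {Γ : Subgroup (Sol ≃ₜ Sol)} {q : Sol → L}
  {S N : Type*} [TopologicalSpace S] [ChartedSpace (EuclideanSpace ℝ (Fin 2)) S]
  [TopologicalSpace N] [ChartedSpace (EuclideanSpace ℝ (Fin 2)) N]
  {H : Subgroup (Sol ≃ₜ Sol)} {g : N → S} {f : S → L} {F : N → Sol}

-- Far from the axis, the complement of the lifted surface is connected and invariant.
theorem IsSurfaceLift.isTwoSided_of_le_axisStabilizer [IsManifold (𝓡 3) ∞ L] [T2Space L]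
    [CompactSpace S] (hF : IsSurfaceLift Γ q H g f F) (hq : IsSolQuotient Γ q) {x₀ y₀ : ℝ}
    (hH : H ≤ axisStabilizer x₀ y₀) : IsTwoSided f := by
  obtain ⟨P, hP⟩ := hF.exists_isSide hq
  obtain ⟨C, hC⟩ := bddAbove_range_of_factorsThrough hF.isQuotientMap
    ((continuous_axisDist x₀ y₀).comp hF.continuous) fun s s' hs => by
      obtain ⟨h, hh, F_eq⟩ := hF.fiber s s' hs
      exact ((congrArg _ F_eq).trans (axisDist_map (hH hh) (F s))).symm
  have disjoint : Disjoint {p | C < axisDist x₀ y₀ p} (range F) := by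
    rw [Set.disjoint_left]
    rintro _ hp ⟨s, rfl⟩
    exact (hC (mem_range_self s)).not_gt hp
  obtain ⟨p₀, hp₀⟩ := exists_lt_axisDist x₀ y₀ C
  refine hF.isTwoSided_of_isSide hq hP fun h hh => hF.isSide_invariant hq hP hh
    (Set.disjoint_left.1 disjoint hp₀) (hP.mem_iff_of_isPreconnected
      (isPreconnected_lt_axisDist x₀ y₀ C) disjoint ?_ hp₀)
  rwa [mem_ofPred_eq, axisDist_map (hH hh)]

end Axis

/-! ### Straight and swapping isometries -/

theorem abs_mul_exp_eq {e : ℝ} (he : e * e = 1) (l : ℝ) : |e * Real.exp l| = Real.exp l := by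
  rw [abs_mul, Real.abs_exp, (abs_eq zero_le_one).2 (mul_self_eq_one_iff.1 he), one_mul]

theorem abs_mul_exp_ne_one {e l : ℝ} (he : e * e = 1) (hl : l ≠ 0) : |e * Real.exp l| ≠ 1 := by
  rwa [abs_mul_exp_eq he, Ne, Real.exp_eq_one_iff]

theorem mul_exp_ne_one {e l : ℝ} (he : e * e = 1) (hl : l ≠ 0) : e * Real.exp l ≠ 1 := fun h =>
  abs_mul_exp_ne_one he hl (by rw [h, abs_one])

namespace IsStraight

theorem apply_eq {Φ : Sol → Sol} {e₀ e₁ l a b : ℝ} (hΦ : IsStraight e₀ e₁ l a b Φ)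
    {p r : Sol} (h0 : e₀ * Real.exp l * p 0 + a = r 0) (h1 : e₁ * Real.exp (-l) * p 1 + b = r 1)
    (h2 : p 2 + l = r 2) : Φ p = r := by
  ext i
  fin_cases i
  · exact (hΦ p).1.trans h0
  · exact (hΦ p).2.1.trans h1
  · exact (hΦ p).2.2.trans h2

theorem mem_axisStabilizer {h : Sol ≃ₜ Sol} {e₀ e₁ l a b x₀ y₀ : ℝ}
    (hs : IsStraight e₀ e₁ l a b h) (he₀ : e₀ * e₀ = 1) (he₁ : e₁ * e₁ = 1)
    (hx : e₀ * Real.exp l * x₀ + a = x₀) (hy : e₁ * Real.exp (-l) * y₀ + b = y₀) :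
    h ∈ axisStabilizer x₀ y₀ := by
  refine ⟨e₀, e₁, l, he₀, he₁, fun p => ?_⟩
  obtain ⟨h0, h1, h2⟩ := hs p
  exact ⟨by rw [h0]; linear_combination hx, by rw [h1]; linear_combination hy, h2⟩

end IsStraight

theorem exists_fixed_affine {r : ℝ} (hr : r ≠ 1) (a : ℝ) : ∃ x, r * x + a = x := by
  have : 1 - r ≠ 0 := sub_ne_zero.2 hr.symm
  exact ⟨a / (1 - r), by field_simp; ring⟩

theorem fixed_of_commute_affine {r a d c x : ℝ} (hr : r ≠ 1) (hx : r * x + a = x)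
    (hcomm : d * (r * x + a) + c = r * (d * x + c) + a) : d * x + c = x := by
  refine mul_left_cancel₀ (sub_ne_zero.2 hr) ?_
  linear_combination d * hx - hcomm - hx

theorem IsStraight.exists_axis {h : Sol ≃ₜ Sol} {e₀ e₁ l a b : ℝ}
    (hs : IsStraight e₀ e₁ l a b h) (he₀ : e₀ * e₀ = 1) (he₁ : e₁ * e₁ = 1) (hl : l ≠ 0) :
    ∃ x₀ y₀, h ∈ axisStabilizer x₀ y₀ ∧
      ∀ k ∈ solIsometryGroup, k * h = h * k → k ∈ axisStabilizer x₀ y₀ := by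
  have r₀_ne_one := mul_exp_ne_one he₀ hl
  have r₁_ne_one := mul_exp_ne_one he₁ (neg_ne_zero.2 hl)
  obtain ⟨x₀, hx⟩ := exists_fixed_affine r₀_ne_one a
  obtain ⟨y₀, hy⟩ := exists_fixed_affine r₁_ne_one b
  refine ⟨x₀, y₀, hs.mem_axisStabilizer he₀ he₁ hx hy, fun k hk hkh => ?_⟩
  have comm (p : Sol) (i : Fin 3) : k (h p) i = h (k p) i := congr($hkh p i)
  obtain ⟨d₀, d₁, m, c, d, hd₀, hd₁, ht | ht⟩ := isStraight_or_isSwap hk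
  · have comm_zero := comm !₂[x₀, y₀, 0] 0
    have comm_one := comm !₂[x₀, y₀, 0] 1
    simp only [(ht _).1, (hs _).1] at comm_zero
    simp only [(ht _).2.1, (hs _).2.1] at comm_one
    exact ht.mem_axisStabilizer hd₀ hd₁ (fixed_of_commute_affine r₀_ne_one hx comm_zero)
      (fixed_of_commute_affine r₁_ne_one hy comm_one)
  · have comm_two := comm 0 2
    simp only [(ht _).2.2, (hs _).2.2] at comm_two
    exact absurd (by linarith) hl

theorem IsSwap.apply_two_ne {h : Sol ≃ₜ Sol} {e₀ e₁ l a b : ℝ} (hs : IsSwap e₀ e₁ l a b h) (k : ℝ) :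
    ¬ ∀ p, h p 2 = p 2 + k := fun hk => by
  have h0 := (hs 0).2.2.symm.trans (hk 0)
  have h1 := (hs !₂[0, 0, 1]).2.2.symm.trans (hk _)
  change -0 + l = 0 + k at h0
  change -1 + l = 1 + k at h1
  linarith

theorem exists_isStraight_of_apply_two {h : Sol ≃ₜ Sol} (hh : h ∈ solIsometryGroup) {k : ℝ}
    (hk : ∀ p, h p 2 = p 2 + k) :
    ∃ e₀ e₁ a b : ℝ, e₀ * e₀ = 1 ∧ e₁ * e₁ = 1 ∧ IsStraight e₀ e₁ k a b h := by
  obtain ⟨e₀, e₁, l, a, b, he₀, he₁, hs | hs⟩ := isStraight_or_isSwap hh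
  · obtain rfl : k = l := add_left_cancel ((hk 0).symm.trans (hs 0).2.2)
    exact ⟨e₀, e₁, a, b, he₀, he₁, hs⟩
  · exact absurd hk (hs.apply_two_ne k)

theorem IsSwap.exists_fixed {h : Sol ≃ₜ Sol} {e₀ e₁ l a b : ℝ} (hs : IsSwap e₀ e₁ l a b h)
    (hneg : e₀ * e₁ = -1) : ∃ p, h p = p := by
  let x := (e₀ * Real.exp l * b + a) / 2
  let p : Sol := !₂[x, e₁ * Real.exp (-l) * x + b, l / 2]
  refine ⟨p, ?_⟩
  ext i
  fin_cases i
  · have two_mul_x : 2 * x = e₀ * Real.exp l * b + a := by simp only [x]; ring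
    refine (hs p).1.trans ?_
    change e₀ * Real.exp l * (e₁ * Real.exp (-l) * x + b) + a = x
    linear_combination (x * exp_mul_exp_neg l * (e₀ * e₁)) + x * hneg - two_mul_x
  · exact (hs p).2.1
  · refine (hs p).2.2.trans ?_
    change -(l / 2) + l = l / 2
    ring

/-! ### Orientation preserving isometries -/

theorem fderiv_apply_of_affine {Φ : Sol → Sol} {p : Sol} (hΦ : DifferentiableAt ℝ Φ p)
    {i j : Fin 3} {c d : ℝ} (h : ∀ p, Φ p i = c * p j + d) (v : Sol) :
    fderiv ℝ Φ p v i = c * v j := by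
  have affine : HasFDerivAt (fun p => Φ p i) (c • (EuclideanSpace.proj j : Sol →L[ℝ] ℝ)) p := by
    rw [funext h]
    exact ((EuclideanSpace.proj j : Sol →L[ℝ] ℝ).hasFDerivAt.const_mul c).add_const d
  rw [← fderiv_apply_coord hΦ, affine.fderiv]
  rfl

theorem det_eq_of_apply {A : Sol →L[ℝ] Sol} {M : Matrix (Fin 3) (Fin 3) ℝ}
    (h : ∀ v i, A v i = ∑ j, M i j * v j) : A.det = M.det := by
  rw [ContinuousLinearMap.det, ← LinearMap.det_toMatrix (EuclideanSpace.basisFun (Fin 3) ℝ).toBasis]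
  congr 1
  ext i j
  simp [LinearMap.toMatrix_apply, h]

theorem IsStraight.det_fderiv {h : Sol → Sol} {e₀ e₁ l a b : ℝ}
    (hs : IsStraight e₀ e₁ l a b h) {p : Sol} (hh : DifferentiableAt ℝ h p) :
    (fderiv ℝ h p).det = e₀ * e₁ := by
  have matrix_eq := det_eq_of_apply (A := fderiv ℝ h p)
    (M := !![e₀ * Real.exp l, 0, 0; 0, e₁ * Real.exp (-l), 0; 0, 0, 1]) fun v i => by
      fin_cases i
      · simpa [Fin.sum_univ_three] using fderiv_apply_of_affine hh (fun p => (hs p).1) v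
      · simpa [Fin.sum_univ_three] using fderiv_apply_of_affine hh (fun p => (hs p).2.1) v
      · simpa [Fin.sum_univ_three] using fderiv_apply_of_affine hh (i := 2) (c := 1) (d := l)
          (fun p => by rw [(hs p).2.2, one_mul]) v
  rw [matrix_eq]
  simp [Matrix.det_fin_three, mul_mul_mul_comm e₀, exp_mul_exp_neg]

theorem IsSwap.det_fderiv {h : Sol → Sol} {e₀ e₁ l a b : ℝ}
    (hs : IsSwap e₀ e₁ l a b h) {p : Sol} (hh : DifferentiableAt ℝ h p) :
    (fderiv ℝ h p).det = e₀ * e₁ := by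
  have matrix_eq := det_eq_of_apply (A := fderiv ℝ h p)
    (M := !![0, e₀ * Real.exp l, 0; e₁ * Real.exp (-l), 0, 0; 0, 0, -1]) fun v i => by
      fin_cases i
      · simpa [Fin.sum_univ_three] using fderiv_apply_of_affine hh (fun p => (hs p).1) v
      · simpa [Fin.sum_univ_three] using fderiv_apply_of_affine hh (fun p => (hs p).2.1) v
      · simpa [Fin.sum_univ_three] using fderiv_apply_of_affine hh (i := 2) (c := -1) (d := l)
          (fun p => by rw [(hs p).2.2, neg_one_mul]) v
  rw [matrix_eq]
  simp [Matrix.det_fin_three, mul_mul_mul_comm e₀, exp_mul_exp_neg]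

theorem det_comp_eq_mul (A B : Sol →L[ℝ] Sol) : (A.comp B).det = A.det * B.det :=
  LinearMap.det_comp _ _

/-- The orientation preserving isometries of Sol. -/
def solOrientationSubgroup : Subgroup (Sol ≃ₜ Sol) where
  carrier := {h | h ∈ solIsometryGroup ∧ ∀ p, (fderiv ℝ h p).det = 1}
  one_mem' := ⟨one_mem _, fun p => by
    rw [show fderiv ℝ ((1 : Sol ≃ₜ Sol) : Sol → Sol) p = .id ℝ Sol from fderiv_id]
    exact LinearMap.det_id⟩
  mul_mem' := by
    rintro h k ⟨hh, det_h⟩ ⟨hk, det_k⟩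
    refine ⟨mul_mem hh hk, fun p => ?_⟩
    have chain : fderiv ℝ ((h * k : Sol ≃ₜ Sol) : Sol → Sol) p =
        (fderiv ℝ h (k p)).comp (fderiv ℝ k p) :=
      fderiv_comp p (hh.1.differentiable (by simp) _) (hk.1.differentiable (by simp) _)
    rw [chain, det_comp_eq_mul, det_h, det_k, one_mul]
  inv_mem' := by
    rintro h ⟨hh, det_h⟩
    refine ⟨inv_mem hh, fun p => ?_⟩
    have inverse : (fderiv ℝ h (h.symm p)).comp (fderiv ℝ h.symm p) = .id ℝ Sol := by
      ext1 w
      simpa using fderiv_apply_fderiv_symm hh (h.symm p) w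
    calc (fderiv ℝ h.symm p).det = ((fderiv ℝ h (h.symm p)).comp (fderiv ℝ h.symm p)).det := by
          rw [det_comp_eq_mul, det_h, one_mul]
      _ = 1 := by rw [inverse]; exact LinearMap.det_id

theorem exists_of_notMem_orientation {h : Sol ≃ₜ Sol} (hh : h ∈ solIsometryGroup)
    (hO : h ∉ solOrientationSubgroup) :
    ∃ e₀ e₁ l a b : ℝ, e₀ * e₀ = 1 ∧ e₁ * e₁ = 1 ∧ e₀ * e₁ = -1 ∧
      (IsStraight e₀ e₁ l a b h ∨ IsSwap e₀ e₁ l a b h) := by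
  obtain ⟨e₀, e₁, l, a, b, he₀, he₁, hs⟩ := isStraight_or_isSwap hh
  have differentiable : Differentiable ℝ h := hh.1.differentiable (by simp)
  refine ⟨e₀, e₁, l, a, b, he₀, he₁, ?_, hs⟩
  refine (mul_self_eq_one_iff.1 (by linear_combination he₀ * e₁ * e₁ + he₁)).resolve_left
    fun h1 => hO ⟨hh, fun p => Eq.trans ?_ h1⟩
  exact hs.elim (·.det_fderiv (differentiable p)) (·.det_fderiv (differentiable p))

/-! ### Cocompact groups of isometries -/

theorem exists_abs_sub_apply_two_eq {Γ : Subgroup (Sol ≃ₜ Sol)} (hΓ : Γ ≤ solIsometryGroup)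
    (hshift : ∀ γ ∈ Γ, ∀ k, (∀ p, γ p 2 = p 2 + k) → k = 0) :
    ∃ m : ℝ, ∀ γ ∈ Γ, ∀ p, |γ p 2 - m| = |p 2 - m| := by
  by_cases hflip : ∃ σ ∈ Γ, ∃ m, ∀ p, σ p 2 = -p 2 + m
  · obtain ⟨σ, hσ, m, hm⟩ := hflip
    refine ⟨m / 2, fun γ hγ p => ?_⟩
    obtain ⟨e₀, e₁, l, a, b, -, -, hs | hs⟩ := isStraight_or_isSwap (hΓ hγ)
    · rw [(hs p).2.2, hshift γ hγ l fun p => (hs p).2.2, add_zero]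
    · have l_sub_m := hshift (γ * σ) (mul_mem hγ hσ) (l - m) fun p => by
        rw [Homeomorph.mul_apply, (hs _).2.2, hm]
        ring
      rw [(hs p).2.2, sub_eq_zero.1 l_sub_m, ← abs_neg]
      ring_nf
  · refine ⟨0, fun γ hγ p => ?_⟩
    obtain ⟨e₀, e₁, l, a, b, -, -, hs | hs⟩ := isStraight_or_isSwap (hΓ hγ)
    · rw [(hs p).2.2, hshift γ hγ l fun p => (hs p).2.2, add_zero]
    · exact absurd ⟨γ, hγ, l, fun p => (hs p).2.2⟩ hflip

theorem IsStraight.apply_add_smul {h : Sol → Sol} {e₀ e₁ l a b : ℝ} (hs : IsStraight e₀ e₁ l a b h)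
    {v : Sol} (hv : v 2 = 0) {r : ℝ} (h0 : e₀ * Real.exp l * v 0 = r * v 0)
    (h1 : e₁ * Real.exp (-l) * v 1 = r * v 1) (p : Sol) (t : ℝ) :
    h (p + t • v) = h p + (r * t) • v := by
  refine hs.apply_eq ?_ ?_ ?_
  · change _ * (p 0 + t * v 0) + a = h p 0 + r * t * v 0
    rw [(hs p).1]
    linear_combination t * h0
  · change _ * (p 1 + t * v 1) + b = h p 1 + r * t * v 1
    rw [(hs p).2.1]
    linear_combination t * h1
  · change p 2 + t * v 2 + l = h p 2 + r * t * v 2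
    rw [(hs p).2.2, hv]
    ring

namespace IsSolQuotient

variable {L : Type*} [TopologicalSpace L] [ChartedSpace (EuclideanSpace ℝ (Fin 3)) L]
  {Γ : Subgroup (Sol ≃ₜ Sol)} {q : Sol → L}

-- Otherwise the distance to some height `m` would descend to the compact quotient.
theorem exists_isStraight_ne_zero [CompactSpace L] (hq : IsSolQuotient Γ q) :
    ∃ η ∈ Γ, ∃ e₀ e₁ l a b : ℝ, e₀ * e₀ = 1 ∧ e₁ * e₁ = 1 ∧ l ≠ 0 ∧
      IsStraight e₀ e₁ l a b η := by
  by_contra! hno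
  obtain ⟨m, hm⟩ := exists_abs_sub_apply_two_eq hq.isometry fun γ hγ k hk => by
    obtain ⟨e₀, e₁, a, b, he₀, he₁, hs⟩ := exists_isStraight_of_apply_two (hq.isometry hγ) hk
    by_contra hk0
    exact hno γ hγ e₀ e₁ k a b he₀ he₁ hk0 hs
  obtain ⟨C, hC⟩ := bddAbove_range_of_factorsThrough
    (hq.diffeo.isOpenMap.isQuotientMap hq.continuous hq.surjective)
    (φ := fun p => |p 2 - m|) (by fun_prop) fun p p' hpp' => by
      obtain ⟨γ, hγ, rfl⟩ := (hq.fiber _ _).1 hpp'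
      exact (hm γ hγ p).symm
  have le_C := (le_abs_self _).trans (hC (mem_range_self !₂[0, 0, m + C + 1]))
  change m + C + 1 - m ≤ C at le_C
  linarith

-- Conjugating by powers of `η` produces arbitrarily small translations in `Γ`.
theorem eq_zero_of_contracting (hq : IsSolQuotient Γ q) {v : Sol} {η : Sol ≃ₜ Sol}
    (hη : η ∈ Γ) {r : ℝ} (hr : |r| < 1)
    (h : ∀ (p : Sol) (t : ℝ), η (p + t • v) = η p + (r * t) • v)
    {τ : Sol ≃ₜ Sol} (hτ : τ ∈ Γ) (hv : ∀ p, τ p = p + v) : v = 0 := by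
  have exists_translation (n : ℕ) : ∃ δ ∈ Γ, ∀ p, δ p = p + r ^ n • v := by
    induction n with
    | zero => exact ⟨τ, hτ, by simpa using hv⟩
    | succ n ih =>
      obtain ⟨δ, hδ, hδv⟩ := ih
      refine ⟨η * δ * η⁻¹, mul_mem (mul_mem hη hδ) (inv_mem hη), fun p => ?_⟩
      change η (δ (η.symm p)) = _
      rw [hδv, h, η.apply_symm_apply, pow_succ']
  have r_ne_zero (hv0 : v ≠ 0) : r ≠ 0 := by
    rintro rfl
    refine hv0 (add_eq_left.1 (η.injective (a₁ := 0 + v) ?_))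
    simpa using h 0 1
  obtain ⟨U, hU, h0U, injOn⟩ := hq.exists_injOn 0
  have tendsto_zero : Filter.Tendsto (fun n : ℕ => (0 : Sol) + r ^ n • v) Filter.atTop (𝓝 0) := by
    simpa using (tendsto_pow_atTop_nhds_zero_of_abs_lt_one hr).smul_const v
  obtain ⟨n, hnU⟩ := (tendsto_zero.eventually (hU.mem_nhds h0U)).exists
  obtain ⟨δ, hδ, hδv⟩ := exists_translation n
  rw [← hδv] at hnU
  have translation_zero : (0 : Sol) + r ^ n • v = 0 :=
    (hδv 0).symm.trans (injOn hnU h0U (hq.apply_eq hδ 0))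
  rw [zero_add, smul_eq_zero] at translation_zero
  by_contra hv0
  exact translation_zero.elim (pow_ne_zero n (r_ne_zero hv0)) hv0

theorem eq_zero_of_scaling (hq : IsSolQuotient Γ q) {v : Sol} {η : Sol ≃ₜ Sol}
    (hη : η ∈ Γ) {r : ℝ} (hr : |r| ≠ 1) (hr0 : r ≠ 0)
    (h : ∀ (p : Sol) (t : ℝ), η (p + t • v) = η p + (r * t) • v)
    {τ : Sol ≃ₜ Sol} (hτ : τ ∈ Γ) (hv : ∀ p, τ p = p + v) : v = 0 := by
  rcases lt_or_gt_of_ne hr with abs_lt | lt_abs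
  · exact hq.eq_zero_of_contracting hη abs_lt h hτ hv
  · refine hq.eq_zero_of_contracting (inv_mem hη) (r := r⁻¹)
      (by rw [abs_inv]; exact inv_lt_one_of_one_lt₀ lt_abs) (fun p t => ?_) hτ hv
    apply η.injective
    rw [h, mul_inv_cancel_left₀ hr0]
    change η (η.symm _) = η (η.symm _) + _
    rw [η.apply_symm_apply, η.apply_symm_apply]

theorem eq_zero_of_translation [CompactSpace L] (hq : IsSolQuotient Γ q) {τ : Sol ≃ₜ Sol}
    (hτ : τ ∈ Γ) {v : Sol} (hv : ∀ p, τ p = p + v) (hv2 : v 2 = 0) (hv01 : v 0 = 0 ∨ v 1 = 0) :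
    v = 0 := by
  obtain ⟨η, hη, e₀, e₁, l, a, b, he₀, he₁, hl, hs⟩ := hq.exists_isStraight_ne_zero
  have scale_ne_zero {e k : ℝ} (he : e * e = 1) : e * Real.exp k ≠ 0 :=
    mul_ne_zero (left_ne_zero_of_mul_eq_one he) (Real.exp_ne_zero k)
  rcases hv01 with hv0 | hv1
  · exact hq.eq_zero_of_scaling hη (abs_mul_exp_ne_one he₁ (neg_ne_zero.2 hl)) (scale_ne_zero he₁)
      (hs.apply_add_smul hv2 (by rw [hv0, mul_zero, mul_zero]) rfl) hτ hv
  · exact hq.eq_zero_of_scaling hη (abs_mul_exp_ne_one he₀ hl) (scale_ne_zero he₀)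
      (hs.apply_add_smul hv2 rfl (by rw [hv1, mul_zero, mul_zero])) hτ hv

theorem eq_one_of_isStraight_zero [CompactSpace L] (hq : IsSolQuotient Γ q)
    {γ : Sol ≃ₜ Sol} (hγ : γ ∈ Γ) {e₀ e₁ a b : ℝ} (he₀ : e₀ * e₀ = 1) (he₁ : e₁ * e₁ = 1)
    (hs : IsStraight e₀ e₁ 0 a b γ) : e₀ = 1 ∧ e₁ = 1 := by
  have square (p : Sol) : (γ * γ) p = p + !₂[e₀ * a + a, e₁ * b + b, 0] := by
    refine hs.apply_eq ?_ ?_ ?_ <;> simp [(hs p).1, (hs p).2.1, (hs p).2.2]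
    · linear_combination p 0 * he₀
    · linear_combination p 1 * he₁
  have square_eq (h : e₀ * a + a = 0 ∨ e₁ * b + b = 0) : e₀ * a + a = 0 ∧ e₁ * b + b = 0 := by
    have := hq.eq_zero_of_translation (mul_mem hγ hγ) square rfl h
    exact ⟨congr($this 0), congr($this 1)⟩
  have of_fixed {x y : ℝ} (hx : e₀ * x + a = x) (hy : e₁ * y + b = y) : e₀ = 1 ∧ e₁ = 1 := by
    have := hq.free γ hγ !₂[x, y, 0] (hs.apply_eq (by simpa) (by simpa) (by simp))
    subst this
    have coeff_zero := (hs !₂[1 + x, 0, 0]).1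
    have coeff_one := (hs !₂[0, 1 + y, 0]).2.1
    simp at coeff_zero coeff_one
    exact ⟨by linarith, by linarith⟩
  rcases mul_self_eq_one_iff.1 he₀ with rfl | rfl <;>
    rcases mul_self_eq_one_iff.1 he₁ with rfl | rfl
  · exact ⟨rfl, rfl⟩
  · obtain ⟨ha, -⟩ := square_eq (.inr (by ring))
    exact of_fixed (x := 0) (y := b / 2) (by linarith) (by ring)
  · obtain ⟨-, hb⟩ := square_eq (.inl (by ring))
    exact of_fixed (x := a / 2) (y := 0) (by ring) (by linarith)
  · exact of_fixed (x := a / 2) (y := b / 2) (by ring) (by ring)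

theorem exists_isStraight_of_notMem_orientation [CompactSpace L] (hq : IsSolQuotient Γ q)
    {γ : Sol ≃ₜ Sol} (hγ : γ ∈ Γ) (hO : γ ∉ solOrientationSubgroup) :
    ∃ e₀ e₁ l a b : ℝ, e₀ * e₀ = 1 ∧ e₁ * e₁ = 1 ∧ e₀ * e₁ = -1 ∧ l ≠ 0 ∧
      IsStraight e₀ e₁ l a b γ := by
  obtain ⟨e₀, e₁, l, a, b, he₀, he₁, hneg, hs | hs⟩ :=
    exists_of_notMem_orientation (hq.isometry hγ) hO
  · refine ⟨e₀, e₁, l, a, b, he₀, he₁, hneg, ?_, hs⟩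
    rintro rfl
    obtain ⟨rfl, rfl⟩ := hq.eq_one_of_isStraight_zero hγ he₀ he₁ hs
    norm_num at hneg
  · obtain ⟨p, hp⟩ := hs.exists_fixed hneg
    obtain rfl := hq.free γ hγ p hp
    exact absurd (fun p : Sol => (add_zero (p 2)).symm) (hs.apply_two_ne 0)

end IsSolQuotient

/-! ### Surfaces covered by the plane -/

/-- Equivalence modulo the group generated by the glide `(s, t) ↦ (s + 1, ε t)` and the shift
`(s, t) ↦ (s, t + 1)`; the quotient of the plane is the torus for `ε = 1` and the Klein bottle for
`ε = -1`. -/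
def PlaneRel (ε : ℝ) (x y : EuclideanSpace ℝ (Fin 2)) : Prop :=
  ∃ m n : ℤ, y 0 = x 0 + m ∧ y 1 = ε ^ m * x 1 + n

/-- The deck transformation `(s, t) ↦ (s + 1, ε t)` of the plane. -/
def planeGlide (ε : ℝ) (hε : ε * ε = 1) : EuclideanSpace ℝ (Fin 2) ≃ₜ EuclideanSpace ℝ (Fin 2) where
  toFun s := !₂[s 0 + 1, ε * s 1]
  invFun s := !₂[s 0 - 1, ε * s 1]
  left_inv s := by ext i; fin_cases i <;> simp [← mul_assoc, hε]
  right_inv s := by ext i; fin_cases i <;> simp [← mul_assoc, hε]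
  continuous_toFun := by fun_prop
  continuous_invFun := by fun_prop

/-- The deck transformation `(s, t) ↦ (s, t + 1)` of the plane. -/
def planeShift : EuclideanSpace ℝ (Fin 2) ≃ₜ EuclideanSpace ℝ (Fin 2) :=
  Homeomorph.addRight !₂[0, 1]

theorem planeGlide_zpow {ε : ℝ} (hε : ε * ε = 1) (m : ℤ) (s : EuclideanSpace ℝ (Fin 2)) :
    (planeGlide ε hε ^ m) s = !₂[s 0 + m, ε ^ m * s 1] := by
  have ε_ne_zero : ε ≠ 0 := left_ne_zero_of_mul_eq_one hε
  induction m generalizing s with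
  | zero => ext i; fin_cases i <;> simp
  | succ m ih =>
    rw [zpow_add_one, Homeomorph.mul_apply, ih, zpow_add_one₀ ε_ne_zero]
    ext i
    fin_cases i <;> simp [planeGlide] <;> ring
  | pred m ih =>
    rw [zpow_sub_one, Homeomorph.mul_apply, ih, zpow_sub_one₀ ε_ne_zero,
      inv_eq_of_mul_eq_one_left hε]
    ext i
    fin_cases i
    · change s 0 - 1 + _ = s 0 + _
      push_cast
      ring
    · exact (mul_assoc _ _ _).symm

theorem planeShift_zpow (n : ℤ) (s : EuclideanSpace ℝ (Fin 2)) :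
    (planeShift ^ n) s = !₂[s 0, s 1 + n] := by
  induction n generalizing s with
  | zero => ext i; fin_cases i <;> simp
  | succ m ih =>
    rw [zpow_add_one, Homeomorph.mul_apply, ih]
    ext i
    fin_cases i <;> simp [planeShift]
    ring
  | pred m ih =>
    rw [zpow_sub_one, Homeomorph.mul_apply, ih]
    ext i
    fin_cases i
    · change s 0 + -0 = s 0
      ring
    · change s 1 + -1 + _ = s 1 + _
      push_cast
      ring

theorem planeRel_iff_exists_zpow {ε : ℝ} (hε : ε * ε = 1) {x y : EuclideanSpace ℝ (Fin 2)} :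
    PlaneRel ε x y ↔ ∃ m n : ℤ, y = (planeShift ^ n * planeGlide ε hε ^ m) x := by
  simp only [Homeomorph.mul_apply, planeShift_zpow, planeGlide_zpow]
  refine exists₂_congr fun m n => ⟨fun ⟨h0, h1⟩ => ?_, ?_⟩
  · ext i
    fin_cases i
    · exact h0
    · exact h1
  · rintro rfl
    exact ⟨rfl, rfl⟩

theorem isCompact_unitSquare :
    IsCompact {s : EuclideanSpace ℝ (Fin 2) | s 0 ∈ Icc (0 : ℝ) 1 ∧ s 1 ∈ Icc (0 : ℝ) 1} := by
  have continuous : Continuous fun x : ℝ × ℝ => (!₂[x.1, x.2] : EuclideanSpace ℝ (Fin 2)) := by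
    fun_prop
  convert ((isCompact_Icc (a := (0 : ℝ)) (b := 1)).prod
    (isCompact_Icc (a := (0 : ℝ)) (b := 1))).image continuous using 1
  ext s
  constructor
  · rintro ⟨h0, h1⟩
    exact ⟨(s 0, s 1), ⟨h0, h1⟩, by ext i; fin_cases i <;> rfl⟩
  · rintro ⟨x, hx, rfl⟩
    exact hx

theorem PlaneRel.exists_mem_unitSquare (ε : ℝ) (x : EuclideanSpace ℝ (Fin 2)) :
    ∃ y, (y 0 ∈ Icc (0 : ℝ) 1 ∧ y 1 ∈ Icc (0 : ℝ) 1) ∧ PlaneRel ε x y := by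
  have add_mem (t : ℝ) : t + ((-⌊t⌋ : ℤ) : ℝ) ∈ Icc (0 : ℝ) 1 := by
    rw [Int.cast_neg, ← sub_eq_add_neg]
    exact ⟨Int.fract_nonneg t, (Int.fract_lt_one t).le⟩
  exact ⟨!₂[x 0 + (-⌊x 0⌋ : ℤ), ε ^ (-⌊x 0⌋) * x 1 + (-⌊ε ^ (-⌊x 0⌋) * x 1⌋ : ℤ)],
    ⟨add_mem _, add_mem _⟩, _, _, rfl, rfl⟩

theorem compactSpace_of_planeRel {S : Type*} [TopologicalSpace S]
    {g : EuclideanSpace ℝ (Fin 2) → S} {ε : ℝ} (hg : Continuous g) (hgs : Function.Surjective g)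
    (hrel : ∀ x y, PlaneRel ε x y → g x = g y) : CompactSpace S := by
  refine ⟨isCompact_unitSquare.image hg |>.of_isClosed_subset isClosed_univ fun s _ => ?_⟩
  obtain ⟨x, rfl⟩ := hgs s
  obtain ⟨y, hy, hxy⟩ := PlaneRel.exists_mem_unitSquare ε x
  exact ⟨y, hy, (hrel x y hxy).symm⟩

/-- The pairs of homeomorphisms of `N` and Sol which are intertwined by `F`. -/
def intertwiners {N : Type*} [TopologicalSpace N] (F : N → Sol) :
    Subgroup ((N ≃ₜ N) × (Sol ≃ₜ Sol)) where
  carrier := {D | ∀ s, F (D.1 s) = D.2 (F s)}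
  one_mem' _ := rfl
  mul_mem' {C D} hC hD s := (hC (D.1 s)).trans (congrArg C.2 (hD s))
  inv_mem' {D} hD s := by
    apply D.2.injective
    rw [← hD]
    exact (congrArg F (D.1.apply_symm_apply s)).trans (D.2.apply_symm_apply (F s)).symm

/-- The elements of `Γ` which preserve the range of `F`. -/
def rangeStabilizer {N : Type*} (Γ : Subgroup (Sol ≃ₜ Sol)) (F : N → Sol) :
    Subgroup (Sol ≃ₜ Sol) where
  carrier := {h | h ∈ Γ ∧ ∀ p, h p ∈ range F ↔ p ∈ range F}
  one_mem' := ⟨one_mem _, fun _ => Iff.rfl⟩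
  mul_mem' {h k} hh hk := ⟨mul_mem hh.1 hk.1, fun p => (hh.2 (k p)).trans (hk.2 p)⟩
  inv_mem' {h} hh := ⟨inv_mem hh.1, fun p => by
    rw [← hh.2, show h (h⁻¹ p) = p from h.apply_symm_apply p]⟩

namespace IsSolQuotient

variable {L : Type*} [TopologicalSpace L] [ChartedSpace (EuclideanSpace ℝ (Fin 3)) L]
  {Γ : Subgroup (Sol ≃ₜ Sol)} {q : Sol → L}
  {S N : Type*} [TopologicalSpace N]

theorem exists_deck_of_comp_eq (hq : IsSolQuotient Γ q) [ConnectedSpace N] {g : N → S} {f : S → L}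
    {F : N → Sol} (hF : Continuous F) (hlift : ∀ s, q (F s) = f (g s)) {D : N ≃ₜ N}
    (hD : ∀ s, g (D s) = g s) : ∃ γ ∈ Γ, ∀ s, F (D s) = γ (F s) :=
  hq.exists_deck hF (hF.comp D.continuous) fun s =>
    (hlift s).trans ((congrArg f (hD s)).symm.trans (hlift (D s)).symm)

variable [TopologicalSpace S] [ChartedSpace (EuclideanSpace ℝ (Fin 2)) S]

theorem isSurfaceLift_rangeStabilizer (hq : IsSolQuotient Γ q)
    [ChartedSpace (EuclideanSpace ℝ (Fin 2)) N] [ConnectedSpace N] {g : N → S} {f : S → L}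
    {F : N → Sol} (hg : IsLocalDiffeomorph (𝓡 2) (𝓡 2) ∞ g) (hgs : Function.Surjective g)
    (hf : IsSmoothEmbedding (𝓡 2) (𝓡 3) ∞ f) (hF : Continuous F) (hlift : ∀ s, q (F s) = f (g s))
    (hdeck : ∀ s s', g s = g s' → ∃ D : N ≃ₜ N, (∀ x, g (D x) = g x) ∧ D s = s') :
    IsSurfaceLift Γ q (rangeStabilizer Γ F) g f F where
  le _ hh := hh.1
  diffeo := hg
  surjective := hgs
  embedding := hf
  continuous := hF
  lift := hlift
  fiber s s' h := by
    obtain ⟨D, hD, rfl⟩ := hdeck s s' h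
    obtain ⟨γ, hγ, intertwines⟩ := hq.exists_deck_of_comp_eq hF hlift hD
    refine ⟨γ, ⟨hγ, fun p => ⟨?_, ?_⟩⟩, intertwines s⟩
    · rintro ⟨x, hx⟩
      refine ⟨D.symm x, γ.injective ?_⟩
      rw [← intertwines, D.apply_symm_apply, hx]
    · rintro ⟨x, rfl⟩
      exact ⟨D x, intertwines x⟩
  invariant h hh s := by
    obtain ⟨s', hs'⟩ := (hh.2 (F s)).2 (mem_range_self s)
    refine ⟨s', hf.isEmbedding.injective ?_, hs'⟩
    rw [← hlift, ← hlift, hs', hq.apply_eq hh.1]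

theorem exists_planeLift (hq : IsSolQuotient Γ q) {ε : ℝ} (hε : ε * ε = 1)
    {g : EuclideanSpace ℝ (Fin 2) → S} (hg : IsQuotientManifold (n := 2) (PlaneRel ε) g) {f : S → L}
    (hf : IsSmoothEmbedding (𝓡 2) (𝓡 3) ∞ f) :
    ∃ H F, IsSurfaceLift Γ q H g f F ∧ ∃ α ∈ Γ, ∃ β ∈ Γ, (∀ s, F (planeGlide ε hε s) = α (F s)) ∧
      (∀ s, F (planeShift s) = β (F s)) ∧ ∀ K : Subgroup (Sol ≃ₜ Sol), α ∈ K → β ∈ K → H ≤ K := by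
  obtain ⟨hg, surjective, fiber⟩ := hg
  simp only [planeRel_iff_exists_zpow hε] at fiber
  obtain ⟨F, hF, lift⟩ := hq.exists_lift (hf.contMDiff.continuous.comp hg.contMDiff.continuous)
  have deck_invariant (m n : ℤ) (s) : g ((planeShift ^ n * planeGlide ε hε ^ m) s) = g s :=
    ((fiber _ _).2 ⟨m, n, rfl⟩).symm
  have hS := hq.isSurfaceLift_rangeStabilizer hg surjective hf hF lift fun s s' h => by
    obtain ⟨m, n, rfl⟩ := (fiber _ _).1 h
    exact ⟨_, deck_invariant m n, rfl⟩
  obtain ⟨α, hα, glide⟩ :=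
    hq.exists_deck_of_comp_eq hF lift (D := planeGlide ε hε) (f := f)
      fun s => by simpa using deck_invariant 1 0 s
  obtain ⟨β, hβ, shift⟩ :=
    hq.exists_deck_of_comp_eq hF lift (D := planeShift) (f := f)
      fun s => by simpa using deck_invariant 0 1 s
  refine ⟨_, F, hS, α, hα, β, hβ, glide, shift, fun K hαK hβK h hh => ?_⟩
  obtain ⟨s', base_eq, hs'⟩ := hS.invariant h hh 0
  obtain ⟨m, n, rfl⟩ := (fiber _ _).1 base_eq.symm
  have intertwines := mul_mem (zpow_mem (show (planeShift, β) ∈ intertwiners F from shift) n)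
    (zpow_mem (show (planeGlide ε hε, α) ∈ intertwiners F from glide) m) 0
  rw [show h = β ^ n * α ^ m from hq.eq_of_apply_eq (hS.le hh)
    (mul_mem (zpow_mem hβ n) (zpow_mem hα m)) (hs'.symm.trans intertwines)]
  exact mul_mem (zpow_mem hβK n) (zpow_mem hαK m)

end IsSolQuotient

/-! ### Tori -/

/-- The linear form `w ↦ det (u, v, w)`. -/
def crossForm (u v : Sol) : Sol →L[ℝ] ℝ :=
  (u 1 * v 2 - u 2 * v 1) • (EuclideanSpace.proj 0 : Sol →L[ℝ] ℝ) +
  (u 2 * v 0 - u 0 * v 2) • (EuclideanSpace.proj 1 : Sol →L[ℝ] ℝ) +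
  (u 0 * v 1 - u 1 * v 0) • (EuclideanSpace.proj 2 : Sol →L[ℝ] ℝ)

theorem crossForm_apply (u v w : Sol) : crossForm u v w =
    (u 1 * v 2 - u 2 * v 1) * w 0 + (u 2 * v 0 - u 0 * v 2) * w 1 +
      (u 0 * v 1 - u 1 * v 0) * w 2 := rfl

theorem crossForm_eq_det (u v w : Sol) : crossForm u v w =
    (EuclideanSpace.basisFun (Fin 3) ℝ).toBasis.det ![u, v, w] := by
  rw [crossForm_apply, Module.Basis.det_apply, Matrix.det_fin_three]
  simp [Module.Basis.toMatrix_apply]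
  ring

theorem crossForm_map (A : Sol →L[ℝ] Sol) (u v w : Sol) :
    crossForm (A u) (A v) (A w) = A.det * crossForm u v w := by
  rw [crossForm_eq_det, crossForm_eq_det, ContinuousLinearMap.det, ← Module.Basis.det_comp]
  congr 1
  ext i
  fin_cases i <;> rfl

theorem crossForm_smul_add_smul (u v : Sol) (a b : ℝ) : crossForm u v (a • u + b • v) = 0 := by
  simp only [crossForm_apply, PiLp.add_apply, PiLp.smul_apply, smul_eq_mul]
  ring

theorem crossForm_ne_zero {u v : Sol} (h : LinearIndependent ℝ ![u, v]) : crossForm u v ≠ 0 := by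
  intro h0
  have minor₀ : u 1 * v 2 - u 2 * v 1 = 0 := by
    simpa [crossForm_apply] using congr($h0 !₂[1, 0, 0])
  have minor₁ : u 2 * v 0 - u 0 * v 2 = 0 := by
    simpa [crossForm_apply] using congr($h0 !₂[0, 1, 0])
  have minor₂ : u 0 * v 1 - u 1 * v 0 = 0 := by
    simpa [crossForm_apply] using congr($h0 !₂[0, 0, 1])
  have coord_eq_zero (i : Fin 3) : u i = 0 := by
    refine (LinearIndependent.pair_iff.1 h (-v i) (u i) ?_).2
    ext j
    change -v i * u j + u i * v j = 0
    fin_cases i <;> fin_cases j <;> simp <;> linarith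
  exact h.ne_zero 0 (by ext i; exact coord_eq_zero i)

section Torus

variable {L : Type*} [TopologicalSpace L] [ChartedSpace (EuclideanSpace ℝ (Fin 3)) L]
  {Γ : Subgroup (Sol ≃ₜ Sol)} {q : Sol → L}
  {S : Type*} [TopologicalSpace S] [ChartedSpace (EuclideanSpace ℝ (Fin 2)) S]
  {g : EuclideanSpace ℝ (Fin 2) → S} {f : S → L} {H : Subgroup (Sol ≃ₜ Sol)}
  {F : EuclideanSpace ℝ (Fin 2) → Sol}

/-- The conormal `det (∂₀ F, ∂₁ F, ·)` of a parametrized surface `F`. -/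
def planeConormal (F : EuclideanSpace ℝ (Fin 2) → Sol) (s : EuclideanSpace ℝ (Fin 2)) :
    Sol →L[ℝ] ℝ :=
  crossForm (fderiv ℝ F s (EuclideanSpace.single 0 1)) (fderiv ℝ F s (EuclideanSpace.single 1 1))

theorem continuous_planeConormal (hF : ContDiff ℝ 1 F) : Continuous (planeConormal F) := by
  have := hF.continuous_fderiv one_ne_zero
  unfold planeConormal crossForm
  fun_prop

theorem planeConormal_ne_zero {s : EuclideanSpace ℝ (Fin 2)}
    (hF : Function.Injective (fderiv ℝ F s)) : planeConormal F s ≠ 0 := by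
  refine crossForm_ne_zero (LinearIndependent.pair_iff.2 fun a b h => ?_)
  rw [← map_smul, ← map_smul, ← map_add] at h
  have eq_zero := hF (h.trans (map_zero _).symm)
  exact ⟨by simpa using congr($eq_zero 0), by simpa using congr($eq_zero 1)⟩

theorem planeConormal_fderiv (s a : EuclideanSpace ℝ (Fin 2)) :
    planeConormal F s (fderiv ℝ F s a) = 0 := by
  have a_eq : a = a 0 • EuclideanSpace.single 0 1 + a 1 • EuclideanSpace.single 1 1 := by
    ext i
    fin_cases i <;> simp
  rw [a_eq, map_add, map_smul, map_smul]
  exact crossForm_smul_add_smul _ _ _ _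

theorem planeConormal_map {k : Sol → Sol} (hk : Differentiable ℝ k) (hF : Differentiable ℝ F)
    {c : EuclideanSpace ℝ (Fin 2)} (h : ∀ x, F (x + c) = k (F x)) (s : EuclideanSpace ℝ (Fin 2))
    (w : Sol) :
    planeConormal F (s + c) (fderiv ℝ k (F s) w) =
      (fderiv ℝ k (F s)).det * planeConormal F s w := by
  have fderiv_eq : fderiv ℝ F (s + c) = (fderiv ℝ k (F s)).comp (fderiv ℝ F s) := by
    rw [← fderiv_comp s (hk _) (hF _), ← fderiv_comp_add_right, funext h]
    rfl
  rw [planeConormal, fderiv_eq]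
  exact crossForm_map _ _ _ _

namespace IsSurfaceLift

theorem apply_add_sub (hF : IsSurfaceLift Γ q H g f F) (hq : IsSolQuotient Γ q)
    {s s' : EuclideanSpace ℝ (Fin 2)} (htrans : ∀ x, g (x + (s' - s)) = g x) {k : Sol ≃ₜ Sol}
    (hk : k ∈ Γ) (h : F s' = k (F s)) (x : EuclideanSpace ℝ (Fin 2)) :
    F (x + (s' - s)) = k (F x) := by
  obtain ⟨δ, hδ, intertwines⟩ := hq.exists_deck_of_comp_eq hF.continuous hF.lift
    (D := Homeomorph.addRight (s' - s)) htrans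
  obtain rfl : δ = k := hq.eq_of_apply_eq hδ hk (p := F s) (by
    rw [← intertwines, ← h]
    exact congrArg F (add_sub_cancel s s'))
  exact intertwines x

theorem isTwoSided_of_le_orientation [IsManifold (𝓡 3) ∞ L] [IsManifold (𝓡 2) ∞ S]
    (hF : IsSurfaceLift Γ q H g f F) (hq : IsSolQuotient Γ q) (hH : H ≤ solOrientationSubgroup)
    (htrans : ∀ s s', g s = g s' → ∀ x, g (x + (s' - s)) = g x) : IsTwoSided f := by
  have smooth : ContDiff ℝ ∞ F := (hF.contMDiff hq).contDiff
  have injective (s) : Function.Injective (fderiv ℝ F s) := by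
    rw [← mfderiv_eq_fderiv]
    exact hF.mfderiv_injective hq s
  refine hF.isTwoSided_of_conormal hq (continuous_planeConormal (smooth.of_le (by simp)))
    (fun s => planeConormal_ne_zero (injective s)) (fun s a => ?_) fun s s' h => ?_
  · rw [mfderiv_eq_fderiv]
    exact planeConormal_fderiv s a
  · obtain ⟨k, hk, hks⟩ := hF.fiber s s' h
    have hkΓ := hF.le hk
    refine ⟨k, hkΓ, hks, 1, one_pos, fun w => ?_⟩
    have map := planeConormal_map ((hq.isometry hkΓ).1.differentiable (by simp))
      (smooth.differentiable (by simp))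
      (hF.apply_add_sub hq (htrans s s' h) hkΓ hks) s w
    rwa [add_sub_cancel, (hH hk).2] at map

end IsSurfaceLift

theorem IsTwoTorus.exists_isQuotientManifold (hS : IsTwoTorus S) :
    ∃ g, IsQuotientManifold (n := 2) (N := S) (PlaneRel 1) g := by
  obtain ⟨g, hg, surjective, fiber⟩ := hS
  exact ⟨g, hg, surjective, by simpa only [PlaneRel, one_zpow, one_mul] using fiber⟩

namespace IsSolQuotient

theorem isTwoSided_of_torus [IsManifold (𝓡 3) ∞ L] [T2Space L] [CompactSpace L]
    [IsManifold (𝓡 2) ∞ S] (hq : IsSolQuotient Γ q) (hS : IsTwoTorus S)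
    (hf : IsSmoothEmbedding (𝓡 2) (𝓡 3) ∞ f) : IsTwoSided f := by
  obtain ⟨g, hg⟩ := hS.exists_isQuotientManifold
  obtain ⟨H, F, hF, α, hα, β, hβ, glide, shift, le_of_mem⟩ := hq.exists_planeLift (mul_one 1) hg hf
  have : CompactSpace S := compactSpace_of_planeRel hg.1.contMDiff.continuous hg.2.1
    fun x y => (hg.2.2 x y).2
  have commute : β * α = α * β := by
    refine hq.eq_of_apply_eq (mul_mem hβ hα) (mul_mem hα hβ) (p := F 0) ?_
    rw [Homeomorph.mul_apply, Homeomorph.mul_apply, ← glide, ← shift, ← shift, ← glide]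
    congr 1
    ext i
    fin_cases i <;> simp [planeGlide, planeShift]
  have isTwoSided_of_reversing {k : Sol ≃ₜ Sol} (hk : k ∈ Γ) (hO : k ∉ solOrientationSubgroup)
      (hα' : α * k = k * α) (hβ' : β * k = k * β) : IsTwoSided f := by
    obtain ⟨e₀, e₁, l, a, b, he₀, he₁, -, hl, hs⟩ :=
      hq.exists_isStraight_of_notMem_orientation hk hO
    obtain ⟨x₀, y₀, -, centralizer⟩ := hs.exists_axis he₀ he₁ hl
    exact hF.isTwoSided_of_le_axisStabilizer hq
      (le_of_mem _ (centralizer α (hq.isometry hα) hα')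
        (centralizer β (hq.isometry hβ) hβ'))
  by_cases hαO : α ∈ solOrientationSubgroup
  · by_cases hβO : β ∈ solOrientationSubgroup
    · refine hF.isTwoSided_of_le_orientation hq (le_of_mem _ hαO hβO) fun s s' h x => ?_
      obtain ⟨m, n, h0, h1⟩ := (hg.2.2 s s').1 h
      rw [eq_comm, hg.2.2]
      exact ⟨m, n, by simp [h0], by simp [h1]⟩
    · exact isTwoSided_of_reversing hβ hβO commute.symm rfl
  · exact isTwoSided_of_reversing hα hαO rfl commute

end IsSolQuotient

end Torus

/-! ### Orientable neighborhoods -/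

theorem subtypeRestr_mem_maximalAtlas {n : ℕ} {M : Type*} [TopologicalSpace M]
    [ChartedSpace (EuclideanSpace ℝ (Fin n)) M]
    {e : OpenPartialHomeomorph M (EuclideanSpace ℝ (Fin n))}
    (he : e ∈ IsManifold.maximalAtlas (𝓡 n) ∞ M) {U : TopologicalSpace.Opens M} (hU : Nonempty U) :
    e.subtypeRestr hU ∈ IsManifold.maximalAtlas (𝓡 n) ∞ U := by
  intro e' he'
  obtain ⟨x, rfl⟩ := TopologicalSpace.Opens.chart_eq hU he'
  have compatible := he (chartAt _ (x : M)) (chart_mem_atlas _ _)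
  exact ⟨StructureGroupoid.mem_of_eqOnSource _
      (closedUnderRestriction' compatible.1 (e.isOpen_inter_preimage_symm U.2))
      (e.subtypeRestr_symm_trans_subtypeRestr hU _),
    StructureGroupoid.mem_of_eqOnSource _
      (closedUnderRestriction' compatible.2 ((chartAt _ (x : M)).isOpen_inter_preimage_symm U.2))
      ((chartAt _ (x : M)).subtypeRestr_symm_trans_subtypeRestr hU _)⟩

namespace IsSolQuotient

variable {L : Type*} [TopologicalSpace L] [ChartedSpace (EuclideanSpace ℝ (Fin 3)) L]
  {Γ : Subgroup (Sol ≃ₜ Sol)} {q : Sol → L}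

theorem exists_section_chart [IsManifold (𝓡 3) ∞ L] (hq : IsSolQuotient Γ q) {W : Set Sol}
    (hW : IsOpen W) {w : Sol} (hw : w ∈ W) :
    ∃ e ∈ IsManifold.maximalAtlas (𝓡 3) ∞ L, q w ∈ e.source ∧
      ∀ y ∈ e.source, e y ∈ W ∧ q (e y) = y := by
  obtain ⟨Φ, hwΦ, hΦ⟩ := hq.diffeo w
  let e : OpenPartialHomeomorph L (EuclideanSpace ℝ (Fin 3)) := Φ.symm.toOpenPartialHomeomorph
  have he : e ∈ IsManifold.maximalAtlas (𝓡 3) ∞ L :=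
    e.mem_maximalAtlas_of_contMDiffOn Φ.contMDiffOn_invFun Φ.contMDiffOn_toFun
  have isOpen := e.isOpen_inter_preimage hW
  have e_apply : e (q w) = w := by
    rw [hΦ hwΦ]
    exact Φ.left_inv hwΦ
  have mem_source : q w ∈ e.source := by
    rw [hΦ hwΦ]
    exact Φ.map_source hwΦ
  refine ⟨e.restr (e.source ∩ e ⁻¹' W), restr_mem_maximalAtlas _ he isOpen, ?_, fun y hy => ?_⟩
  · rw [e.restr_source' _ isOpen]
    exact ⟨mem_source, mem_source, by rwa [mem_preimage, e_apply]⟩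
  · rw [e.restr_source' _ isOpen] at hy
    exact ⟨hy.2.2, (hΦ (e.map_source hy.1)).trans (e.left_inv hy.1)⟩

theorem exists_eventuallyEq_transition (hq : IsSolQuotient Γ q) {X : Type*} [TopologicalSpace X]
    {i : X → L} {e e' : OpenPartialHomeomorph X Sol} (he : ∀ x ∈ e.source, q (e x) = i x)
    (he' : ∀ x ∈ e'.source, q (e' x) = i x) {x : X} (hx : x ∈ e.source) (hx' : x ∈ e'.source) :
    ∃ γ ∈ Γ, γ (e x) = e' x ∧ e' ∘ e.symm =ᶠ[𝓝 (e x)] γ := by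
  obtain ⟨γ, hγ, hγx⟩ := (hq.fiber _ _).1 ((he x hx).trans (he' x hx').symm)
  refine ⟨γ, hγ, hγx, ?_⟩
  obtain ⟨V, hV, hxV, injOn⟩ := hq.exists_injOn (e' x)
  have continuousAt_symm : ContinuousAt e.symm (e x) := e.continuousAt_symm (e.map_source hx)
  have continuousAt : ContinuousAt (e' ∘ e.symm) (e x) := by
    refine ContinuousAt.comp ?_ continuousAt_symm
    rw [e.left_inv hx]
    exact e'.continuousAt hx'
  filter_upwards [e.open_target.mem_nhds (e.map_source hx),
    continuousAt_symm.eventually (e'.open_source.mem_nhds (by rwa [e.left_inv hx])),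
    continuousAt.eventually (hV.mem_nhds (by rwa [Function.comp_apply, e.left_inv hx])),
    γ.continuous.continuousAt.eventually (hV.mem_nhds (by rwa [hγx]))]
    with y y_target symm_source comp_mem γ_mem
  refine injOn comp_mem γ_mem ?_
  rw [hq.apply_eq hγ, Function.comp_apply, he' _ symm_source, ← he _ (e.map_target y_target),
    e.right_inv y_target]

theorem isOrientableManifold [IsManifold (𝓡 3) ∞ L] (hq : IsSolQuotient Γ q)
    {W : Set Sol} (hW : IsOpen W)
    (h : ∀ p ∈ W, ∀ γ ∈ Γ, γ p ∈ W → γ ∈ solOrientationSubgroup) {U : TopologicalSpace.Opens L}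
    (hU : (U : Set L) = q '' W) : IsOrientableManifold 3 U := by
  refine ⟨{e | e ∈ IsManifold.maximalAtlas (𝓡 3) ∞ U ∧ ∀ x ∈ e.source, e x ∈ W ∧ q (e x) = x},
    fun e he => he.1, fun x => ?_, ?_⟩
  · obtain ⟨w, hw, hwx⟩ : (x : L) ∈ q '' W := hU ▸ x.2
    obtain ⟨e, he, mem_source, section_e⟩ := hq.exists_section_chart hW hw
    exact ⟨e.subtypeRestr ⟨x⟩, ⟨subtypeRestr_mem_maximalAtlas he ⟨x⟩, fun y hy =>
      section_e y (by rwa [e.subtypeRestr_source] at hy)⟩,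
      by rwa [e.subtypeRestr_source, mem_preimage, ← hwx]⟩
  · rintro e ⟨-, he⟩ e' ⟨-, he'⟩ x ⟨hx, hx'⟩
    obtain ⟨γ, hγ, hγx, transition⟩ := hq.exists_eventuallyEq_transition
      (fun y hy => (he y hy).2) (fun y hy => (he' y hy).2) hx hx'
    rw [transition.fderiv_eq, (h _ (he x hx).1 γ hγ (hγx ▸ (he' x hx').1)).2]
    exact one_pos

theorem eventually_deck_mem [T2Space L] (hq : IsSolQuotient Γ q) {G : Set (Sol ≃ₜ Sol)} {x y : Sol}
    (h : ∀ γ ∈ Γ, γ x = y → γ ∈ G) :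
    ∀ᶠ z : Sol × Sol in 𝓝 (x, y), ∀ γ ∈ Γ, γ z.1 = z.2 → γ ∈ G := by
  by_cases hxy : q x = q y
  · obtain ⟨δ, hδ, rfl⟩ := (hq.fiber _ _).1 hxy
    obtain ⟨V, hV, hyV, injOn⟩ := hq.exists_injOn (δ x)
    filter_upwards [(δ.continuous.comp continuous_fst).continuousAt.eventually (hV.mem_nhds hyV),
      continuous_snd.continuousAt.eventually (hV.mem_nhds hyV)] with z δz_mem z_mem γ hγ hγz
    have apply_eq : γ z.1 = δ z.1 :=
      injOn (hγz ▸ z_mem) δz_mem (by rw [hq.apply_eq hγ, hq.apply_eq hδ])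
    rw [hq.eq_of_apply_eq hγ hδ apply_eq]
    exact h δ hδ rfl
  · have isOpen_ne : IsOpen {z : Sol × Sol | q z.1 ≠ q z.2} :=
      isOpen_ne_fun (hq.continuous.comp continuous_fst) (hq.continuous.comp continuous_snd)
    filter_upwards [isOpen_ne.mem_nhds hxy] with z hz γ hγ hγz
    exact absurd (by rw [← hγz, hq.apply_eq hγ]) hz

theorem exists_isOrientableManifold [IsManifold (𝓡 3) ∞ L] [T2Space L] (hq : IsSolQuotient Γ q)
    {K : Set Sol} (hK : IsCompact K)
    (h : ∀ p ∈ K, ∀ γ ∈ Γ, γ p ∈ K → γ ∈ solOrientationSubgroup) :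
    ∃ U : TopologicalSpace.Opens L, q '' K ⊆ U ∧ IsOrientableManifold 3 U := by
  let G : Set (Sol × Sol) := {z | ∀ γ ∈ Γ, γ z.1 = z.2 → γ ∈ solOrientationSubgroup}
  have subset_interior : K ×ˢ K ⊆ interior G := by
    rintro ⟨x, y⟩ ⟨hx, hy⟩
    exact mem_interior_iff_mem_nhds.2 (hq.eventually_deck_mem
      (G := solOrientationSubgroup) fun γ hγ hγx => h x hx γ hγ (hγx ▸ hy))
  obtain ⟨u, v, hu, hv, hKu, hKv, huv⟩ :=
    generalized_tube_lemma hK hK isOpen_interior subset_interior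
  refine ⟨⟨q '' (u ∩ v), hq.diffeo.isOpenMap _ (hu.inter hv)⟩, image_mono (subset_inter hKu hKv),
    hq.isOrientableManifold (hu.inter hv) (fun p hp γ hγ hp' => ?_) rfl⟩
  exact interior_subset (huv (mk_mem_prod hp.1 hp'.2)) γ hγ rfl

end IsSolQuotient

/-! ### Klein bottles -/

namespace IsSolQuotient

variable {L : Type*} [TopologicalSpace L] [ChartedSpace (EuclideanSpace ℝ (Fin 3)) L]
  {Γ : Subgroup (Sol ≃ₜ Sol)} {q : Sol → L}

theorem mem_orientation_of_mul_mul [CompactSpace L] (hq : IsSolQuotient Γ q)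
    {α β : Sol ≃ₜ Sol} (hα : α ∈ Γ) (hβ : β ∈ Γ) (h : β * α * β = α) :
    β ∈ solOrientationSubgroup := by
  by_contra hO
  obtain ⟨e₀, e₁, l, a, b, -, -, hneg, hl, hs⟩ :=
    hq.exists_isStraight_of_notMem_orientation hβ hO
  have relation (p : Sol) : β (α (β p)) = α p := congr($h p)
  obtain ⟨d₀, d₁, m, c, d, hd₀, -, ht | ht⟩ := isStraight_or_isSwap (hq.isometry hα)
  · have height := congr($(relation 0) 2)
    simp only [(hs _).2.2, (ht _).2.2] at height
    exact hl (by linarith)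
  · have coord (p : Sol) := congr($(relation p) 0)
    simp only [(hs _).1, (hs _).2.1, (ht _).1] at coord
    have at_zero := coord !₂[0, 0, 0]
    have at_one := coord !₂[0, 1, 0]
    simp only [Matrix.cons_val_one, Matrix.cons_val_zero] at at_zero at_one
    have coeff_eq_zero : d₀ * Real.exp m = 0 := by
      linear_combination (at_zero - at_one +
        d₀ * Real.exp m * (e₀ * e₁ * exp_mul_exp_neg l + hneg)) / 2
    exact mul_ne_zero (left_ne_zero_of_mul_eq_one hd₀) (Real.exp_ne_zero m) coeff_eq_zero

theorem eq_one_of_mul_mul [CompactSpace L] (hq : IsSolQuotient Γ q)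
    {α β : Sol ≃ₜ Sol} (hβ : β ∈ Γ) {e₀ e₁ l a b : ℝ} (he₀ : e₀ * e₀ = 1) (he₁ : e₁ * e₁ = 1)
    (hl : l ≠ 0) (hs : IsStraight e₀ e₁ l a b α) (h : β * α * β = α) : β = 1 := by
  have relation (p : Sol) : β (α (β p)) = α p := congr($h p)
  obtain ⟨d₀, d₁, m, c, d, hd₀, hd₁, ht | ht⟩ := isStraight_or_isSwap (hq.isometry hβ)
  · have height := congr($(relation 0) 2)
    simp only [(hs _).2.2, (ht _).2.2] at height
    obtain rfl : m = 0 := by linarith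
    obtain ⟨rfl, rfl⟩ := hq.eq_one_of_isStraight_zero hβ hd₀ hd₁ ht
    have coord_zero := congr($(relation 0) 0)
    have coord_one := congr($(relation 0) 1)
    simp only [(hs _).1, (hs _).2.1, (ht _).1, (ht _).2.1, Real.exp_zero, neg_zero]
      at coord_zero coord_one
    have eq_zero {e k t : ℝ} (he : e * e = 1) (hk : k ≠ 0) (ht : t + e * Real.exp k * t = 0) :
        t = 0 := by
      have ne_one := mul_exp_ne_one (e := -e) (by linear_combination he) hk
      refine (mul_eq_zero.1 (?_ : t * (1 - -e * Real.exp k) = 0)).resolve_right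
        (sub_ne_zero.2 ne_one.symm)
      linear_combination ht
    have hc : c = 0 := eq_zero he₀ hl (by linear_combination coord_zero)
    have hd : d = 0 := eq_zero he₁ (neg_ne_zero.2 hl) (by linear_combination coord_one)
    exact hq.free β hβ 0 (ht.apply_eq (by simp [hc]) (by simp [hd]) (by simp))
  · have height := congr($(relation 0) 2)
    simp only [(hs _).2.2, (ht _).2.2] at height
    exact absurd (by linarith) hl

variable {S : Type*} [TopologicalSpace S] [ChartedSpace (EuclideanSpace ℝ (Fin 2)) S] {f : S → L}

theorem not_hasNonorientableNeighborhood [IsManifold (𝓡 3) ∞ L] [T2Space L]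
    {ε : ℝ} {g : EuclideanSpace ℝ (Fin 2) → S} {F : EuclideanSpace ℝ (Fin 2) → Sol}
    {H : Subgroup (Sol ≃ₜ Sol)} (hq : IsSolQuotient Γ q) (hF : IsSurfaceLift Γ q H g f F)
    (hg : ∀ x y, PlaneRel ε x y → g x = g y) (hH : H ≤ solOrientationSubgroup) :
    ¬ HasNonorientableNeighborhood f := by
  have orientation : ∀ p ∈ F '' {s | s 0 ∈ Icc (0 : ℝ) 1 ∧ s 1 ∈ Icc (0 : ℝ) 1}, ∀ γ ∈ Γ,
      γ p ∈ F '' {s | s 0 ∈ Icc (0 : ℝ) 1 ∧ s 1 ∈ Icc (0 : ℝ) 1} → γ ∈ solOrientationSubgroup := by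
    rintro _ ⟨s, -, rfl⟩ γ hγ ⟨s', -, hs'⟩
    have base_eq : g s = g s' := hF.embedding.isEmbedding.injective (by
      rw [← hF.lift, ← hF.lift, hs', hq.apply_eq hγ])
    obtain ⟨h, hh, hhs⟩ := hF.fiber s s' base_eq
    rw [hq.eq_of_apply_eq hγ (hF.le hh) (hs'.symm.trans hhs)]
    exact hH hh
  obtain ⟨U, hU, orientable⟩ := hq.exists_isOrientableManifold
    (isCompact_unitSquare.image hF.continuous) orientation
  refine fun hn => hn U (Subset.trans ?_ hU) orientable
  rintro _ ⟨x, rfl⟩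
  obtain ⟨s, rfl⟩ := hF.surjective x
  obtain ⟨s', hs', hss'⟩ := PlaneRel.exists_mem_unitSquare ε s
  exact ⟨F s', mem_image_of_mem F hs', by rw [hF.lift, hg s s' hss']⟩

theorem isTwoSided_of_klein [IsManifold (𝓡 3) ∞ L] [T2Space L] [CompactSpace L]
    (hq : IsSolQuotient Γ q) (hS : IsKleinBottle S)
    (hf : IsSmoothEmbedding (𝓡 2) (𝓡 3) ∞ f) (hn : HasNonorientableNeighborhood f) :
    IsTwoSided f := by
  obtain ⟨g, hg⟩ : ∃ g, IsQuotientManifold (n := 2) (N := S) (PlaneRel (-1)) g := hS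
  obtain ⟨H, F, hF, α, hα, β, hβ, glide, shift, le_of_mem⟩ :=
    hq.exists_planeLift (show (-1 : ℝ) * -1 = 1 by norm_num) hg hf
  have invariant (x y) : PlaneRel (-1) x y → g x = g y := (hg.2.2 x y).2
  have : CompactSpace S := compactSpace_of_planeRel hg.1.contMDiff.continuous hg.2.1 invariant
  have relation : β * α * β = α := by
    refine hq.eq_of_apply_eq (mul_mem (mul_mem hβ hα) hβ) hα (p := F 0) ?_
    rw [Homeomorph.mul_apply, Homeomorph.mul_apply, ← shift, ← glide, ← shift, ← glide]
    congr 1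
    ext i
    fin_cases i <;> simp [planeGlide, planeShift]
  have hβO := hq.mem_orientation_of_mul_mul hα hβ relation
  by_cases hαO : α ∈ solOrientationSubgroup
  · exact absurd hn (hq.not_hasNonorientableNeighborhood hF invariant (le_of_mem _ hαO hβO))
  · obtain ⟨e₀, e₁, l, a, b, he₀, he₁, -, hl, hs⟩ :=
      hq.exists_isStraight_of_notMem_orientation hα hαO
    obtain ⟨x₀, y₀, hαx, -⟩ := hs.exists_axis he₀ he₁ hl
    refine hF.isTwoSided_of_le_axisStabilizer hq (le_of_mem _ hαx ?_)
    rw [hq.eq_one_of_mul_mul hβ he₀ he₁ hl hs relation]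
    exact one_mem _

end IsSolQuotient

/-! ### Maps from spheres -/

namespace IsSolQuotient

variable {L : Type*} [TopologicalSpace L] [ChartedSpace (EuclideanSpace ℝ (Fin 3)) L]
  {Γ : Subgroup (Sol ≃ₜ Sol)} {q : Sol → L} {A : Type*} [TopologicalSpace A] {f : A → L}

theorem exists_liftOn_source (hq : IsSolQuotient Γ q) {B : Type*} [TopologicalSpace B]
    [SimplyConnectedSpace B] [LocallyPathConnectedSpace B] (hf : Continuous f)
    (e : OpenPartialHomeomorph A B) (he : e.target = univ) :
    ∃ F : A → Sol, ContinuousOn F e.source ∧ ∀ x ∈ e.source, q (F x) = f x := by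
  have continuous_symm : Continuous e.symm :=
    continuousOn_univ.1 (he ▸ e.continuousOn_symm)
  obtain ⟨F, hF, hlift⟩ := hq.exists_lift (hf.comp continuous_symm)
  refine ⟨F ∘ e, hF.comp_continuousOn e.continuousOn, fun x hx => ?_⟩
  rw [Function.comp_apply, hlift, Function.comp_apply, e.left_inv hx]

theorem exists_lift_of_union (hq : IsSolQuotient Γ q) {U V : Set A} (hU : IsOpen U)
    (hV : IsOpen V) (hUV : U ∪ V = univ) (hconn : IsConnected (U ∩ V)) {F₁ F₂ : A → Sol}
    (hF₁ : ContinuousOn F₁ U) (hF₂ : ContinuousOn F₂ V) (lift₁ : ∀ x ∈ U, q (F₁ x) = f x)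
    (lift₂ : ∀ x ∈ V, q (F₂ x) = f x) : ∃ F : A → Sol, Continuous F ∧ ∀ x, q (F x) = f x := by
  classical
  have : ConnectedSpace ↥(U ∩ V) := isConnected_iff_connectedSpace.1 hconn
  obtain ⟨γ, hγ, transition⟩ := hq.exists_deck (A := ↥(U ∩ V)) (F := fun x => F₂ x)
    (G := fun x => F₁ x) (hF₂.comp_continuous continuous_subtype_val fun x => x.2.2)
    (hF₁.comp_continuous continuous_subtype_val fun x => x.2.1)
    fun x => (lift₂ x x.2.2).trans (lift₁ x x.2.1).symm
  let F : A → Sol := U.piecewise F₁ (γ ∘ F₂)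
  have F_eq₁ : EqOn F F₁ U := piecewise_eqOn U _ _
  have F_eq₂ : EqOn F (γ ∘ F₂) V := fun x hx => by
    by_cases hxU : x ∈ U
    · exact (F_eq₁ hxU).trans (transition ⟨x, hxU, hx⟩)
    · exact piecewise_eq_of_notMem _ _ _ hxU
  refine ⟨F, ?_, fun x => ?_⟩
  · rw [← continuousOn_univ, ← hUV]
    exact (hF₁.congr F_eq₁).union_of_isOpen ((γ.continuous.comp_continuousOn hF₂).congr F_eq₂) hU hV
  · rcases hUV.symm ▸ mem_univ x with hx | hx
    · rw [F_eq₁ hx, lift₁ x hx]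
    · rw [F_eq₂ hx, Function.comp_apply, hq.apply_eq hγ, lift₂ x hx]

end IsSolQuotient

section Sphere

variable {E : Type*} [NormedAddCommGroup E] [InnerProductSpace ℝ E] {n : ℕ}
  [Fact (Module.finrank ℝ E = n + 1)]

theorem isConnected_compl_antipodal_pair (hn : 1 < n) (v : Metric.sphere (0 : E) 1) :
    IsConnected ({v}ᶜ ∩ {-v}ᶜ : Set (Metric.sphere (0 : E) 1)) := by
  let φ := stereographic (norm_eq_of_mem_sphere v)
  have isConnected : IsConnected ({0}ᶜ : Set (ℝ ∙ (v : E))ᗮ) := by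
    refine isConnected_compl_singleton_of_one_lt_rank (Module.lt_rank_of_lt_finrank ?_) 0
    rwa [Submodule.finrank_orthogonal_span_singleton (n := n)
      (ne_zero_of_mem_unit_sphere v)]
  have neg_mem : -v ∈ φ.source := (ne_neg_of_mem_unit_sphere ℝ v).symm
  convert isConnected.image φ.symm
    (isOpenEmbedding_stereographic_symm (norm_eq_of_mem_sphere v)).continuous.continuousOn using 1
  ext x
  constructor
  · rintro ⟨hx, hx'⟩
    refine ⟨φ x, fun h0 => hx' (φ.injOn hx neg_mem ?_), φ.left_inv hx⟩
    exact Eq.trans h0 (stereographic_apply_neg v).symm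
  · rintro ⟨a, ha, rfl⟩
    refine ⟨φ.map_target (mem_univ a), fun h => ha ?_⟩
    rw [mem_singleton_iff, ← φ.right_inv (mem_univ a), mem_singleton_iff.1 h]
    exact stereographic_apply_neg v

theorem IsSolQuotient.exists_lift_sphere {L : Type*} [TopologicalSpace L]
    [ChartedSpace (EuclideanSpace ℝ (Fin 3)) L] {Γ : Subgroup (Sol ≃ₜ Sol)} {q : Sol → L}
    (hq : IsSolQuotient Γ q) (hn : 1 < n) {f : Metric.sphere (0 : E) 1 → L} (hf : Continuous f) :
    ∃ F : Metric.sphere (0 : E) 1 → Sol, Continuous F ∧ ∀ x, q (F x) = f x := by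
  have : Nontrivial E := Module.nontrivial_of_finrank_pos (R := ℝ) (by
    rw [Fact.out (p := Module.finrank ℝ E = n + 1)]
    exact n.succ_pos)
  obtain ⟨v⟩ : Nonempty (Metric.sphere (0 : E) 1) :=
    (NormedSpace.sphere_nonempty.2 zero_le_one).to_subtype
  obtain ⟨F₁, hF₁, lift₁⟩ :=
    hq.exists_liftOn_source hf (stereographic (norm_eq_of_mem_sphere v)) rfl
  obtain ⟨F₂, hF₂, lift₂⟩ :=
    hq.exists_liftOn_source hf (stereographic (norm_eq_of_mem_sphere (-v))) rfl
  refine hq.exists_lift_of_union isOpen_compl_singleton isOpen_compl_singleton ?_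
    (isConnected_compl_antipodal_pair hn v) hF₁ hF₂ lift₁ lift₂
  rw [← compl_inter, compl_univ_iff, singleton_inter_eq_empty]
  exact ne_neg_of_mem_unit_sphere ℝ v

end Sphere

section OddDimension

variable {E : Type*} [NormedAddCommGroup E] [NormedSpace ℝ E]

theorem exists_det_eq_zero_of_odd (hE : Odd (Module.finrank ℝ E)) (hE1 : 1 < Module.finrank ℝ E)
    {T : Metric.sphere (0 : E) 1 → E →L[ℝ] E} (hT : Continuous T) (hodd : ∀ x, T (-x) = -T x) :
    ∃ x, (T x).det = 0 := by
  have : Nontrivial E := Module.nontrivial_of_finrank_pos (R := ℝ) (zero_lt_one.trans hE1)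
  have : PreconnectedSpace (Metric.sphere (0 : E) 1) :=
    isPreconnected_iff_preconnectedSpace.1
      (isPreconnected_sphere (Module.lt_rank_of_lt_finrank (mod_cast hE1)) 0 1)
  obtain ⟨x⟩ : Nonempty (Metric.sphere (0 : E) 1) :=
    (NormedSpace.sphere_nonempty.2 zero_le_one).to_subtype
  have continuous_det : Continuous fun x => (T x).det :=
    ContinuousLinearMap.continuous_det.comp hT
  have det_neg : (T (-x)).det = -(T x).det := by
    have smul_eq : ((T (-x) : E →L[ℝ] E) : E →ₗ[ℝ] E) = (-1 : ℝ) • (T x : E →ₗ[ℝ] E) := by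
      rw [hodd, neg_one_smul]
      rfl
    rw [ContinuousLinearMap.det, smul_eq, LinearMap.det_smul, hE.neg_one_pow, neg_one_mul]
  rcases le_total (T x).det 0 with h | h
  · exact mem_range_of_exists_le_of_exists_ge continuous_det
      ⟨x, h⟩ ⟨-x, by rwa [det_neg, neg_nonneg]⟩
  · exact mem_range_of_exists_le_of_exists_ge continuous_det
      ⟨-x, by rwa [det_neg, neg_nonpos]⟩ ⟨x, h⟩

end OddDimension

section RadialProjection

variable {m : ℕ}

/-- The radial projection `y ↦ y / ‖y‖` to the unit sphere, with an arbitrary value at the origin.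
It extends maps defined on the sphere to maps defined on the ambient space. -/
def radialProj (y : EuclideanSpace ℝ (Fin (m + 1))) :
    Metric.sphere (0 : EuclideanSpace ℝ (Fin (m + 1))) 1 :=
  open Classical in
  if h : y = 0 then ⟨EuclideanSpace.single 0 1, by simp⟩
  else ⟨‖y‖⁻¹ • y, by simp [norm_smul, h]⟩

theorem coe_radialProj {y : EuclideanSpace ℝ (Fin (m + 1))} (hy : y ≠ 0) :
    (radialProj y : EuclideanSpace ℝ (Fin (m + 1))) = ‖y‖⁻¹ • y := by
  rw [radialProj, dif_neg hy]

theorem radialProj_coe (x : Metric.sphere (0 : EuclideanSpace ℝ (Fin (m + 1))) 1) :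
    radialProj (x : EuclideanSpace ℝ (Fin (m + 1))) = x := by
  ext1
  rw [coe_radialProj (ne_zero_of_mem_unit_sphere x), norm_eq_of_mem_sphere, inv_one, one_smul]

theorem radialProj_neg {y : EuclideanSpace ℝ (Fin (m + 1))} (hy : y ≠ 0) :
    radialProj (-y) = -radialProj y := by
  ext1
  rw [coe_radialProj (neg_ne_zero.2 hy), norm_neg, smul_neg, ← coe_radialProj hy]
  rfl

theorem radialProj_smul {y : EuclideanSpace ℝ (Fin (m + 1))} (hy : y ≠ 0) {t : ℝ} (ht : 0 < t) :
    radialProj (t • y) = radialProj y := by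
  ext1
  rw [coe_radialProj (smul_ne_zero ht.ne' hy), coe_radialProj hy, norm_smul, Real.norm_eq_abs,
    abs_of_pos ht, smul_smul, mul_inv, mul_right_comm, inv_mul_cancel₀ ht.ne', one_mul]

theorem contDiffAt_coe_radialProj {y : EuclideanSpace ℝ (Fin (m + 1))} (hy : y ≠ 0) :
    ContDiffAt ℝ ∞ (fun y => (radialProj y : EuclideanSpace ℝ (Fin (m + 1)))) y := by
  have contDiffAt_div : ContDiffAt ℝ ∞ (fun y : EuclideanSpace ℝ (Fin (m + 1)) => ‖y‖⁻¹ • y) y :=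
    ((contDiffAt_norm ℝ hy).inv (norm_ne_zero_iff.2 hy)).smul contDiffAt_id
  refine contDiffAt_div.congr_of_eventuallyEq ?_
  filter_upwards [isOpen_ne.mem_nhds hy] with z hz using coe_radialProj hz

variable {G : Type*} [NormedAddCommGroup G] [NormedSpace ℝ G]
  {F : Metric.sphere (0 : EuclideanSpace ℝ (Fin (m + 1))) 1 → G}

theorem contDiffAt_comp_radialProj (hF : ContMDiff (𝓡 m) 𝓘(ℝ, G) ∞ F)
    {y : EuclideanSpace ℝ (Fin (m + 1))} (hy : y ≠ 0) : ContDiffAt ℝ ∞ (F ∘ radialProj) y := by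
  let U : TopologicalSpace.Opens (EuclideanSpace ℝ (Fin (m + 1))) := ⟨{0}ᶜ, isOpen_compl_singleton⟩
  have smooth_coe : ContMDiff (𝓡 (m + 1)) (𝓡 (m + 1)) ∞
      fun x : U => (radialProj (x : EuclideanSpace ℝ (Fin (m + 1))) :
        EuclideanSpace ℝ (Fin (m + 1))) := fun x =>
    (contMDiffAt_subtype_iff (f := fun y : EuclideanSpace ℝ (Fin (m + 1)) =>
      (radialProj y : EuclideanSpace ℝ (Fin (m + 1))))).2
        (contDiffAt_coe_radialProj x.2).contMDiffAt
  have smooth : ContMDiff (𝓡 (m + 1)) (𝓡 m) ∞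
      fun x : U => radialProj (x : EuclideanSpace ℝ (Fin (m + 1))) :=
    smooth_coe.codRestrict_sphere fun x => (radialProj (x : EuclideanSpace ℝ (Fin (m + 1)))).2
  exact ((contMDiffAt_subtype_iff (f := F ∘ radialProj) (x := (⟨y, hy⟩ : U))).1
    (hF.comp smooth ⟨y, hy⟩)).contDiffAt

theorem fderiv_comp_radialProj_self {x : Metric.sphere (0 : EuclideanSpace ℝ (Fin (m + 1))) 1}
    (hF : DifferentiableAt ℝ (F ∘ radialProj) (x : EuclideanSpace ℝ (Fin (m + 1)))) :
    fderiv ℝ (F ∘ radialProj) (x : EuclideanSpace ℝ (Fin (m + 1))) x = 0 := by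
  refine (hF.hasFDerivAt.hasLineDerivAt (x : EuclideanSpace ℝ (Fin (m + 1)))).unique
    ((hasDerivAt_const 0 (F x)).congr_of_eventuallyEq ?_)
  filter_upwards [lt_mem_nhds neg_one_lt_zero] with t ht
  have add_smul_self : x.1 + t • x.1 = (1 + t) • x.1 := by rw [add_smul, one_smul]
  rw [add_smul_self, Function.comp_apply,
    radialProj_smul (ne_zero_of_mem_unit_sphere x) (by linarith), radialProj_coe]

theorem fderiv_comp_radialProj_neg (heven : ∀ x, F (-x) = F x)
    (x : Metric.sphere (0 : EuclideanSpace ℝ (Fin (m + 1))) 1) :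
    fderiv ℝ (F ∘ radialProj) (-x : EuclideanSpace ℝ (Fin (m + 1))) =
      -fderiv ℝ (F ∘ radialProj) (x : EuclideanSpace ℝ (Fin (m + 1))) := by
  have comp_neg : (F ∘ radialProj) ∘ ContinuousLinearEquiv.neg ℝ
      =ᶠ[𝓝 (x : EuclideanSpace ℝ (Fin (m + 1)))] F ∘ radialProj := by
    filter_upwards [isOpen_ne.mem_nhds (ne_zero_of_mem_unit_sphere x)] with y hy
    rw [Function.comp_apply, ContinuousLinearEquiv.neg_apply, Function.comp_apply,
      Function.comp_apply, radialProj_neg hy, heven]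
  rw [← comp_neg.fderiv_eq, ContinuousLinearEquiv.comp_right_fderiv,
    ContinuousLinearEquiv.neg_apply]
  ext v
  simp

theorem exists_mvfderiv_coe_sphere_eq
    (x : Metric.sphere (0 : EuclideanSpace ℝ (Fin (m + 1))) 1)
    (w : EuclideanSpace ℝ (Fin (m + 1))) :
    ∃ u, mvfderiv (𝓡 m) ((↑) : Metric.sphere (0 : EuclideanSpace ℝ (Fin (m + 1))) 1 → _) x u =
      w - inner ℝ x.1 w • x.1 := by
  have mem : w - inner ℝ x.1 w • x.1 ∈ (ℝ ∙ x.1)ᗮ := by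
    rw [Submodule.mem_orthogonal_singleton_iff_inner_right, inner_sub_right, inner_smul_right,
      real_inner_self_eq_norm_sq, norm_eq_of_mem_sphere, one_pow, mul_one, sub_self]
  rwa [← range_mvfderiv_subtypeVal (n := m) x] at mem

theorem fderiv_comp_radialProj_mvfderiv_coe (hF : ContMDiff (𝓡 m) 𝓘(ℝ, G) ∞ F)
    (x : Metric.sphere (0 : EuclideanSpace ℝ (Fin (m + 1))) 1) (u : TangentSpace (𝓡 m) x) :
    fderiv ℝ (F ∘ radialProj) x.1 (mvfderiv (𝓡 m) (↑) x u) = mvfderiv (𝓡 m) F x u := by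
  have comp_coe : (F ∘ radialProj) ∘ ((↑) : Metric.sphere (0 : EuclideanSpace ℝ _) 1 → _) = F :=
    funext fun y => congrArg F (radialProj_coe y)
  have differentiable : DifferentiableAt ℝ (F ∘ radialProj) x.1 :=
    (contDiffAt_comp_radialProj hF (ne_zero_of_mem_unit_sphere x)).differentiableAt (by simp)
  have chain := mfderiv_comp_apply x (I'' := 𝓘(ℝ, G)) differentiable.mdifferentiableAt
    ((contMDiff_coe_sphere (m := 1) (n := m) x).mdifferentiableAt one_ne_zero) u
  rw [comp_coe, mfderiv_eq_fderiv] at chain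
  exact chain.symm

/-- If `F` were an even immersion with an even transverse field `n`, then adding the radial
derivative `n` to the derivative of the homogeneous extension of `F` would give an odd map from the
sphere to the invertible endomorphisms of an odd-dimensional space. -/
theorem exists_mem_range_mfderiv_of_even (hm : Even m) (hm0 : m ≠ 0)
    {F n : Metric.sphere (0 : EuclideanSpace ℝ (Fin (m + 1))) 1 → EuclideanSpace ℝ (Fin (m + 1))}
    (hF : ContMDiff (𝓡 m) (𝓡 (m + 1)) ∞ F) (hF_even : ∀ x, F (-x) = F x)
    (injective : ∀ x, Function.Injective (mvfderiv (𝓡 m) F x)) (hn : Continuous n)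
    (hn_even : ∀ x, n (-x) = n x) : ∃ x, n x ∈ range (mvfderiv (𝓡 m) F x) := by
  let T (x : Metric.sphere (0 : EuclideanSpace ℝ (Fin (m + 1))) 1) :
      EuclideanSpace ℝ (Fin (m + 1)) →L[ℝ] EuclideanSpace ℝ (Fin (m + 1)) :=
    fderiv ℝ (F ∘ radialProj) x.1 + (innerSL ℝ x.1).smulRight (n x)
  have smooth (x : Metric.sphere (0 : EuclideanSpace ℝ (Fin (m + 1))) 1) :
      ContDiffAt ℝ ∞ (F ∘ radialProj) x.1 :=
    contDiffAt_comp_radialProj hF (ne_zero_of_mem_unit_sphere x)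
  have continuous_T : Continuous T := by
    refine Continuous.add (continuous_iff_continuousAt.2 fun x => ?_) (by fun_prop)
    exact ContinuousAt.comp (((smooth x).fderiv_right (m := 0) (by simp)).continuousAt)
      continuous_subtype_val.continuousAt
  have odd_T (x) : T (-x) = -T x := by
    ext1 v
    simp [T, hn_even, fderiv_comp_radialProj_neg hF_even, add_comm]
  obtain ⟨x, hx⟩ := exists_det_eq_zero_of_odd (by simpa using hm.add_one)
    (by simpa using Nat.pos_of_ne_zero hm0) continuous_T odd_T
  obtain ⟨w, hw, w_ne⟩ := (Submodule.ne_bot_iff _).1 (LinearMap.bot_lt_ker_of_det_eq_zero hx).ne'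
  obtain ⟨u, hu⟩ := exists_mvfderiv_coe_sphere_eq x w
  have kernel : mvfderiv (𝓡 m) F x u + inner ℝ x.1 w • n x = 0 := by
    rw [← fderiv_comp_radialProj_mvfderiv_coe hF, hu, map_sub, map_smul,
      fderiv_comp_radialProj_self ((smooth x).differentiableAt (by simp)), smul_zero, sub_zero]
    exact hw
  refine ⟨x, -(inner ℝ x.1 w)⁻¹ • u, ?_⟩
  have inner_ne : inner ℝ x.1 w ≠ 0 := fun h0 => by
    rw [h0, zero_smul, add_zero] at kernel
    have u_zero : u = 0 := injective x (kernel.trans (map_zero _).symm)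
    rw [h0, zero_smul, sub_zero, u_zero, map_zero] at hu
    exact w_ne hu.symm
  rw [map_smul, eq_neg_of_add_eq_zero_left kernel, neg_smul_neg, inv_smul_smul₀ inner_ne]

end RadialProjection

/-! ### Projective planes -/

section ProjectivePlane

namespace IsSolQuotient

variable {L : Type*} [TopologicalSpace L] [ChartedSpace (EuclideanSpace ℝ (Fin 3)) L]
  {Γ : Subgroup (Sol ≃ₜ Sol)} {q : Sol → L}
  {S : Type*} [TopologicalSpace S] [ChartedSpace (EuclideanSpace ℝ (Fin 2)) S]
  {g : Metric.sphere (0 : EuclideanSpace ℝ (Fin 3)) 1 → S} {f : S → L}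
  {F : Metric.sphere (0 : EuclideanSpace ℝ (Fin 3)) 1 → Sol}

theorem eq_one_of_mul_self (hq : IsSolQuotient Γ q) {γ : Sol ≃ₜ Sol} (hγ : γ ∈ Γ)
    (h : γ * γ = 1) : γ = 1 := by
  have fixed : γ (γ 0) = 0 := congr($h 0)
  -- An isometry of Sol is affine, so an involution fixes the midpoint of any of its orbits.
  refine hq.free γ hγ ((1 / 2 : ℝ) • γ 0) ?_
  have coord : γ (γ 0) 0 = 0 ∧ γ (γ 0) 1 = 0 ∧ γ (γ 0) 2 = 0 := by simp [fixed]
  obtain ⟨e₀, e₁, l, a, b, -, -, hs | hs⟩ := isStraight_or_isSwap (hq.isometry hγ)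
  all_goals
    simp only [(hs _).1, (hs _).2.1, (hs _).2.2] at coord
    ext i
    fin_cases i <;> simp [(hs _).1, (hs _).2.1, (hs _).2.2] at coord ⊢ <;> linarith

theorem apply_neg_sphere (hq : IsSolQuotient Γ q) (hF : Continuous F)
    (hlift : ∀ x, q (F (-x)) = q (F x)) (x : Metric.sphere (0 : EuclideanSpace ℝ (Fin 3)) 1) :
    F (-x) = F x := by
  have : ConnectedSpace (Metric.sphere (0 : EuclideanSpace ℝ (Fin 3)) 1) :=
    isConnected_iff_connectedSpace.1 (isConnected_sphere
      (Module.lt_rank_of_lt_finrank (by simp)) 0 zero_le_one)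
  obtain ⟨γ, hγ, F_neg⟩ := hq.exists_deck hF (hF.comp continuous_neg) fun x => (hlift x).symm
  replace F_neg (x) : F (-x) = γ (F x) := F_neg x
  have γ_eq : γ = 1 := hq.eq_one_of_mul_self hγ (hq.free _ (mul_mem hγ hγ) (F x) (by
    rw [Homeomorph.mul_apply, ← F_neg, ← F_neg, neg_neg]))
  rw [F_neg, γ_eq, Homeomorph.one_apply]

theorem exists_isSurfaceLift_of_isProjectivePlane (hq : IsSolQuotient Γ q)
    (hg : IsQuotientManifold (n := 2) (fun x y => y = x ∨ y = -x) g)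
    (hf : IsSmoothEmbedding (𝓡 2) (𝓡 3) ∞ f) :
    ∃ F : Metric.sphere (0 : EuclideanSpace ℝ (Fin 3)) 1 → Sol,
      IsSurfaceLift Γ q ⊥ g f F ∧ ∀ x, F (-x) = F x := by
  have : Fact (Module.finrank ℝ (EuclideanSpace ℝ (Fin 3)) = 2 + 1) := ⟨by simp⟩
  obtain ⟨hg, g_surjective, fiber⟩ := hg
  obtain ⟨F, hF, hlift⟩ := hq.exists_lift_sphere one_lt_two
    (hf.contMDiff.continuous.comp hg.contMDiff.continuous)
  replace hlift (x) : q (F x) = f (g x) := hlift x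
  have F_neg := hq.apply_neg_sphere hF fun x => by
    rw [hlift, hlift, (fiber x (-x)).2 (Or.inr rfl)]
  refine ⟨F, ?_, F_neg⟩
  exact
    { le := bot_le
      diffeo := hg
      surjective := g_surjective
      embedding := hf
      continuous := hF
      lift := hlift
      fiber := fun s s' h => by
        refine ⟨1, one_mem _, ?_⟩
        rcases (fiber s s').1 h with rfl | rfl
        · rfl
        · exact F_neg s
      invariant := fun h hh s => ⟨s, rfl, by rw [Subgroup.mem_bot.1 hh, Homeomorph.one_apply]⟩ }

theorem not_isProjectivePlane [IsManifold (𝓡 3) ∞ L] [T2Space L] [IsManifold (𝓡 2) ∞ S]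
    (hq : IsSolQuotient Γ q) (hf : IsSmoothEmbedding (𝓡 2) (𝓡 3) ∞ f) :
    ¬ IsProjectivePlane S := by
  rintro ⟨g, hg⟩
  obtain ⟨F, hF, F_neg⟩ := hq.exists_isSurfaceLift_of_isProjectivePlane hg hf
  have : CompactSpace S :=
    ⟨hF.surjective.range_eq ▸ isCompact_range hF.diffeo.contMDiff.continuous⟩
  obtain ⟨P, hP⟩ := hF.exists_isSide hq
  obtain ⟨ν, continuousOn, conormal⟩ := hP.exists_conormal
  replace conormal (x) : IsConormal P (F x) (ν (F x)) := conormal _ (mem_range_self x)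
  let n (x : Metric.sphere (0 : EuclideanSpace ℝ (Fin 3)) 1) : Sol := solNormal (F x) (ν (F x))
  have continuous_n : Continuous n := continuous_solNormal hF.continuous
    (continuousOn.comp_continuous hF.continuous mem_range_self) fun x => (conormal x).ne_zero
  obtain ⟨x, u, hu⟩ := exists_mem_range_mfderiv_of_even even_two two_ne_zero (hF.contMDiff hq)
    F_neg (hF.mfderiv_injective hq) continuous_n fun x => by simp only [n, F_neg]
  refine (apply_solNormal_pos (p := F x) (conormal x).ne_zero).ne' ?_
  rw [← hF.conormal_mfderiv hq hP (conormal x) u]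
  exact congrArg _ hu.symm

end IsSolQuotient
end ProjectivePlane

theorem IsSolManifold.exists_isSolQuotient {L : Type*} [TopologicalSpace L]
    [ChartedSpace (EuclideanSpace ℝ (Fin 3)) L] (hL : IsSolManifold L) :
    ∃ Γ q, IsSolQuotient (L := L) Γ q := by
  obtain ⟨Γ, isometry, -, free, q, diffeo, surjective, fiber⟩ := hL
  exact ⟨Γ, q, isometry, free, diffeo, surjective, fiber⟩

end

theorem mainTheorem8 (L : Type*) [TopologicalSpace L] [T2Space L] [CompactSpace L]
    [ChartedSpace (EuclideanSpace ℝ (Fin 3)) L] [IsManifold (𝓡 3) ∞ L]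
    (hL : IsSolManifold L) :
    (¬ ∃ (S : Type*) (_ : TopologicalSpace S) (_ : ChartedSpace (EuclideanSpace ℝ (Fin 2)) S)
        (_ : IsManifold (𝓡 2) ∞ S) (f : S → L),
        IsProjectivePlane S ∧ IsSmoothEmbedding (𝓡 2) (𝓡 3) ∞ f) ∧
    (¬ ∃ (S : Type*) (_ : TopologicalSpace S) (_ : ChartedSpace (EuclideanSpace ℝ (Fin 2)) S)
        (_ : IsManifold (𝓡 2) ∞ S) (f : S → L),
        IsTwoTorus S ∧ IsSmoothEmbedding (𝓡 2) (𝓡 3) ∞ f ∧ ¬ IsTwoSided f) ∧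
    (¬ ∃ (S : Type*) (_ : TopologicalSpace S) (_ : ChartedSpace (EuclideanSpace ℝ (Fin 2)) S)
        (_ : IsManifold (𝓡 2) ∞ S) (f : S → L),
        IsKleinBottle S ∧ IsSmoothEmbedding (𝓡 2) (𝓡 3) ∞ f ∧ ¬ IsTwoSided f ∧
          HasNonorientableNeighborhood f) := by
  obtain ⟨Γ, q, hq⟩ := hL.exists_isSolQuotient
  refine ⟨?_, ?_, ?_⟩
  · rintro ⟨S, _, _, _, f, hS, hf⟩
    exact hq.not_isProjectivePlane hf hS
  · rintro ⟨S, _, _, _, f, hS, hf, h⟩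
    exact h (hq.isTwoSided_of_torus hS hf)
  · rintro ⟨S, _, _, _, f, hS, hf, h, hn⟩
    exact h (hq.isTwoSided_of_klein hS hf hn)
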